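/- Let $k$ be a field, $X$ a topological space, $Y$ a metric space and $f\colon X\to Y$ continuous. The Leray (pre)cosheaf $\mathcal L^f=\bigoplus_{n\ge 0}\mathcal L^f_n$ on $Y$ is the functor on open sets $V\subseteq Y$ with values in graded $k$-vector spaces given by $\mathcal L^f_n(V)=H_n(f^{-1}(V);k)$ (singular homology), with the maps induced by inclusions. A finite 1D cover of $f(X)$ is a finite family $\mathcal U=(U_i)_{i\in I}$ of open subsets of $Y$ with $f(X)\subseteq\bigcup_i U_i$ whose nerve $\mathcal N_{\mathcal U}=\{\emptyset\ne\sigma\subseteq I : U_\sigma:=\bigcap_{i\in\sigma}U_i\neq\emptyset\}$ is a simplicial complex of dimension at most one. The cellular Leray cosheaf $D_{\mathcal U}\mathcal L^f$ is the cosheaf $\sigma\mapsto\mathcal L^f(U_\sigma)$ on $\mathcal N_{\mathcal U}$, with maps $\mathcal L^f(U_\tau\subseteq U_\sigma)$ for $\sigma\subseteq\tau$. For $V\subseteq Y$ open let $K_V=\{\sigma\in\mathcal N_{\mathcal U}: U_\sigma\cap V\ne\emptyset\}$. The continuous extension $C_{\mathcal U}D_{\mathcal U}\mathcal L^f$ is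 the (pre)cosheaf of graded vector spaces on $Y$ whose degree $n$ part is $$V\mapsto H_0\big(K_V;D_{\mathcal U}\mathcal L^f_n|_{K_V}\big)\oplus H_1\big(K_V;D_{\mathcal U}\mathcal L^f_{n-1}|_{K_V}\big)\qquad(\mathcal L^f_{-1}:=0),$$ where $H_i(K_V;-)$ is simplicial homology with coefficients in a cosheaf, with the maps induced by $K_V\subseteq K_W$ for $V\subseteq W$. For $\epsilon>0$ put $V^\epsilon=\{y\in Y: d(y,V)<\epsilon\}$, and $V^0=V$. For a (pre)cosheaf $F$ on $Y$ let $F^\bullet$ be the family $(F^\epsilon)_{\epsilon\ge0}$ of (pre)cosheaves $F^\epsilon(V)=F(V^\epsilon)$ with the structure maps $F^\epsilon\to F^\delta$, $\epsilon\le\delta$. Let $d(F,G)\in[0,\infty]$ be the interleaving distance of $F^\bullet$ and $G^\bullet$, i.e. the infimum of all $\delta\ge0$ for which there are morphisms $\varphi_\epsilon\colon F^\epsilon\to G^{\epsilon+\delta}$ and $\psi_\epsilon\colon G^\epsilon\to F^{\epsilon+\delta}$, natural in $\epsilon$, whose composites $\psi_{\epsilon+\delta}\varphi_\epsilon$ and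 $\varphi_{\epsilon+\delta}\psi_\epsilon$ are the structure maps $F^\epsilon\to F^{\epsilon+2\delta}$ and $G^\epsilon\to G^{\epsilon+2\delta}$ (for (pre)cosheaves of graded vector spaces, morphisms preserve degrees). Let $\operatorname{res}(\mathcal U)=\sup_{i}\sup_{x,y\in U_i}d(x,y)\in[0,\infty]$. Then for every finite 1D cover $\mathcal U$ of $f(X)$ $$d\big(C_{\mathcal U}D_{\mathcal U}\mathcal L^f,\mathcal L^f\big)\le\operatorname{res}(\mathcal U).$$ Consequently, if $(\mathcal U_j)_j$ is a sequence (or, more generally, a family along any filter) of finite 1D covers of $f(X)$ with $\operatorname{res}(\mathcal U_j)\to0$, then $d\big(C_{\mathcal U_j}D_{\mathcal U_j}\mathcal L^f,\mathcal L^f\big)\to0$. -/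

import Mathlib

open CategoryTheory CategoryTheory.Limits TopologicalSpace Filter Topology
open scoped NNReal ENNReal DirectSum

universe u v w

noncomputable section

namespace LerayCosheaf

/-! ### Cosheaves on simplicial complexes and their homology -/

section Cellular

variable {ι : Type} [LinearOrder ι] (k : Type u) [Field k]

set_option linter.unusedSectionVars false

/-- The face poset of a simplicial complex: `σ ≤ τ` iff `σ` is a face of `τ`. -/
abbrev Face (K : PreAbstractSimplicialComplex ι) : Type := {σ : Finset ι // σ ∈ K}

/-- A (cellular) cosheaf of vector spaces on a simplicial complex `K`: a vector space `F σ` for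
every simplex and functorial maps `F τ ⟶ F σ` for every face relation `σ ≤ τ`. -/
abbrev CellularCosheaf (K : PreAbstractSimplicialComplex ι) := (Face K)ᵒᵖ ⥤ ModuleCat.{u} k

variable {k}

/-- The restriction of a cosheaf on `K` to a subcomplex `L`. -/
abbrev CellularCosheaf.restrict {K L : PreAbstractSimplicialComplex ι} (F : CellularCosheaf k K)
    (h : L ≤ K) : CellularCosheaf k L where
  obj σ := F.obj (Opposite.op ⟨σ.unop.1, h σ.unop.2⟩)
  map e := F.map (homOfLE (leOfHom e.unop)).op
  map_id _ := F.map_id _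
  map_comp _ _ := F.map_comp _ _

/-- The simplices of dimension `p`, i.e. those with `p + 1` vertices. -/
abbrev Simplex (K : PreAbstractSimplicialComplex ι) (p : ℕ) : Type :=
  {σ : Face K // σ.1.card = p + 1}

/-- The codimension one face of `σ` opposite to the vertex `i`. -/
def Simplex.face {K : PreAbstractSimplicialComplex ι} {p : ℕ} (σ : Simplex K (p + 1))
    (i : σ.1.1) : Simplex K p :=
  ⟨⟨σ.1.1.erase i, (K.isRelLowerSet_faces σ.1.2).2 (Finset.erase_subset _ _) (by
      have h := Finset.card_erase_of_mem i.2
      have h' := σ.2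
      exact Finset.card_pos.1 (by omega))⟩, by
    have h := Finset.card_erase_of_mem i.2
    have h' := σ.2
    change (σ.1.1.erase i).card = _
    omega⟩

lemma Simplex.face_le {K : PreAbstractSimplicialComplex ι} {p : ℕ} (σ : Simplex K (p + 1))
    (i : σ.1.1) : (σ.face i).1 ≤ σ.1 :=
  Finset.erase_subset _ _

/-- The incidence number of `σ` and its face opposite to `i`: it is `(-1) ^ j` if
`σ = {i₀ < ⋯ < iₚ}` and `i = iⱼ`. -/
def Simplex.sign {K : PreAbstractSimplicialComplex ι} {p : ℕ} (σ : Simplex K p)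
    (i : σ.1.1) : ℤ :=
  (-1) ^ (σ.1.1.filter (· < (i : ι))).card

namespace CellularCosheaf

variable {K : PreAbstractSimplicialComplex ι} (F : CellularCosheaf k K)

/-- The `p`-chains with coefficients in the cosheaf `F`. -/
abbrev Chains (p : ℕ) : Type u := ⨁ σ : Simplex K p, F.obj (Opposite.op σ.1)

/-- The inclusion of the summand of the simplex `σ`. -/
abbrev ofSimplex {p : ℕ} (σ : Simplex K p) : F.obj (Opposite.op σ.1) →ₗ[k] F.Chains p :=
  DirectSum.lof k (Simplex K p) (fun σ => F.obj (Opposite.op σ.1)) σ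

/-- The extension map `F τ → F σ` of a face relation `σ ≤ τ`. -/
abbrev extension {σ τ : Face K} (h : σ ≤ τ) : F.obj (Opposite.op τ) →ₗ[k] F.obj (Opposite.op σ) :=
  (F.map (homOfLE h).op).hom

/-- The boundary map: on the summand `F σ` it is the signed sum of the extension maps
`F σ → F τ` over the codimension one faces `τ` of `σ`. -/
def boundary (p : ℕ) : F.Chains (p + 1) →ₗ[k] F.Chains p :=
  DirectSum.toModule k _ _ fun σ =>
    ∑ i : σ.1.1, σ.sign i • (F.ofSimplex (σ.face i) ∘ₗ F.extension (σ.face_le i))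

lemma boundary_ofSimplex {p : ℕ} (σ : Simplex K (p + 1)) (x : F.obj (Opposite.op σ.1)) :
    F.boundary p (F.ofSimplex σ x) =
      ∑ i : σ.1.1, σ.sign i • F.ofSimplex (σ.face i) (F.extension (σ.face_le i) x) := by
  simp [boundary, ofSimplex, DirectSum.toModule_lof, LinearMap.sum_apply]

lemma extension_extension {σ τ ρ : Face K} (h : σ ≤ τ) (h' : τ ≤ ρ) (x : F.obj (Opposite.op ρ)) :
    F.extension h (F.extension h' x) = F.extension (h.trans h') x := by
  have : (homOfLE (h.trans h')).op = (homOfLE h').op ≫ (homOfLE h).op := rfl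
  simp only [extension]
  rw [this, F.map_comp]
  rfl

lemma ofSimplex_congr {p : ℕ} {ρ : Face K} {σ τ : Simplex K p} (e : σ.1.1 = τ.1.1)
    (h : σ.1 ≤ ρ) (h' : τ.1 ≤ ρ) (x : F.obj (Opposite.op ρ)) :
    F.ofSimplex σ (F.extension h x) = F.ofSimplex τ (F.extension h' x) := by
  obtain rfl : σ = τ := Subtype.ext (Subtype.ext e)
  rfl

lemma card_filter_erase (s : Finset ι) {i j : ι} (hi : i ∈ s) (h : i < j) :
    ((s.erase i).filter (· < j)).card + 1 = (s.filter (· < j)).card := by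
  rw [Finset.filter_erase]
  exact Finset.card_erase_add_one (by simp [hi, h])

lemma card_filter_erase' (s : Finset ι) {i j : ι} (h : j < i) :
    ((s.erase i).filter (· < j)).card = (s.filter (· < j)).card := by
  rw [Finset.filter_erase, Finset.erase_eq_of_notMem]
  simp [h.le]

lemma sign_cancel (s : Finset ι) {i j : ι} (hi : i ∈ s) (hj : j ∈ s) (h : i ≠ j) :
    (-1 : ℤ) ^ (s.filter (· < i)).card * (-1) ^ ((s.erase i).filter (· < j)).card +
      (-1 : ℤ) ^ (s.filter (· < j)).card * (-1) ^ ((s.erase j).filter (· < i)).card = 0 := by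
  rcases lt_or_gt_of_ne h with h | h
  · rw [card_filter_erase' s h, ← card_filter_erase s hi h, pow_succ]
    ring
  · rw [card_filter_erase' s h, ← card_filter_erase s hj h, pow_succ]
    ring

lemma boundary_boundary (p : ℕ) (x : F.Chains (p + 2)) :
    F.boundary p (F.boundary (p + 1) x) = 0 := by
  suffices h : F.boundary p ∘ₗ F.boundary (p + 1) = 0 from LinearMap.congr_fun h x
  refine DirectSum.linearMap_ext k fun σ => LinearMap.ext fun x => ?_
  change F.boundary p (F.boundary (p + 1) (F.ofSimplex σ x)) = 0
  rw [boundary_ofSimplex, map_sum]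
  simp only [map_zsmul, boundary_ofSimplex, extension_extension, Finset.smul_sum, smul_smul]
  rw [← Finset.sum_sigma' Finset.univ (fun _ => Finset.univ)
    (fun (i : σ.1.1) (j : (σ.face i).1.1) => (σ.sign i * (σ.face i).sign j) •
      F.ofSimplex ((σ.face i).face j)
        (F.extension (((σ.face i).face_le j).trans (σ.face_le i)) x)) |>.symm]
  have mem : ∀ a : (Σ i : σ.1.1, (σ.face i).1.1), a.2.1 ∈ σ.1.1 ∧ a.2.1 ≠ a.1.1 := fun a =>
    ⟨Finset.mem_of_mem_erase a.2.2, Finset.ne_of_mem_erase a.2.2⟩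
  refine Finset.sum_involution
    (fun a _ => ⟨⟨a.2.1, (mem a).1⟩, ⟨a.1.1, Finset.mem_erase.2 ⟨(mem a).2.symm, a.1.2⟩⟩⟩)
    ?_ ?_ ?_ ?_
  · rintro ⟨i, j⟩ -
    have h := mem ⟨i, j⟩
    have e := F.ofSimplex_congr (σ := (σ.face i).face j)
      (τ := (σ.face ⟨j.1, h.1⟩).face ⟨i.1, Finset.mem_erase.2 ⟨h.2.symm, i.2⟩⟩)
      Finset.erase_right_comm (((σ.face i).face_le j).trans (σ.face_le i))
      ((Simplex.face_le _ _).trans (σ.face_le _)) x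
    refine (congrArg (fun y => _ • y + _) e).trans ((add_smul _ _ _).symm.trans ?_)
    convert zero_smul ℤ _
    exact sign_cancel σ.1.1 i.2 h.1 h.2.symm
  · rintro ⟨i, j⟩ - - e
    have h := (mem ⟨i, j⟩).2
    exact h (congrArg (fun a : (Σ i : σ.1.1, (σ.face i).1.1) => a.1.1) e)
  · intros; simp
  · rintro ⟨i, j⟩ -
    rfl

/-- The chain complex of `K` with coefficients in the cosheaf `F`. -/
def chainComplex : ChainComplex (ModuleCat.{u} k) ℕ :=
  ChainComplex.of (fun p => ModuleCat.of k (F.Chains p)) (fun p => ModuleCat.ofHom (F.boundary p))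
    fun p => by
      ext1
      exact LinearMap.ext fun x => F.boundary_boundary p x

/-- A simplex of a subcomplex, viewed as a simplex of a larger complex. -/
abbrev _root_.LerayCosheaf.Simplex.incl {L M : PreAbstractSimplicialComplex ι} (h : L ≤ M) {p : ℕ}
    (σ : Simplex L p) : Simplex M p :=
  ⟨⟨σ.1.1, h σ.1.2⟩, σ.2⟩

/-- For subcomplexes `L ≤ M` of `K`, the inclusion of `p`-chains with coefficients in the
restrictions of `F`: on every summand `F σ` it is the identity. -/
def chainsIncl {L M : PreAbstractSimplicialComplex ι} (hM : M ≤ K) (h : L ≤ M) (p : ℕ) :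
    (F.restrict (h.trans hM)).Chains p →ₗ[k] (F.restrict hM).Chains p :=
  DirectSum.toModule k _ _ fun σ => (F.restrict hM).ofSimplex (σ.incl h)

lemma chainsIncl_ofSimplex {L M : PreAbstractSimplicialComplex ι} (hM : M ≤ K) (h : L ≤ M)
    {p : ℕ} (σ : Simplex L p) (x : (F.restrict (h.trans hM)).obj (Opposite.op σ.1)) :
    F.chainsIncl hM h p ((F.restrict (h.trans hM)).ofSimplex σ x) =
      (F.restrict hM).ofSimplex (σ.incl h) x := by
  unfold chainsIncl
  erw [DirectSum.toModule_lof]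

lemma chainsIncl_boundary {L M : PreAbstractSimplicialComplex ι} (hM : M ≤ K) (h : L ≤ M)
    (p : ℕ) (x : (F.restrict (h.trans hM)).Chains (p + 1)) :
    F.chainsIncl hM h p ((F.restrict (h.trans hM)).boundary p x) =
      (F.restrict hM).boundary p (F.chainsIncl hM h (p + 1) x) := by
  suffices e : F.chainsIncl hM h p ∘ₗ (F.restrict (h.trans hM)).boundary p =
      (F.restrict hM).boundary p ∘ₗ F.chainsIncl hM h (p + 1) from LinearMap.congr_fun e x
  refine DirectSum.linearMap_ext k fun σ => LinearMap.ext fun x => ?_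
  change F.chainsIncl hM h p ((F.restrict (h.trans hM)).boundary p
      ((F.restrict (h.trans hM)).ofSimplex σ x)) =
    (F.restrict hM).boundary p (F.chainsIncl hM h (p + 1)
      ((F.restrict (h.trans hM)).ofSimplex σ x))
  rw [chainsIncl_ofSimplex, boundary_ofSimplex, map_sum]
  refine Eq.trans ?_ (boundary_ofSimplex (F.restrict hM) (σ.incl h) x).symm
  refine Finset.sum_congr rfl fun i _ => ?_
  rw [map_zsmul, chainsIncl_ofSimplex]
  rfl

/-- The chain complexes of the subcomplexes `L ≤ K` with coefficients in the restrictions of `F`,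
together with the chain maps induced by the inclusions of subcomplexes. -/
def chainComplexFunctor : Set.Iic K ⥤ ChainComplex (ModuleCat.{u} k) ℕ where
  obj L := (F.restrict L.2).chainComplex
  map {L M} h := ChainComplex.ofHom
    (fun p => ModuleCat.ofHom (F.chainsIncl M.2 (leOfHom h) p)) fun p => by
      simp only [chainComplex, ChainComplex.of_d]
      ext1
      exact LinearMap.ext fun x => (F.chainsIncl_boundary M.2 (leOfHom h) p x).symm
  map_id L := by
    ext1 p
    refine ModuleCat.hom_ext (DirectSum.linearMap_ext k fun σ => LinearMap.ext fun x => ?_)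
    exact F.chainsIncl_ofSimplex L.2 le_rfl σ x
  map_comp {L M N} h g := by
    ext1 p
    refine ModuleCat.hom_ext (DirectSum.linearMap_ext k fun σ => LinearMap.ext fun x => ?_)
    change F.chainsIncl N.2 _ p ((F.restrict L.2).ofSimplex σ x) =
      F.chainsIncl N.2 (leOfHom g) p (F.chainsIncl M.2 (leOfHom h) p
        ((F.restrict L.2).ofSimplex σ x))
    erw [chainsIncl_ofSimplex, chainsIncl_ofSimplex, chainsIncl_ofSimplex]

/-- The degree `i` homology `H_i(L; F|_L)` of the subcomplexes `L ≤ K`, and the maps induced by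
inclusions of subcomplexes. -/
def homology (i : ℕ) : Set.Iic K ⥤ ModuleCat.{u} k :=
  F.chainComplexFunctor ⋙ HomologicalComplex.homologyFunctor _ _ i

end CellularCosheaf

end Cellular

/-! ### The Leray (pre)cosheaf, its cellular version, and the continuous extension -/

section Leray

variable (k : Type u) [Field k] {X : Type u} [TopologicalSpace X] {Y : Type v}
  [TopologicalSpace Y]

/-- The degree `n` part of the Leray (pre)cosheaf of `f`: the assignment
`V ↦ H_n(f⁻¹(V); k)` (singular homology), with the maps induced by inclusions. -/
def leray (f : C(X, Y)) (n : ℕ) : Opens Y ⥤ ModuleCat.{u} k :=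
  (OrderHomClass.mono (Opens.comap f)).functor ⋙ Opens.toTopCat (TopCat.of X) ⋙
    (AlgebraicTopology.singularHomologyFunctor (ModuleCat.{u} k) n).obj (ModuleCat.of k k)

/-- The graded Leray (pre)cosheaf `V ↦ ⨁ₙ H_n(f⁻¹(V); k)`, as a (pre)cosheaf of graded
vector spaces. -/
def gradedLeray (f : C(X, Y)) : Opens Y ⥤ GradedObject ℕ (ModuleCat.{u} k) :=
  Functor.pi' (leray k f)

variable {ι : Type} [LinearOrder ι] (U : ι → Opens Y)

/-- The intersection `U_σ` of the cover elements indexed by `σ`. -/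
abbrev inter {ι : Type} (U : ι → Opens Y) (σ : Finset ι) : Opens Y := σ.inf U

lemma inter_anti {ι : Type} (U : ι → Opens Y) {σ τ : Finset ι} (h : σ ⊆ τ) : inter U τ ≤ inter U σ := Finset.inf_mono h

/-- The complex `K_V` of all `σ` such that `U_σ` meets `V`. -/
def meeting (V : Opens Y) : PreAbstractSimplicialComplex ι where
  faces := {σ | σ.Nonempty ∧ ((inter U σ : Set Y) ∩ V).Nonempty}
  isRelLowerSet_faces := fun _ hσ => ⟨hσ.1, fun _ hτσ hτ =>
    ⟨hτ, hσ.2.mono (Set.inter_subset_inter_left _ (inter_anti U hτσ))⟩⟩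

/-- The nerve complex of the family `U`: all `σ` such that `U_σ` is nonempty. -/
def nerve : PreAbstractSimplicialComplex ι where
  faces := {σ | σ.Nonempty ∧ (inter U σ : Set Y).Nonempty}
  isRelLowerSet_faces := fun _ hσ => ⟨hσ.1, fun _ hτσ hτ =>
    ⟨hτ, hσ.2.mono (inter_anti U hτσ)⟩⟩

/-- `V ↦ K_V` as a functor to the subcomplexes of the nerve. -/
def meetingFunctor : Opens Y ⥤ Set.Iic (nerve U) :=
  Monotone.functor (f := fun V =>
      (⟨meeting U V, fun _ hσ => ⟨hσ.1, hσ.2.mono Set.inter_subset_left⟩⟩ : Set.Iic (nerve U)))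
    fun _ _ hVW _ hσ => ⟨hσ.1, hσ.2.mono (Set.inter_subset_inter_right _ hVW)⟩

/-- The degree `n` part of the cellular Leray cosheaf `D_U L^f`, a cosheaf on the nerve of `U`:
`σ ↦ L^f_n(U_σ)` with the maps `L^f_n(U_τ ⊆ U_σ)` for `σ ≤ τ`. -/
def cellularLeray (f : C(X, Y)) (n : ℕ) : CellularCosheaf k (nerve U) :=
  { obj := fun σ => inter U σ.unop.1
    map := fun h => homOfLE (inter_anti U (leOfHom h.unop)) } ⋙ leray k f n

/-- The degree `n` part of the continuous extension:
`V ↦ H_0(K_V; D_U L^f_n) ⊕ H_1(K_V; D_U L^f_{n-1})`, where `L^f_{-1} = 0`. -/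
def continuousExtension (f : C(X, Y)) : ℕ → (Opens Y ⥤ ModuleCat.{u} k)
  | 0 => meetingFunctor U ⋙ (cellularLeray k U f 0).homology 0
  | n + 1 => (meetingFunctor U ⋙ (cellularLeray k U f (n + 1)).homology 0) ⊞
      (meetingFunctor U ⋙ (cellularLeray k U f n).homology 1)

/-- The continuous extension `C_U D_U L^f`, as a (pre)cosheaf of graded vector spaces. -/
def gradedContinuousExtension (f : C(X, Y)) : Opens Y ⥤ GradedObject ℕ (ModuleCat.{u} k) :=
  Functor.pi' (continuousExtension k U f)

/-- A finite open cover of `f(X)` whose nerve complex is (at most) one-dimensional. -/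
structure IsFinite1DCover (f : C(X, Y)) : Prop where
  finite : Finite ι
  covers : Set.range f ⊆ ⋃ i, (U i : Set Y)
  dim_le_one : ∀ σ ∈ nerve U, σ.card ≤ 2

end Leray

/-! ### The interleaving distance -/

section Interleaving

/-- The shift `ε ↦ ε + δ` on `[0, ∞)`. -/
def shift (δ : ℝ≥0) : ℝ≥0 ⥤ ℝ≥0 :=
  Monotone.functor (f := fun ε => ε + δ) fun _ _ h => add_le_add_left h δ

/-- Two families parameterized by `[0, ∞)` are `δ`-interleaved if there are morphisms
`φ_ε : M ε ⟶ N (ε + δ)` and `ψ_ε : N ε ⟶ M (ε + δ)`, natural in `ε`, whose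
composites are the structure morphisms `M ε ⟶ M (ε + 2δ)` and `N ε ⟶ N (ε + 2δ)`. -/
def IsInterleaved {B : Type*} [Category B] (δ : ℝ≥0) (M N : ℝ≥0 ⥤ B) : Prop :=
  ∃ (φ : M ⟶ shift δ ⋙ N) (ψ : N ⟶ shift δ ⋙ M),
    (∀ ε : ℝ≥0, φ.app ε ≫ ψ.app (ε + δ) =
      M.map (homOfLE (le_self_add.trans le_self_add : ε ≤ ε + δ + δ))) ∧
    (∀ ε : ℝ≥0, ψ.app ε ≫ φ.app (ε + δ) =
      N.map (homOfLE (le_self_add.trans le_self_add : ε ≤ ε + δ + δ)))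

/-- The interleaving distance (`∞` if there is no interleaving). -/
def interleavingDist {B : Type*} [Category B] (M N : ℝ≥0 ⥤ B) : ℝ≥0∞ :=
  ⨅ (δ : ℝ≥0) (_ : IsInterleaved δ M N), (δ : ℝ≥0∞)

variable {Y : Type v} [MetricSpace Y]

/-- The open `ε`-thickening `V^ε = {y | d(y, V) < ε}` for `ε > 0`, and `V^0 = V`
(for `ε > 0` the set `V` is contained in its thickening, and for `ε = 0` the latter is empty). -/
def thicken (ε : ℝ≥0) (V : Opens Y) : Opens Y :=
  V ⊔ ⟨Metric.thickening ε V, Metric.isOpen_thickening⟩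

lemma coe_thicken_of_pos {ε : ℝ≥0} (hε : 0 < ε) (V : Opens Y) :
    (thicken ε V : Set Y) = Metric.thickening ε V :=
  Set.union_eq_self_of_subset_left (Metric.self_subset_thickening (by exact_mod_cast hε) _)

lemma thicken_zero (V : Opens Y) : thicken 0 V = V := by
  ext y
  simp [thicken, Metric.thickening_of_nonpos]

lemma thicken_mono {ε δ : ℝ≥0} (h : ε ≤ δ) {V W : Opens Y} (hVW : V ≤ W) :
    thicken ε V ≤ thicken δ W :=
  sup_le_sup hVW ((Metric.thickening_mono (by exact_mod_cast h) _).trans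
    (Metric.thickening_subset_of_subset _ hVW))

/-- `(ε, V) ↦ V^ε` as a functor. -/
def thickenFunctor : ℝ≥0 ⥤ Opens Y ⥤ Opens Y where
  obj ε := Monotone.functor (f := thicken ε) fun _ _ h => thicken_mono le_rfl h
  map h := { app := fun _ => homOfLE (thicken_mono (leOfHom h) le_rfl) }

/-- The parameterized family `F^•` of (pre)cosheaves, `F^ε(V) = F(V^ε)`. -/
def parameterized {A : Type*} [Category A] (F : Opens Y ⥤ A) : ℝ≥0 ⥤ Opens Y ⥤ A :=
  thickenFunctor ⋙ (Functor.whiskeringRight _ _ _).obj F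

/-- The distance of two (pre)cosheaves on a metric space. -/
def precosheafDist {A : Type*} [Category A] (F G : Opens Y ⥤ A) : ℝ≥0∞ :=
  interleavingDist (parameterized F) (parameterized G)

/-- The resolution of a family of open sets, `sup_i sup_{x, y ∈ U_i} d(x, y)`. -/
def res {ι : Type} (U : ι → Opens Y) : ℝ≥0∞ :=
  ⨆ (i : ι) (x ∈ U i) (y ∈ U i), edist x y

end Interleaving

end LerayCosheaf

end

/-! Both cosheaves are rewritten through one homology functor on graphs of subsets of `X`; the
interleaving then reduces to inclusions of sets. Given sets A_i at the vertices and A_ij at the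
edges, take the total complex of singular n-chains on the vertices and (n-1)-chains on the edges.
Its homology is `graphHomologyFunctor`, functorial for inclusions. Every open V gives two such
graphs: Q(V) = `coverGraph f U V`, made of f⁻¹(U_i ∩ V) and f⁻¹(U_i ∩ U_j ∩ V), and P(V) =
`preimageGraph f U (meeting U V)`, made of the full preimages f⁻¹(U_σ) for σ in K_V.

Q computes the Leray cosheaf (`lerayIso`). Triple intersections are empty, so 0 → ⊕ C(A_i ∩ A_j) → ⊕
C(A_i) → (small chains) → 0 is exact (`eq_zero_of_edgeBoundary_eq_zero`, `exists_edgeBoundary_eq`,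
`exists_sum_eq_of_mem_small`). The small simplices theorem `exists_sub_boundary_mem_small`, proved
by barycentric subdivision, passes from small chains to all chains.

P computes the continuous extension (`continuousExtensionIso`). For a one-dimensional nerve the
spectral sequence of the double complex reduces to a short exact sequence with outer terms H_0(K_V;
L_n) and H_1(K_V; L_{n-1}). Over a field it is split by linear choices of representing cycles and of
fillings (`vertexMap_coprod_edgeMap_bijective`). These choices are made once in each f⁻¹(U_σ),
independently of V, so the splitting is natural in V.

Finally Q(V) ≤ P(V), because a point of U_σ ∩ V witnesses σ ∈ K_V; and P(V) ≤ Q(V^δ) for δ > res(U),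
because a U_σ that meets V lies in V^δ. Morphisms in a preorder are unique, so functoriality yields
all the interleaving identities (`isInterleaved_of_le`). The infimum over δ > res(U) gives the
bound, and squeezing gives the limit. -/

noncomputable section

namespace LerayCosheaf

/-! ### Barycentric subdivision of affine chains -/

section VertexChains

variable (k : Type*) [CommRing k] {P Q : Type*}

/-- Formal combinations of finite sequences of points, graded by the length of the sequence; the
empty sequence spans the augmentation. -/
abbrev VertexChains (P : Type*) : Type _ := (Σ m, Fin m → P) →₀ k

namespace VertexChains

/-- A sequence of points as a chain. -/
abbrev simplex {m : ℕ} (p : Fin m → P) : VertexChains k P := Finsupp.single ⟨m, p⟩ 1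

/-- The boundary of a sequence of points. -/
def faces : ∀ {m : ℕ}, (Fin m → P) → VertexChains k P
  | 0, _ => 0
  | m + 1, p => ∑ i : Fin (m + 1), (-1 : k) ^ (i : ℕ) • simplex k (p ∘ Fin.succAbove i)

/-- The augmented boundary map. -/
def boundary : VertexChains k P →ₗ[k] VertexChains k P :=
  Finsupp.linearCombination k fun s => faces k s.2

/-- The cone with apex `b`. -/
def cone (b : P) : VertexChains k P →ₗ[k] VertexChains k P :=
  Finsupp.linearCombination k fun s => simplex k (Fin.cons b s.2 : Fin (s.1 + 1) → P)

/-- Push-forward along a map of points. -/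
def map (φ : P → Q) : VertexChains k P →ₗ[k] VertexChains k Q :=
  Finsupp.linearCombination k fun s => simplex k (φ ∘ s.2)

variable {k}

@[simp] lemma boundary_simplex {m : ℕ} (p : Fin m → P) :
    boundary k (simplex k p) = faces k p := by
  simp [boundary]

@[simp] lemma cone_simplex (b : P) {m : ℕ} (p : Fin m → P) :
    cone k b (simplex k p) = simplex k (Fin.cons b p : Fin (m + 1) → P) := by
  simp [cone]

@[simp] lemma map_simplex (φ : P → Q) {m : ℕ} (p : Fin m → P) :
    map k φ (simplex k p) = simplex k (φ ∘ p) := by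
  simp [map]

lemma hom_ext {V : Type*} [AddCommMonoid V] [Module k V] {f g : VertexChains k P →ₗ[k] V}
    (h : ∀ (m : ℕ) (p : Fin m → P), f (simplex k p) = g (simplex k p)) : f = g :=
  Finsupp.lhom_ext' fun s => LinearMap.ext_ring (h s.1 s.2)

/-- Omitting the apex returns the sequence; omitting a later entry commutes with the cone and
changes the sign. The formula needs no exception for points because the empty sequence is kept as
augmentation. -/
lemma boundary_cone (b : P) (c : VertexChains k P) :
    boundary k (cone k b c) = c - cone k b (boundary k c) := by
  suffices h : boundary k ∘ₗ cone k b = LinearMap.id - cone k b ∘ₗ boundary k from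
    LinearMap.congr_fun h c
  refine hom_ext fun m p => ?_
  have e : ((Fin.cons b p : Fin (m + 1) → P) ∘ Fin.succ) = p := by ext; simp
  cases m with
  | zero =>
    simp [faces, e]
  | succ m =>
    have e' : ∀ i : Fin (m + 1), ((Fin.cons b p : Fin (m + 2) → P) ∘ Fin.succAbove i.succ) =
        (Fin.cons b (p ∘ Fin.succAbove i) : Fin (m + 1) → P) := by
      intro i
      ext j
      refine Fin.cases ?_ (fun j => ?_) j <;> simp
    simp [faces, Fin.sum_univ_succ (n := m + 1), e, e', pow_succ, sub_eq_add_neg,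
      -Finsupp.smul_single]

/-- A nonempty sequence is the cone over its tail with its first entry as apex, so `boundary_cone`
reduces the claim to shorter sequences. -/
lemma boundary_boundary (c : VertexChains k P) : boundary k (boundary k c) = 0 := by
  suffices h : boundary k ∘ₗ boundary k = (0 : VertexChains k P →ₗ[k] VertexChains k P) from
    LinearMap.congr_fun h c
  refine hom_ext fun m => ?_
  induction m with
  | zero => intro p; simp [faces]
  | succ m ih =>
    intro p
    have e : simplex k p = cone k (p 0) (simplex k (Fin.tail p)) := by
      rw [cone_simplex, Fin.cons_self_tail]
    have := ih (Fin.tail p)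
    simp only [LinearMap.comp_apply, LinearMap.zero_apply] at this ⊢
    rw [e, boundary_cone, map_sub, boundary_cone, this, map_zero, sub_zero, sub_self]

lemma map_boundary (φ : P → Q) (c : VertexChains k P) :
    map k φ (boundary k c) = boundary k (map k φ c) := by
  suffices h : map k φ ∘ₗ boundary k = boundary k ∘ₗ map k φ from LinearMap.congr_fun h c
  refine hom_ext fun m p => ?_
  cases m with
  | zero => simp [faces]
  | succ m => simp [faces, Function.comp_assoc, -Finsupp.smul_single]

lemma map_cone (φ : P → Q) (b : P) (c : VertexChains k P) :
    map k φ (cone k b c) = cone k (φ b) (map k φ c) := by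
  suffices h : map k φ ∘ₗ cone k b = cone k (φ b) ∘ₗ map k φ from LinearMap.congr_fun h c
  refine hom_ext fun m p => ?_
  have e : φ ∘ (Fin.cons b p : Fin (m + 1) → P) = (Fin.cons (φ b) (φ ∘ p) : Fin (m + 1) → Q) :=
    Fin.comp_cons ..
  simp [e]

/-! ### Subdivision operator, its chain homotopy to the identity, and the shrinking estimate -/

section Subdivision

variable (k) (β : ∀ m, (Fin (m + 1) → P) → P)

/-- The subdivision of a sequence of points with respect to a choice `β` of barycentres. -/
def sdSimplex : ∀ {m : ℕ}, (Fin m → P) → VertexChains k P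
  | 0, p => simplex k p
  | m + 1, p => cone k (β m p) (∑ i : Fin (m + 1), (-1 : k) ^ (i : ℕ) • sdSimplex (p ∘ Fin.succAbove i))

/-- The subdivision operator. -/
def sd : VertexChains k P →ₗ[k] VertexChains k P :=
  Finsupp.linearCombination k fun s => sdSimplex k β s.2

/-- The homotopy between the identity and the subdivision on a sequence of points. -/
def sdHomotopySimplex : ∀ {m : ℕ}, (Fin m → P) → VertexChains k P
  | 0, _ => 0
  | m + 1, p => cone k (β m p) (simplex k p -
      ∑ i : Fin (m + 1), (-1 : k) ^ (i : ℕ) • sdHomotopySimplex (p ∘ Fin.succAbove i))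

/-- The homotopy between the identity and the subdivision. -/
def sdHomotopy : VertexChains k P →ₗ[k] VertexChains k P :=
  Finsupp.linearCombination k fun s => sdHomotopySimplex k β s.2

variable {k}

lemma sd_simplex {m : ℕ} (p : Fin m → P) : sd k β (simplex k p) = sdSimplex k β p := by
  simp [sd]

lemma sdHomotopy_simplex {m : ℕ} (p : Fin m → P) :
    sdHomotopy k β (simplex k p) = sdHomotopySimplex k β p := by
  simp [sdHomotopy]

lemma sd_simplex_zero (p : Fin 0 → P) : sd k β (simplex k p) = simplex k p := by
  simp [sd_simplex, sdSimplex]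

lemma sd_simplex_succ {m : ℕ} (p : Fin (m + 1) → P) :
    sd k β (simplex k p) = cone k (β m p) (sd k β (boundary k (simplex k p))) := by
  rw [boundary_simplex]
  simp only [sd_simplex, sdSimplex, faces, map_sum, map_smul]

lemma sdHomotopy_simplex_zero (p : Fin 0 → P) : sdHomotopy k β (simplex k p) = 0 := by
  simp [sdHomotopy_simplex, sdHomotopySimplex]

lemma sdHomotopy_simplex_succ {m : ℕ} (p : Fin (m + 1) → P) :
    sdHomotopy k β (simplex k p) =
      cone k (β m p) (simplex k p - sdHomotopy k β (boundary k (simplex k p))) := by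
  rw [boundary_simplex]
  simp only [sdHomotopy_simplex, sdHomotopySimplex, faces, map_sum, map_smul]

/-- The device for induction on length: a boundary is a combination of sequences that are one
shorter. -/
lemma eq_on_boundary {V : Type*} [AddCommMonoid V] [Module k V] {f g : VertexChains k P →ₗ[k] V}
    {m : ℕ} (h : ∀ p : Fin m → P, f (simplex k p) = g (simplex k p)) (p : Fin (m + 1) → P) :
    f (boundary k (simplex k p)) = g (boundary k (simplex k p)) := by
  simp only [boundary_simplex, faces, map_sum, map_smul, h]

/-- By `boundary_cone`, the boundary of the cone over the subdivided boundary is that subdivided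
boundary minus a cone over sd ∂∂ = 0. -/
lemma boundary_sd (c : VertexChains k P) :
    boundary k (sd k β c) = sd k β (boundary k c) := by
  suffices h : boundary k ∘ₗ sd k β = sd k β ∘ₗ boundary k from LinearMap.congr_fun h c
  refine hom_ext fun m => ?_
  induction m with
  | zero => intro p; simp [sd_simplex_zero, faces]
  | succ m ih =>
    intro p
    have h := eq_on_boundary ih p
    simp only [LinearMap.comp_apply] at h ⊢
    rw [sd_simplex_succ, boundary_cone, h, boundary_boundary, map_zero, map_zero, sub_zero]

/-- The homotopy h sends p to the cone over p - h∂p. By induction this chain has boundary sd ∂p, and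
the cone over sd ∂p is sd p; hence ∂hp = p - h∂p - sd p. -/
lemma boundary_sdHomotopy (c : VertexChains k P) :
    boundary k (sdHomotopy k β c) + sdHomotopy k β (boundary k c) = c - sd k β c := by
  suffices h : boundary k ∘ₗ sdHomotopy k β + sdHomotopy k β ∘ₗ boundary k =
      LinearMap.id - sd k β from LinearMap.congr_fun h c
  refine hom_ext fun m => ?_
  induction m with
  | zero => intro p; simp [sdHomotopy_simplex_zero, sd_simplex_zero, faces]
  | succ m ih =>
    intro p
    have h := eq_on_boundary ih p
    simp only [LinearMap.comp_apply, LinearMap.add_apply, LinearMap.sub_apply, LinearMap.id_apply,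
      boundary_boundary, map_zero, add_zero] at h ⊢
    rw [sdHomotopy_simplex_succ, boundary_cone, map_sub, h, sd_simplex_succ, sub_sub_cancel]
    abel

/-- Applied to affine maps, which preserve barycentres, this is the naturality that lets subdivision
be transported to singular simplices. -/
lemma map_sd {γ : ∀ m, (Fin (m + 1) → Q) → Q} (φ : P → Q)
    (hφ : ∀ m p, φ (β m p) = γ m (φ ∘ p)) (c : VertexChains k P) :
    map k φ (sd k β c) = sd k γ (map k φ c) := by
  suffices h : map k φ ∘ₗ sd k β = sd k γ ∘ₗ map k φ from LinearMap.congr_fun h c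
  refine hom_ext fun m => ?_
  induction m with
  | zero => intro p; simp [sd_simplex_zero]
  | succ m ih =>
    intro p
    have h := eq_on_boundary ih p
    simp only [LinearMap.comp_apply, map_simplex] at h ⊢
    rw [sd_simplex_succ, map_cone, h, sd_simplex_succ, map_boundary, map_simplex, hφ]

lemma map_sdHomotopy {γ : ∀ m, (Fin (m + 1) → Q) → Q} (φ : P → Q)
    (hφ : ∀ m p, φ (β m p) = γ m (φ ∘ p)) (c : VertexChains k P) :
    map k φ (sdHomotopy k β c) = sdHomotopy k γ (map k φ c) := by
  suffices h : map k φ ∘ₗ sdHomotopy k β = sdHomotopy k γ ∘ₗ map k φ from LinearMap.congr_fun h c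
  refine hom_ext fun m => ?_
  induction m with
  | zero => intro p; simp [sdHomotopy_simplex_zero]
  | succ m ih =>
    intro p
    have h := eq_on_boundary ih p
    simp only [LinearMap.comp_apply, map_simplex] at h ⊢
    rw [sdHomotopy_simplex_succ, map_cone, map_sub, h, sdHomotopy_simplex_succ, map_boundary,
      map_simplex, hφ]

lemma cone_mem_supported {b : P} {S S' : Set (Σ m, Fin m → P)} {c : VertexChains k P}
    (hc : c ∈ Finsupp.supported k k S)
    (h : ∀ (m : ℕ) (q : Fin m → P), ⟨m, q⟩ ∈ S →
      (⟨m + 1, Fin.cons b q⟩ : Σ m, Fin m → P) ∈ S') :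
    cone k b c ∈ Finsupp.supported k k S' := by
  rw [cone, Finsupp.linearCombination_apply]
  exact Submodule.sum_mem _ fun s hs => Submodule.smul_mem _ _
    (Finsupp.single_mem_supported _ _ (h _ _ (hc hs)))

lemma map_boundary_mem {V : Type*} [AddCommMonoid V] [Module k V] {f : VertexChains k P →ₗ[k] V}
    {m : ℕ} {S : Submodule k V} (p : Fin (m + 1) → P)
    (h : ∀ i, f (simplex k (p ∘ Fin.succAbove i)) ∈ S) : f (boundary k (simplex k p)) ∈ S := by
  simp only [boundary_simplex, faces, map_sum, map_smul]
  exact Submodule.sum_mem _ fun i _ => Submodule.smul_mem _ _ (h i)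

lemma sdHomotopy_mem_supported {m : ℕ} (p : Fin m → P) :
    sdHomotopy k β (simplex k p) ∈ Finsupp.supported k k {s | s.1 = m + 1} := by
  induction m with
  | zero => simp [sdHomotopy_simplex_zero]
  | succ m ih =>
    rw [sdHomotopy_simplex_succ]
    refine cone_mem_supported (S := {s | s.1 = m + 1})
      (Submodule.sub_mem _ (Finsupp.single_mem_supported _ _ rfl)
        (map_boundary_mem p fun i => ih _)) ?_
    rintro m q h
    exact congrArg (· + 1) h

variable [PseudoMetricSpace P]

/-- In a space in which balls are closed under taking barycentres `β`, and the barycentre of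
`m + 1` points at mutual distance at most `D` has distance at most `m / (m + 1) * D` to these
points, subdivision of an `m`-simplex shrinks distances by `m / (m + 1)`. -/
lemma sd_mem_supported
    (hβ : ∀ m p (y : P) R, (∀ i, dist y (p i) ≤ R) → dist y (β m p) ≤ R)
    (hβ' : ∀ m p D, (∀ i j, dist (p i) (p j) ≤ D) → ∀ i, dist (β m p) (p i) ≤ m / (m + 1) * D)
    {c D : ℝ} (hD : 0 ≤ D) {m : ℕ} (p : Fin m → P) (hm : (m : ℝ) - 1 ≤ c * m)
    (hp : ∀ i j, dist (p i) (p j) ≤ D) :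
    sd k β (simplex k p) ∈ Finsupp.supported k k {s | s.1 = m ∧
      (∀ y R, (∀ i, dist y (p i) ≤ R) → ∀ i, dist y (s.2 i) ≤ R) ∧
      ∀ i j, dist (s.2 i) (s.2 j) ≤ c * D} := by
  induction m with
  | zero =>
    rw [sd_simplex_zero]
    exact Finsupp.single_mem_supported _ _ ⟨rfl, fun _ _ h => h, fun i => i.elim0⟩
  | succ m ih =>
    -- `m` counts points, so the sequence at hand is a simplex of dimension `m`. The hypothesis `hm`
    -- is m / (m + 1) ≤ c cleared of denominators, a form that also makes sense for the empty
    -- sequence.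
    have hc : (m : ℝ) / (m + 1) ≤ c := by
      rw [div_le_iff₀ (by positivity)]
      simpa using hm
    have hc0 : 0 ≤ c := le_trans (by positivity) hc
    -- The same factor serves the faces: for c < 1, subtracting c from m ≤ c(m + 1) gives m - 1 < m
    -- - c ≤ cm.
    have hc1 : (m : ℝ) - 1 ≤ c * m := by
      rcases le_or_gt 1 c with h | h
      · nlinarith [(Nat.cast_nonneg m : (0 : ℝ) ≤ m)]
      · push_cast at hm; linarith
    have hcD : (m : ℝ) / (m + 1) * D ≤ c * D := mul_le_mul_of_nonneg_right hc hD
    rw [sd_simplex_succ]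
    refine cone_mem_supported (map_boundary_mem (S := Finsupp.supported k k {s | s.1 = m ∧
      (∀ y R, (∀ i, dist y (p i) ≤ R) → ∀ i, dist y (s.2 i) ≤ R) ∧
      ∀ i j, dist (s.2 i) (s.2 j) ≤ c * D}) p fun i => ?_) ?_
    · refine Finsupp.supported_mono ?_ (ih (p ∘ Fin.succAbove i) hc1 fun a b => hp _ _)
      rintro s ⟨h, h', h''⟩
      exact ⟨h, fun y R hy => h' y R fun j => hy _, h''⟩
    · rintro l q ⟨rfl, h, h'⟩
      -- This is what the clause on balls is carried for: a ball around the apex containing the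
      -- vertices of p also contains all vertices of the subdivided faces.
      have hb : ∀ i, dist (β l p) (q i) ≤ c * D :=
        h _ _ fun i => (hβ' l p D hp i).trans hcD
      refine ⟨rfl, fun y R hy i => ?_, fun i j => ?_⟩
      · refine Fin.cases ?_ (fun i => ?_) i
        · simpa using hβ l p y R hy
        · simpa using h y R hy i
      · refine Fin.cases ?_ (fun i => ?_) i <;> refine Fin.cases ?_ (fun j => ?_) j
        · simpa using mul_nonneg hc0 hD
        · simpa using hb j
        · simpa [dist_comm] using hb i
        · simpa using h' i j

end Subdivision

end VertexChains

end VertexChains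

end LerayCosheaf

end

noncomputable section

namespace LerayCosheaf

lemma map_mem_of_supported {k : Type*} [CommRing k] {α V : Type*} [AddCommMonoid V] [Module k V]
    (f : (α →₀ k) →ₗ[k] V) {S : Set α} {W : Submodule k V}
    (h : ∀ s ∈ S, f (Finsupp.single s 1) ∈ W) {c : α →₀ k} (hc : c ∈ Finsupp.supported k k S) :
    f c ∈ W := by
  rw [Finsupp.supported_eq_span_single] at hc
  have : Submodule.span k ((fun i => Finsupp.single i (1 : k)) '' S) ≤ W.comap f := by
    rw [Submodule.span_le]
    rintro _ ⟨s, hs, rfl⟩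
    exact h s hs
  exact this hc

/-! ### Affine simplices of a standard simplex -/

section AffineSimplex

/-- The topological standard simplex of dimension `n`. -/
abbrev TopSimplex (n : ℕ) : Type := stdSimplex ℝ (Fin (n + 1))

/-- The vertices of the standard simplex. -/
abbrev TopSimplex.vertices (n : ℕ) : Fin (n + 1) → TopSimplex n := stdSimplex.vertex

/-- The inclusion of the face opposite to the vertex `i`. -/
def TopSimplex.coface {n : ℕ} (i : Fin (n + 2)) : C(TopSimplex n, TopSimplex (n + 1)) :=
  ⟨stdSimplex.map (Fin.succAbove i), stdSimplex.continuous_map _⟩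

/-- The affine simplex with given vertices. -/
def affineSimplex {m n : ℕ} (p : Fin (m + 1) → TopSimplex n) : C(TopSimplex m, TopSimplex n) where
  toFun t := ⟨∑ i, t i • (p i : Fin (n + 1) → ℝ),
    (convex_stdSimplex ℝ _).sum_mem (fun i _ => t.2.1 i) t.2.2 fun i _ => (p i).2⟩
  continuous_toFun := by
    refine Continuous.subtype_mk (continuous_finsetSum _ fun i _ => ?_) _
    exact ((continuous_apply i).comp continuous_subtype_val).smul continuous_const

lemma coe_affineSimplex {m n : ℕ} (p : Fin (m + 1) → TopSimplex n) (t : TopSimplex m) :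
    ((affineSimplex p t : TopSimplex n) : Fin (n + 1) → ℝ) =
      ∑ i, t i • (p i : Fin (n + 1) → ℝ) := rfl

lemma affineSimplex_vertex {m n : ℕ} (p : Fin (m + 1) → TopSimplex n) (i : Fin (m + 1)) :
    affineSimplex p (TopSimplex.vertices m i) = p i := by
  apply Subtype.ext
  change ∑ j, (Pi.single i 1 : Fin (m + 1) → ℝ) j • (p j : Fin (n + 1) → ℝ) = p i
  simp [Pi.single_apply]

lemma affineSimplex_vertices (n : ℕ) :
    affineSimplex (TopSimplex.vertices n) = ContinuousMap.id _ := by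
  ext t j
  change (∑ i, t i • (Pi.single i 1 : Fin (n + 1) → ℝ)) j = t j
  simp [Finset.sum_apply, Pi.single_apply]

lemma affineSimplex_comp {l m n : ℕ} (p : Fin (m + 1) → TopSimplex n)
    (q : Fin (l + 1) → TopSimplex m) :
    affineSimplex (affineSimplex p ∘ q) = (affineSimplex p).comp (affineSimplex q) := by
  ext t j
  change (∑ i, t i • (∑ a, (q i) a • (p a : Fin (n + 1) → ℝ))) j =
    (∑ a, (∑ i, t i • (q i : Fin (m + 1) → ℝ)) a • (p a : Fin (n + 1) → ℝ)) j
  simp only [Finset.sum_apply, Pi.smul_apply, smul_eq_mul, Finset.mul_sum, Finset.sum_mul]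
  rw [Finset.sum_comm]
  simp only [mul_assoc]

lemma affineSimplex_coface {m n : ℕ} (p : Fin (m + 2) → TopSimplex n) (i : Fin (m + 2)) :
    (affineSimplex p).comp (TopSimplex.coface i) = affineSimplex (p ∘ Fin.succAbove i) := by
  ext t j
  change (∑ a, (FunOnFinite.linearMap ℝ ℝ (Fin.succAbove i) t) a • (p a : Fin (n + 1) → ℝ)) j =
    (∑ a, t a • (p (Fin.succAbove i a) : Fin (n + 1) → ℝ)) j
  simp only [Finset.sum_apply, Pi.smul_apply, smul_eq_mul, FunOnFinite.linearMap_apply_apply,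
    Finset.sum_mul]
  rw [← Finset.sum_fiberwise Finset.univ (Fin.succAbove i)]
  refine Finset.sum_congr rfl fun a _ => Finset.sum_congr rfl fun b hb => ?_
  rw [(Finset.mem_filter.1 hb).2]

/-- Closed balls of the ambient normed space are convex. -/
lemma dist_affineSimplex_le {m n : ℕ} (p : Fin (m + 1) → TopSimplex n) (t : TopSimplex m)
    (y : TopSimplex n) {R : ℝ} (h : ∀ i, dist y (p i) ≤ R) : dist y (affineSimplex p t) ≤ R := by
  have h' : ∀ i, (p i : Fin (n + 1) → ℝ) ∈ Metric.closedBall (y : Fin (n + 1) → ℝ) R := by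
    intro i
    rw [Metric.mem_closedBall, dist_comm]
    exact h i
  have := (convex_closedBall (y : Fin (n + 1) → ℝ) R).sum_mem (fun i _ => t.2.1 i) t.2.2
    fun i _ => h' i
  rw [Metric.mem_closedBall, dist_comm] at this
  exact this

/-- The barycentre of a sequence of points of a standard simplex. -/
def affineBarycenter (n m : ℕ) (p : Fin (m + 1) → TopSimplex n) : TopSimplex n :=
  affineSimplex p stdSimplex.barycenter

lemma affineSimplex_affineBarycenter {l m n : ℕ} (p : Fin (m + 1) → TopSimplex n)
    (q : Fin (l + 1) → TopSimplex m) :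
    affineSimplex p (affineBarycenter m l q) = affineBarycenter n l (affineSimplex p ∘ q) := by
  rw [affineBarycenter, affineBarycenter, affineSimplex_comp]
  rfl

/-- In each coordinate the difference is the average of the m + 1 numbers p_j - p_i. The one with j
= i vanishes, which leaves m terms of size at most D / (m + 1). -/
lemma dist_affineBarycenter_le {m n : ℕ} (p : Fin (m + 1) → TopSimplex n) {D : ℝ}
    (h : ∀ i j, dist (p i) (p j) ≤ D) (i : Fin (m + 1)) :
    dist (affineBarycenter n m p) (p i) ≤ m / (m + 1) * D := by
  have hD : 0 ≤ D := dist_nonneg.trans (h 0 0)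
  rw [Subtype.dist_eq, dist_pi_le_iff (by positivity)]
  intro a
  have e : ((affineBarycenter n m p : TopSimplex n) : Fin (n + 1) → ℝ) a - (p i) a =
      ∑ j ∈ Finset.univ.erase i, (1 / (m + 1 : ℝ)) * ((p j) a - (p i) a) := by
    have : (p i) a = ∑ j : Fin (m + 1), (1 / (m + 1 : ℝ)) * (p i) a := by
      have : (m + 1 : ℝ) ≠ 0 := by positivity
      rw [Finset.sum_const, Finset.card_univ, Fintype.card_fin]
      simp
      field_simp
    rw [Finset.sum_erase _ (by simp)]
    simp only [mul_sub, Finset.sum_sub_distrib]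
    rw [← this]
    congr 1
    rw [affineBarycenter, coe_affineSimplex, Finset.sum_apply]
    refine Finset.sum_congr rfl fun j _ => ?_
    change (Fintype.card (Fin (m + 1)) : ℝ)⁻¹ * (p j) a = _
    simp
  rw [Real.dist_eq]
  refine (congrArg abs e).trans_le ((Finset.abs_sum_le_sum_abs _ _).trans ?_)
  refine (Finset.sum_le_card_nsmul _ _ (1 / (m + 1 : ℝ) * D) fun j _ => ?_).trans_eq ?_
  · rw [abs_mul, abs_of_nonneg (by positivity)]
    refine mul_le_mul_of_nonneg_left ?_ (by positivity)
    have := (dist_le_pi_dist (p j : Fin (n + 1) → ℝ) (p i) a).trans (h j i)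
    rwa [Real.dist_eq] at this
  · rw [Finset.card_erase_of_mem (Finset.mem_univ _), Finset.card_univ, Fintype.card_fin]
    simp
    ring

end AffineSimplex

/-! ### Singular chains and small simplices -/

section SingularChains

variable (k : Type*) [CommRing k] (X : Type*) [TopologicalSpace X]

/-- The singular chains of all dimensions. -/
abbrev SingularChains : Type _ := (Σ n, C(TopSimplex n, X)) →₀ k

namespace SingularChains

variable {X}

/-- A singular simplex as a chain. -/
abbrev simplex {n : ℕ} (s : C(TopSimplex n, X)) : SingularChains k X := Finsupp.single ⟨n, s⟩ 1

/-- The boundary of a singular simplex. -/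
def faces : ∀ {n : ℕ}, C(TopSimplex n, X) → SingularChains k X
  | 0, _ => 0
  | n + 1, s => ∑ i : Fin (n + 2), (-1 : k) ^ (i : ℕ) • simplex k (s.comp (TopSimplex.coface i))

/-- The boundary map. -/
def boundary : SingularChains k X →ₗ[k] SingularChains k X :=
  Finsupp.linearCombination k fun s => faces k s.2

/-- The chains of dimension `m - 1` in the subset `A`. -/
def degree (m : ℕ) (A : Set X) : Submodule k (SingularChains k X) :=
  Finsupp.supported k k {s | s.1 + 1 = m ∧ Set.range s.2 ⊆ A}

/-- The image of an affine simplex under a singular simplex. -/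
def pushSimplex {n : ℕ} (s : C(TopSimplex n, X)) :
    ∀ {m : ℕ}, (Fin m → TopSimplex n) → SingularChains k X
  | 0, _ => 0
  | _ + 1, p => simplex k (s.comp (affineSimplex p))

/-- The image of affine chains under a singular simplex. -/
def push {n : ℕ} (s : C(TopSimplex n, X)) :
    VertexChains k (TopSimplex n) →ₗ[k] SingularChains k X :=
  Finsupp.linearCombination k fun p => pushSimplex k s p.2

variable {k}

lemma hom_ext {V : Type*} [AddCommMonoid V] [Module k V] {f g : SingularChains k X →ₗ[k] V}
    (h : ∀ (n : ℕ) (s : C(TopSimplex n, X)), f (simplex k s) = g (simplex k s)) : f = g :=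
  Finsupp.lhom_ext' fun s => LinearMap.ext_ring (h s.1 s.2)

@[simp] lemma boundary_simplex {n : ℕ} (s : C(TopSimplex n, X)) :
    boundary k (simplex k s) = faces k s := by
  simp [boundary]

@[simp] lemma push_simplex {n : ℕ} (s : C(TopSimplex n, X)) {m : ℕ} (p : Fin m → TopSimplex n) :
    push k s (VertexChains.simplex k p) = pushSimplex k s p := by
  simp [push]

/-- Every singular simplex is thus a push-forward of an affine one, so identities for singular
chains follow from those for `VertexChains`. -/
lemma push_vertices {n : ℕ} (s : C(TopSimplex n, X)) :
    push k s (VertexChains.simplex k (TopSimplex.vertices n)) = simplex k s := by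
  rw [push_simplex, pushSimplex, affineSimplex_vertices, ContinuousMap.comp_id]

lemma push_map {m n : ℕ} (s : C(TopSimplex n, X)) (p : Fin (m + 1) → TopSimplex n)
    (c : VertexChains k (TopSimplex m)) :
    push k s (VertexChains.map k (affineSimplex p) c) = push k (s.comp (affineSimplex p)) c := by
  suffices h : push k s ∘ₗ VertexChains.map k (affineSimplex p) =
    push k (s.comp (affineSimplex p)) from LinearMap.congr_fun h c
  refine VertexChains.hom_ext fun l q => ?_
  cases l with
  | zero => simp [pushSimplex]
  | succ l => simp [pushSimplex, affineSimplex_comp, ContinuousMap.comp_assoc]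

lemma boundary_push {n : ℕ} (s : C(TopSimplex n, X)) (c : VertexChains k (TopSimplex n)) :
    boundary k (push k s c) = push k s (VertexChains.boundary k c) := by
  suffices h : boundary k ∘ₗ push k s = push k s ∘ₗ VertexChains.boundary k from
    LinearMap.congr_fun h c
  refine VertexChains.hom_ext fun m p => ?_
  match m, p with
  | 0, p => simp [pushSimplex, VertexChains.faces]
  -- The affine boundary of a point is the empty sequence, which `push` kills: the augmentation
  -- disappears and matches the zero boundary of a singular 0-simplex.
  | 1, p => simp [pushSimplex, VertexChains.faces, faces, -Finsupp.smul_single]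
  | m + 2, p =>
    simp [pushSimplex, VertexChains.faces, faces, ContinuousMap.comp_assoc, affineSimplex_coface,
      -Finsupp.smul_single]

lemma boundary_boundary (c : SingularChains k X) : boundary k (boundary k c) = 0 := by
  suffices h : boundary k ∘ₗ boundary k = (0 : SingularChains k X →ₗ[k] SingularChains k X) from
    LinearMap.congr_fun h c
  refine hom_ext fun n s => ?_
  rw [← push_vertices, LinearMap.comp_apply, boundary_push, boundary_push,
    VertexChains.boundary_boundary, map_zero, LinearMap.zero_apply]

lemma simplex_mem_degree {n : ℕ} {s : C(TopSimplex n, X)} {A : Set X} (h : Set.range s ⊆ A) :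
    simplex k s ∈ degree k (n + 1) A :=
  Finsupp.single_mem_supported _ _ ⟨rfl, h⟩

variable (k) in
lemma degree_mono (m : ℕ) {A B : Set X} (h : A ⊆ B) : degree k m A ≤ degree k m B :=
  Finsupp.supported_mono fun _ hs => ⟨hs.1, hs.2.trans h⟩

lemma push_mem_degree {n : ℕ} {s : C(TopSimplex n, X)} {A : Set X} (h : Set.range s ⊆ A) {m : ℕ}
    {c : VertexChains k (TopSimplex n)} (hc : c ∈ Finsupp.supported k k {p | p.1 = m}) :
    push k s c ∈ degree k m A := by
  refine map_mem_of_supported _ ?_ hc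
  rintro ⟨l, p⟩ rfl
  rw [push_simplex]
  cases l with
  | zero => exact Submodule.zero_mem _
  | succ l => exact simplex_mem_degree ((Set.range_comp_subset_range (affineSimplex p) s).trans h)

lemma boundary_mem_degree {m : ℕ} {A : Set X} {c : SingularChains k X}
    (hc : c ∈ degree k (m + 1) A) : boundary k c ∈ degree k m A := by
  refine map_mem_of_supported _ ?_ hc
  rintro ⟨n, s⟩ ⟨h, hs⟩
  obtain rfl : n = m := by simpa using h
  rw [boundary_simplex]
  cases n with
  | zero => exact Submodule.zero_mem _
  | succ n =>
    exact Submodule.sum_mem _ fun i _ => Submodule.smul_mem _ _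
      (simplex_mem_degree ((Set.range_comp_subset_range (TopSimplex.coface i) s).trans hs))

variable (k) in
/-- The extension of operators on the affine chains of all standard simplices to singular
chains. -/
def extend (Φ : ∀ n, VertexChains k (TopSimplex n) →ₗ[k] VertexChains k (TopSimplex n)) :
    SingularChains k X →ₗ[k] SingularChains k X :=
  Finsupp.linearCombination k fun s =>
    push k s.2 (Φ s.1 (VertexChains.simplex k (TopSimplex.vertices s.1)))

section Extend

variable {Φ : ∀ n, VertexChains k (TopSimplex n) →ₗ[k] VertexChains k (TopSimplex n)}

lemma extend_simplex {n : ℕ} (s : C(TopSimplex n, X)) :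
    extend k Φ (simplex k s) =
      push k s (Φ n (VertexChains.simplex k (TopSimplex.vertices n))) := by
  simp [extend]

/-- An operator natural for affine maps is determined by its values on the standard simplices. The
condition `h0` keeps multiples of the empty sequence among the chains killed by `push`. -/
lemma extend_push (h0 : ∀ n (p : Fin 0 → TopSimplex n), Φ n (VertexChains.simplex k p) ∈
      Submodule.span k {VertexChains.simplex k (Fin.elim0 : Fin 0 → TopSimplex n)})
    (hΦ : ∀ {m n : ℕ} (p : Fin (m + 1) → TopSimplex n) (c : VertexChains k (TopSimplex m)),
      VertexChains.map k (affineSimplex p) (Φ m c) = Φ n (VertexChains.map k (affineSimplex p) c))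
    {n : ℕ} (s : C(TopSimplex n, X)) (c : VertexChains k (TopSimplex n)) :
    extend k Φ (push k s c) = push k s (Φ n c) := by
  suffices h : extend k Φ ∘ₗ push k s = push k s ∘ₗ Φ n from LinearMap.congr_fun h c
  refine VertexChains.hom_ext fun m p => ?_
  cases m with
  | zero =>
    obtain ⟨a, ha⟩ := Submodule.mem_span_singleton.1 (h0 n p)
    rw [LinearMap.comp_apply, LinearMap.comp_apply, ← ha]
    simp [pushSimplex, -Finsupp.smul_single]
  | succ m =>
    have e : affineSimplex p ∘ TopSimplex.vertices m = p := funext (affineSimplex_vertex p)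
    rw [LinearMap.comp_apply, LinearMap.comp_apply, push_simplex, pushSimplex, extend_simplex,
      ← push_map, hΦ, VertexChains.map_simplex, e]

end Extend

variable (k X) in
/-- Barycentric subdivision of singular chains. -/
def sd : SingularChains k X →ₗ[k] SingularChains k X :=
  extend k fun n => VertexChains.sd k (affineBarycenter n)

variable (k X) in
/-- The homotopy between the identity and barycentric subdivision. -/
def sdHomotopy : SingularChains k X →ₗ[k] SingularChains k X :=
  extend k fun n => VertexChains.sdHomotopy k (affineBarycenter n)

lemma sd_push {n : ℕ} (s : C(TopSimplex n, X)) (c : VertexChains k (TopSimplex n)) :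
    sd k X (push k s c) = push k s (VertexChains.sd k (affineBarycenter n) c) := by
  refine extend_push (fun n p => ?_) (fun p c => ?_) s c
  · rw [VertexChains.sd_simplex_zero, Subsingleton.elim p Fin.elim0]
    exact Submodule.mem_span_singleton_self _
  · exact VertexChains.map_sd _ _ (fun m q => affineSimplex_affineBarycenter p q) c

lemma sdHomotopy_push {n : ℕ} (s : C(TopSimplex n, X)) (c : VertexChains k (TopSimplex n)) :
    sdHomotopy k X (push k s c) = push k s (VertexChains.sdHomotopy k (affineBarycenter n) c) := by
  refine extend_push (fun n p => ?_) (fun p c => ?_) s c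
  · rw [VertexChains.sdHomotopy_simplex_zero]
    exact Submodule.zero_mem _
  · exact VertexChains.map_sdHomotopy _ _ (fun m q => affineSimplex_affineBarycenter p q) c

lemma boundary_sd (c : SingularChains k X) : boundary k (sd k X c) = sd k X (boundary k c) := by
  suffices h : boundary k ∘ₗ sd k X = sd k X ∘ₗ boundary k from LinearMap.congr_fun h c
  refine hom_ext fun n s => ?_
  simp only [LinearMap.comp_apply]
  rw [← push_vertices, sd_push, boundary_push, boundary_push, sd_push, VertexChains.boundary_sd]

lemma boundary_sdHomotopy (c : SingularChains k X) :
    boundary k (sdHomotopy k X c) + sdHomotopy k X (boundary k c) = c - sd k X c := by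
  suffices h : boundary k ∘ₗ sdHomotopy k X + sdHomotopy k X ∘ₗ boundary k =
      LinearMap.id - sd k X from LinearMap.congr_fun h c
  refine hom_ext fun n s => ?_
  simp only [LinearMap.add_apply, LinearMap.sub_apply, LinearMap.comp_apply, LinearMap.id_apply]
  rw [← push_vertices, sdHomotopy_push, boundary_push, boundary_push, sdHomotopy_push, sd_push,
    ← map_add, VertexChains.boundary_sdHomotopy, map_sub]

variable (k) in
/-- The chains of dimension `m - 1` all of whose simplices lie in a member of the family `A`. -/
def small {ι : Type*} (m : ℕ) (A : ι → Set X) : Submodule k (SingularChains k X) :=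
  Finsupp.supported k k {s | s.1 + 1 = m ∧ ∃ i, Set.range s.2 ⊆ A i}

/-! ### Small simplices theorem -/

section Small

variable {ι : Type*} {A : ι → Set X}

lemma degree_le_small (m : ℕ) (i : ι) : degree k m (A i) ≤ small k m A :=
  Finsupp.supported_mono fun _ hs => ⟨hs.1, i, hs.2⟩

lemma map_mem_small {f : SingularChains k X →ₗ[k] SingularChains k X} {m m' : ℕ}
    (h : ∀ (A : Set X), ∀ c ∈ degree k m A, f c ∈ degree k m' A) {c : SingularChains k X}
    (hc : c ∈ small k m A) : f c ∈ small k m' A := by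
  refine map_mem_of_supported _ ?_ hc
  rintro ⟨n, s⟩ ⟨rfl, i, hi⟩
  exact degree_le_small _ i (h (A i) _ (simplex_mem_degree hi))

lemma sd_vertices_mem_supported {n : ℕ} {D : ℝ} (hD : 0 ≤ D) {c : VertexChains k (TopSimplex n)}
    (hc : c ∈ Finsupp.supported k k {s | s.1 = n + 1 ∧ ∀ i j, dist (s.2 i) (s.2 j) ≤ D}) :
    VertexChains.sd k (affineBarycenter n) c ∈
      Finsupp.supported k k {s | s.1 = n + 1 ∧
        ∀ i j, dist (s.2 i) (s.2 j) ≤ (n / (n + 1) : ℝ) * D} := by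
  refine map_mem_of_supported _ ?_ hc
  rintro ⟨m, p⟩ ⟨h, hp⟩
  obtain rfl : m = n + 1 := h
  refine Finsupp.supported_mono ?_ (VertexChains.sd_mem_supported (affineBarycenter n)
    (fun m p y R h => dist_affineSimplex_le p _ y h)
    (fun m p D h => dist_affineBarycenter_le p h) hD p (c := n / (n + 1)) ?_ hp)
  · rintro s ⟨h, -, h'⟩
    exact ⟨h, h'⟩
  · push_cast
    field_simp
    simp

lemma sd_mem_degree {m : ℕ} {A : Set X} {c : SingularChains k X} (hc : c ∈ degree k m A) :
    sd k X c ∈ degree k m A := by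
  refine map_mem_of_supported _ ?_ hc
  rintro ⟨n, s⟩ ⟨rfl, hs⟩
  change sd k X (simplex k s) ∈ _
  rw [← push_vertices, sd_push]
  -- Only the lengths of the sequences matter here; the diameter serves as an arbitrary valid bound
  -- and the estimate is discarded.
  refine push_mem_degree hs (Finsupp.supported_mono (fun s h => h.1)
    (sd_vertices_mem_supported Metric.diam_nonneg (Finsupp.single_mem_supported _ _
      ⟨rfl, fun i j => Metric.dist_le_diam_of_mem isCompact_univ.isBounded
        (Set.mem_univ _) (Set.mem_univ _)⟩)))

lemma sdHomotopy_mem_degree {m : ℕ} {A : Set X} {c : SingularChains k X}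
    (hc : c ∈ degree k m A) : sdHomotopy k X c ∈ degree k (m + 1) A := by
  refine map_mem_of_supported _ ?_ hc
  rintro ⟨n, s⟩ ⟨rfl, hs⟩
  change sdHomotopy k X (simplex k s) ∈ _
  rw [← push_vertices, sdHomotopy_push]
  exact push_mem_degree hs (VertexChains.sdHomotopy_mem_supported _ _)

/-- The pulled-back cover of the compact standard simplex has a Lebesgue number ε. After r
subdivisions the vertices of a piece have mutual distance at most (n / (n + 1))^r times the
diameter. Once this is below ε, convexity puts the piece into the ε-ball around its first vertex. -/
lemma exists_sd_iterate_simplex_mem_small (hA : ∀ i, IsOpen (A i)) {n : ℕ}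
    (s : C(TopSimplex n, X)) (hs : Set.range s ⊆ ⋃ i, A i) :
    ∃ r, (sd k X)^[r] (simplex k s) ∈ small k (n + 1) A := by
  obtain ⟨ε, hε, h⟩ := lebesgue_number_lemma_of_metric (s := Set.univ) (c := fun i => s ⁻¹' A i)
    isCompact_univ (fun i => (hA i).preimage s.continuous) (fun x _ => by
      simpa using hs ⟨x, rfl⟩)
  set D := Metric.diam (Set.univ : Set (TopSimplex n))
  have key : ∀ r : ℕ, (VertexChains.sd k (affineBarycenter n))^[r]
      (VertexChains.simplex k (TopSimplex.vertices n)) ∈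
        Finsupp.supported k k {s | s.1 = n + 1 ∧
          ∀ i j, dist (s.2 i) (s.2 j) ≤ (n / (n + 1) : ℝ) ^ r * D} := by
    intro r
    induction r with
    | zero =>
      exact Finsupp.single_mem_supported _ _ ⟨rfl, fun i j => by
        simpa using Metric.dist_le_diam_of_mem isCompact_univ.isBounded
          (Set.mem_univ (TopSimplex.vertices n i)) (Set.mem_univ (TopSimplex.vertices n j))⟩
    | succ r ih =>
      rw [Function.iterate_succ_apply', pow_succ', mul_assoc]
      exact sd_vertices_mem_supported (mul_nonneg (by positivity) Metric.diam_nonneg) ih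
  have comm : ∀ (r : ℕ) c, (sd k X)^[r] (push k s c) =
      push k s ((VertexChains.sd k (affineBarycenter n))^[r] c) := by
    intro r
    induction r with
    | zero => intro c; rfl
    | succ r ih => intro c; rw [Function.iterate_succ_apply, sd_push, ih,
        Function.iterate_succ_apply]
  have lim : Tendsto (fun r : ℕ => (n / (n + 1) : ℝ) ^ r * D) atTop (𝓝 (0 * D)) :=
    (tendsto_pow_atTop_nhds_zero_of_lt_one (by positivity)
      ((div_lt_one (by positivity)).2 (by linarith))).mul_const D
  rw [zero_mul] at lim
  obtain ⟨r, hr⟩ := (lim.eventually (gt_mem_nhds hε)).exists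
  refine ⟨r, ?_⟩
  rw [← push_vertices, comm]
  refine map_mem_of_supported _ ?_ (key r)
  rintro ⟨m, p⟩ ⟨hm, hp⟩
  obtain rfl : m = n + 1 := hm
  obtain ⟨i, hi⟩ := h (p 0) (Set.mem_univ _)
  rw [push_simplex, pushSimplex]
  refine degree_le_small _ i (simplex_mem_degree ?_)
  rintro _ ⟨t, rfl⟩
  refine hi ?_
  rw [Metric.mem_ball, dist_comm]
  exact (dist_affineSimplex_le p t (p 0) (fun j => hp 0 j)).trans_lt hr

/-- A chain involves finitely many simplices, and small chains stay small under further subdivision,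
so the numbers of subdivisions for two summands may be added. -/
lemma exists_sd_iterate_mem_small (hA : ∀ i, IsOpen (A i)) {m : ℕ} {c : SingularChains k X}
    (hc : c ∈ degree k m (⋃ i, A i)) : ∃ r, (sd k X)^[r] c ∈ small k m A := by
  have step : ∀ r c, (sd k X)^[r] c ∈ small k m A → ∀ l, (sd k X)^[r + l] c ∈ small k m A := by
    intro r c h l
    induction l with
    | zero => exact h
    | succ l ih =>
      rw [← add_assoc, Function.iterate_succ_apply']
      exact map_mem_small (fun A c hc => sd_mem_degree hc) ih
  rw [degree, Finsupp.supported_eq_span_single] at hc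
  induction hc using Submodule.span_induction with
  | mem c hc =>
    obtain ⟨⟨n, s⟩, ⟨rfl, hs⟩, rfl⟩ := hc
    exact exists_sd_iterate_simplex_mem_small hA s hs
  | zero => exact ⟨0, Submodule.zero_mem _⟩
  | add x y _ _ hx hy =>
    obtain ⟨r, hr⟩ := hx
    obtain ⟨t, ht⟩ := hy
    refine ⟨r + t, ?_⟩
    rw [iterate_map_add]
    exact Submodule.add_mem _ (step r x hr t) (add_comm r t ▸ step t y ht r)
  | smul a x _ hx =>
    obtain ⟨r, hr⟩ := hx
    refine ⟨r, ?_⟩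
    rw [← Module.End.pow_apply, map_smul, Module.End.pow_apply]
    exact Submodule.smul_mem _ _ hr

/-- **Small simplices theorem**: relative to the chains that are small of order an open cover,
every relative cycle is a relative boundary. -/
theorem exists_sub_boundary_mem_small (hA : ∀ i, IsOpen (A i)) {m : ℕ} {c : SingularChains k X}
    (hc : c ∈ degree k (m + 1) (⋃ i, A i)) (hdc : boundary k c ∈ small k m A) :
    ∃ y ∈ degree k (m + 2) (⋃ i, A i), c - boundary k y ∈ small k (m + 1) A := by
  obtain ⟨r, hr⟩ := exists_sd_iterate_mem_small hA hc
  -- Induction on the number of subdivisions that make `c` small. Passing from sd c back to c uses c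
  -- - sd c = ∂hc + h∂c: the first term is absorbed into the filling, and h∂c is small because ∂c
  -- is.
  induction r generalizing c with
  | zero => exact ⟨0, Submodule.zero_mem _, by simpa using hr⟩
  | succ r ih =>
    obtain ⟨y, hy, h⟩ := ih (sd_mem_degree hc) (by
      rw [boundary_sd]
      exact map_mem_small (fun A c hc => sd_mem_degree hc) hdc) hr
    refine ⟨y + sdHomotopy k X c, Submodule.add_mem _ hy (sdHomotopy_mem_degree hc), ?_⟩
    have e : c - boundary k (y + sdHomotopy k X c) =
        (sd k X c - boundary k y) + sdHomotopy k X (boundary k c) := by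
      have := boundary_sdHomotopy c
      rw [map_add, ← sub_eq_zero]
      rw [← sub_eq_zero] at this
      rw [← neg_eq_zero, ← this]
      abel
    rw [e]
    exact Submodule.add_mem _ h (map_mem_small (fun A c hc => sdHomotopy_mem_degree hc) hdc)

end Small

end SingularChains

end SingularChains

end LerayCosheaf

end

noncomputable section

namespace LerayCosheaf

/-! ### The double complex of a cover with one-dimensional nerve -/

section CoverComplex

open SingularChains

set_option linter.unusedSectionVars false

variable (k : Type u) [CommRing k] {X : Type u} [TopologicalSpace X] {ι : Type} [Fintype ι]

/-- Sets indexed by the vertices and by the edges of a graph. -/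
def GraphOfSets (ι : Type) (X : Type u) : Type u := (ι → Set X) × (ι → ι → Set X)

instance : Preorder (GraphOfSets ι X) := inferInstanceAs (Preorder (_ × _))

/-- Families of singular chains indexed by the vertices and by the edges of a graph. -/
def GraphChains (k : Type u) [CommRing k] (ι : Type) (X : Type u) [TopologicalSpace X] : Type u :=
  (ι → SingularChains k X) × (ι → ι → SingularChains k X)

instance : AddCommGroup (GraphChains k ι X) := inferInstanceAs (AddCommGroup (_ × _))

instance : Module k (GraphChains k ι X) := inferInstanceAs (Module k (_ × _))

namespace GraphChains

variable {k}

@[simp] lemma fst_zero : (0 : GraphChains k ι X).1 = 0 := rfl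

@[simp] lemma snd_zero : (0 : GraphChains k ι X).2 = 0 := rfl

@[simp] lemma fst_add (x y : GraphChains k ι X) : (x + y).1 = x.1 + y.1 := rfl

@[simp] lemma snd_add (x y : GraphChains k ι X) : (x + y).2 = x.2 + y.2 := rfl

@[simp] lemma fst_smul (a : k) (x : GraphChains k ι X) : (a • x).1 = a • x.1 := rfl

@[simp] lemma snd_smul (a : k) (x : GraphChains k ι X) : (a • x).2 = a • x.2 := rfl

end GraphChains

/-- The boundary map from edges to vertices. -/
def edgeBoundary : (ι → ι → SingularChains k X) →ₗ[k] (ι → SingularChains k X) where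
  toFun e l := ∑ i, e i l - ∑ j, e l j
  map_add' e e' := by
    ext1 l
    simp only [Pi.add_apply, Finset.sum_add_distrib]
    abel
  map_smul' a e := by
    ext1 l
    simp only [Pi.smul_apply, ← Finset.smul_sum, smul_sub, RingHom.id_apply]

variable {k}

lemma edgeBoundary_apply (e : ι → ι → SingularChains k X) (l : ι) :
    edgeBoundary k e l = ∑ i, e i l - ∑ j, e l j := rfl

lemma sum_edgeBoundary (e : ι → ι → SingularChains k X) : ∑ l, edgeBoundary k e l = 0 := by
  simp only [edgeBoundary_apply, Finset.sum_sub_distrib]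
  rw [Finset.sum_comm, sub_self]

lemma boundary_edgeBoundary (e : ι → ι → SingularChains k X) (l : ι) :
    boundary k (edgeBoundary k e l) = edgeBoundary k (fun i j => boundary k (e i j)) l := by
  simp only [edgeBoundary_apply, map_sub, map_sum]

lemma eq_zero_of_mem_degree {m : ℕ} {A : Set X} {c : SingularChains k X}
    (hc : c ∈ degree k m A) {s : Σ n, C(TopSimplex n, X)} (h : ¬ Set.range s.2 ⊆ A) : c s = 0 := by
  by_contra h'
  exact h (hc (Finsupp.mem_support_iff.2 h')).2

/-- The index of `degree` is the dimension plus one, so index zero means dimension -1. -/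
lemma degree_zero (A : Set X) : degree k 0 A = ⊥ := by
  rw [degree, eq_bot_iff]
  intro c hc
  ext s
  by_contra h
  exact Nat.succ_ne_zero _ (hc (Finsupp.mem_support_iff.2 h)).1

variable (k) in
/-- The cycles of degree `n` of the total complex: singular `n`-chains on the vertices and singular
`n - 1`-chains on the edges. -/
def graphCycles (n : ℕ) (A : GraphOfSets ι X) :
    Submodule k (GraphChains k ι X) where
  carrier := {x | (∀ i, x.1 i ∈ degree k (n + 1) (A.1 i)) ∧ (∀ i j, x.2 i j ∈ degree k n (A.2 i j)) ∧
    (∀ i j, boundary k (x.2 i j) = 0) ∧ ∀ i, boundary k (x.1 i) = edgeBoundary k x.2 i}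
  zero_mem' := by simp
  add_mem' {x y} hx hy := ⟨fun i => Submodule.add_mem _ (hx.1 i) (hy.1 i),
    fun i j => Submodule.add_mem _ (hx.2.1 i j) (hy.2.1 i j),
    fun i j => by simp [hx.2.2.1 i j, hy.2.2.1 i j],
    fun i => by simp [hx.2.2.2 i, hy.2.2.2 i]⟩
  smul_mem' a x hx := ⟨fun i => Submodule.smul_mem _ _ (hx.1 i),
    fun i j => Submodule.smul_mem _ _ (hx.2.1 i j),
    fun i j => by simp [hx.2.2.1 i j], fun i => by simp [hx.2.2.2 i]⟩

variable (k) in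
/-- The boundaries of degree `n` of the total complex. -/
def graphBoundaries (n : ℕ) (A : GraphOfSets ι X) :
    Submodule k (GraphChains k ι X) where
  -- With d the edge boundary, the total differential is (v, e) ↦ (∂v + de, -∂e). The sign of the
  -- edge component in degree n is reversed, which gives ∂x₁ = dx₂ for cycles and (∂w + dg, ∂g) for
  -- boundaries.
  carrier := {x | ∃ (w : ι → SingularChains k X) (g : ι → ι → SingularChains k X),
    (∀ i, w i ∈ degree k (n + 2) (A.1 i)) ∧ (∀ i j, g i j ∈ degree k (n + 1) (A.2 i j)) ∧
    (∀ i, x.1 i = boundary k (w i) + edgeBoundary k g i) ∧ ∀ i j, x.2 i j = boundary k (g i j)}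
  zero_mem' := ⟨0, 0, by simp, by simp, by simp, by simp⟩
  add_mem' := by
    rintro x y ⟨w, g, h₁, h₂, h₃, h₄⟩ ⟨w', g', h₁', h₂', h₃', h₄'⟩
    refine ⟨w + w', g + g', fun i => Submodule.add_mem _ (h₁ i) (h₁' i),
      fun i j => Submodule.add_mem _ (h₂ i j) (h₂' i j), fun i => ?_, fun i j => ?_⟩
    · simp [h₃, h₃']
      abel
    · simp [h₄, h₄']
  smul_mem' := by
    rintro a x ⟨w, g, h₁, h₂, h₃, h₄⟩
    refine ⟨a • w, a • g, fun i => Submodule.smul_mem _ _ (h₁ i),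
      fun i j => Submodule.smul_mem _ _ (h₂ i j), fun i => ?_, fun i j => ?_⟩
    · simp [h₃]
    · simp [h₄]

lemma graphCycles_mono (n : ℕ) {A B : GraphOfSets ι X} (h : A ≤ B) :
    graphCycles k n A ≤ graphCycles k n B := fun _ hx =>
  ⟨fun i => degree_mono k _ (h.1 i) (hx.1 i), fun i j => degree_mono k _ (h.2 i j) (hx.2.1 i j),
    hx.2.2.1, hx.2.2.2⟩

lemma graphBoundaries_mono (n : ℕ) {A B : GraphOfSets ι X} (h : A ≤ B) :
    graphBoundaries k n A ≤ graphBoundaries k n B := by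
  rintro x ⟨w, g, hw, hg, hx⟩
  exact ⟨w, g, fun i => degree_mono k _ (h.1 i) (hw i), fun i j => degree_mono k _ (h.2 i j) (hg i j),
    hx⟩

/-- The homology of the total complex. -/
abbrev GraphHomology (k : Type u) [CommRing k] (n : ℕ) (A : GraphOfSets ι X) : Type u :=
  graphCycles k n A ⧸ (graphBoundaries k n A).submoduleOf (graphCycles k n A)

/-- The class of a cycle. -/
abbrev GraphHomology.mk {n : ℕ} {A : GraphOfSets ι X} :
    graphCycles k n A →ₗ[k] GraphHomology k n A :=
  Submodule.mkQ _

lemma GraphHomology.mk_eq_zero_iff {n : ℕ} {A : GraphOfSets ι X} {x : graphCycles k n A} :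
    GraphHomology.mk x = 0 ↔ x.1 ∈ graphBoundaries k n A := by
  exact Submodule.Quotient.mk_eq_zero _

variable (k) in
/-- The homology of the total complex as a functor. -/
def graphHomologyFunctor (n : ℕ) : GraphOfSets ι X ⥤ ModuleCat.{u} k where
  obj A := ModuleCat.of k (GraphHomology k n A)
  map {A B} h := ModuleCat.ofHom (Submodule.mapQ _ _
    (Submodule.inclusion (graphCycles_mono n (leOfHom h)))
    fun _ hx => graphBoundaries_mono n (leOfHom h) hx)
  map_id A := by
    ext x
    rfl
  map_comp h g := by
    ext x
    rfl

lemma exists_sum_eq_of_mem_small {A : ι → Set X} {m : ℕ} {c : SingularChains k X}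
    (hc : c ∈ small k m A) : ∃ v : ι → SingularChains k X,
      (∀ i, v i ∈ degree k m (A i)) ∧ ∑ i, v i = c := by
  classical
  let W : Submodule k (SingularChains k X) :=
    (Submodule.pi Set.univ fun i => degree k m (A i)).map (∑ i : ι, LinearMap.proj i)
  have h : LinearMap.id (R := k) c ∈ W := by
    refine map_mem_of_supported _ ?_ hc
    rintro s ⟨hs, i, hi⟩
    refine ⟨(Pi.single i (Finsupp.single s 1) : ι → SingularChains k X), fun j _ => ?_, by simp⟩
    obtain rfl | hj := eq_or_ne j i
    · have : Finsupp.single s (1 : k) ∈ degree k m (A j) :=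
        Finsupp.single_mem_supported _ _ ⟨hs, hi⟩
      simpa using this
    · simp [hj]
  obtain ⟨v, hv, hv'⟩ := h
  exact ⟨v, fun i => hv i (Set.mem_univ i), by simpa using hv'⟩

variable [LinearOrder ι]

/-- The graph of pairwise intersections of a family of sets. -/
def intersectionGraph (A : ι → Set X) : GraphOfSets ι X :=
  (A, fun i j => if i < j then A i ∩ A j else ∅)

lemma range_not_subset_empty (s : Σ n, C(TopSimplex n, X)) : ¬ Set.range s.2 ⊆ ∅ := fun h =>
  (Set.range_nonempty s.2).not_subset_empty h

lemma range_subset_of_ne_zero {A : ι → Set X} {m : ℕ} {i j : ι} {c : SingularChains k X}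
    (hc : c ∈ degree k m ((intersectionGraph A).2 i j)) {s : Σ n, C(TopSimplex n, X)}
    (h : c s ≠ 0) : i < j ∧ Set.range s.2 ⊆ A i ∧ Set.range s.2 ⊆ A j := by
  by_contra h'
  refine h (eq_zero_of_mem_degree hc fun h'' => ?_)
  change Set.range s.2 ⊆ if i < j then A i ∩ A j else ∅ at h''
  split_ifs at h'' with hij
  · exact h' ⟨hij, Set.subset_inter_iff.1 h''⟩
  · exact range_not_subset_empty s h''

/-! ### Mayer–Vietoris for a family without triple intersections -/

section

variable {A : ι → Set X} (hA : ∀ i j l, i ≠ j → j ≠ l → i ≠ l → A i ∩ A j ∩ A l = ∅)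
include hA

/-- Singular simplices are nonempty, so none lies in three members. The exactness statements below
are checked one simplex at a time by means of this. -/
lemma eq_of_range_subset {s : Σ n, C(TopSimplex n, X)} {i j l : ι} (hij : i ≠ j)
    (hi : Set.range s.2 ⊆ A i) (hj : Set.range s.2 ⊆ A j) (hl : Set.range s.2 ⊆ A l) :
    l = i ∨ l = j := by
  by_contra! h
  exact range_not_subset_empty s ((Set.subset_inter (Set.subset_inter hi hj) hl).trans
    (hA i j l hij h.2.symm h.1.symm).subset)

/-- A simplex occurring in `e i j` lies in A_i and A_j and in no other member, so at the vertex j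
its coefficient in the edge boundary comes from this edge alone. -/
lemma eq_zero_of_edgeBoundary_eq_zero {m : ℕ} {e : ι → ι → SingularChains k X}
    (he : ∀ i j, e i j ∈ degree k m ((intersectionGraph A).2 i j)) (h : edgeBoundary k e = 0)
    (i j : ι) : e i j = 0 := by
  ext s
  by_contra hs
  obtain ⟨hij, hi, hj⟩ := range_subset_of_ne_zero (he i j) hs
  have h1 := DFunLike.congr_fun (congrFun h j) s
  rw [edgeBoundary_apply, Finsupp.sub_apply, Finsupp.finsetSum_apply, Finsupp.finsetSum_apply,
    Finset.sum_eq_single i, Finset.sum_eq_zero, sub_zero] at h1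
  · exact hs h1
  · intro l _
    by_contra hl
    obtain ⟨hjl, -, hl⟩ := range_subset_of_ne_zero (he j l) hl
    rcases eq_of_range_subset hA hij.ne hi hj hl with rfl | rfl
    · exact lt_asymm hij hjl
    · exact lt_irrefl _ hjl
  · intro l _ hli
    by_contra hl
    obtain ⟨hlj, hl, -⟩ := range_subset_of_ne_zero (he l j) hl
    rcases eq_of_range_subset hA hij.ne hi hj hl with rfl | rfl
    · exact hli rfl
    · exact lt_irrefl _ hlj
  · simp

/-- For a simplex in exactly two members the two coefficients cancel, so an edge carrying the
coefficient of its larger end produces both. A simplex in only one member has coefficient zero. -/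
lemma exists_edgeBoundary_eq {m : ℕ} {v : ι → SingularChains k X}
    (hv : ∀ i, v i ∈ degree k m (A i)) (h : ∑ i, v i = 0) :
    ∃ e : ι → ι → SingularChains k X,
      (∀ i j, e i j ∈ degree k m ((intersectionGraph A).2 i j)) ∧ edgeBoundary k e = v := by
  classical
  -- On the edge i < j: the part of `v j` supported on simplices that also lie in A_i.
  refine ⟨fun i j => if i < j then (v j).filter fun s => Set.range s.2 ⊆ A i else 0,
    fun i j => ?_, ?_⟩
  · change _ ∈ degree k m (if i < j then A i ∩ A j else ∅)
    dsimp only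
    split_ifs with hij
    · intro s hs
      rw [Finset.mem_coe, Finsupp.support_filter, Finset.mem_filter] at hs
      have := hv j hs.1
      exact ⟨this.1, Set.subset_inter hs.2 this.2⟩
    · exact Submodule.zero_mem _
  · ext l s
    rw [edgeBoundary_apply, Finsupp.sub_apply, Finsupp.finsetSum_apply, Finsupp.finsetSum_apply]
    have hv0 : ∀ i, ¬ Set.range s.2 ⊆ A i → v i s = 0 := fun i hi => eq_zero_of_mem_degree (hv i) hi
    have hsum : ∑ i, v i s = 0 := by
      rw [← Finsupp.finsetSum_apply, h, Finsupp.zero_apply]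
    have e : ∀ i j, (if i < j then (v j).filter fun s => Set.range s.2 ⊆ A i else 0 :
        SingularChains k X) s = if i < j ∧ Set.range s.2 ⊆ A i then v j s else 0 := by
      intro i j
      by_cases hij : i < j <;> simp [hij, Finsupp.filter_apply]
    simp only [e]
    by_cases hl : Set.range s.2 ⊆ A l
    · by_cases ha : ∃ a, a ≠ l ∧ Set.range s.2 ⊆ A a
      · obtain ⟨a, hal, ha⟩ := ha
        have huniq : ∀ i, Set.range s.2 ⊆ A i → i = l ∨ i = a := fun i hi =>
          eq_of_range_subset hA hal.symm hl ha hi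
        rcases lt_or_gt_of_ne hal with hal' | hal'
        · rw [Finset.sum_eq_single a, Finset.sum_eq_zero, if_pos ⟨hal', ha⟩, sub_zero]
          · intro j _
            split_ifs with hj
            · refine hv0 j fun hj' => ?_
              rcases huniq j hj' with rfl | rfl
              · exact lt_irrefl _ hj.1
              · exact lt_asymm hj.1 hal'
            · rfl
          · intro i _ hia
            rw [if_neg]
            rintro ⟨hil, hi⟩
            exact (huniq i hi).elim hil.ne hia
          · simp
        · rw [Finset.sum_eq_zero, Finset.sum_eq_single a, if_pos ⟨hal', hl⟩, zero_sub,
            neg_eq_iff_add_eq_zero, ← hsum]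
          · rw [← Finset.sum_pair (f := fun i => v i s) hal]
            refine Finset.sum_subset (Finset.subset_univ _) fun i _ hi => hv0 i fun hi' => hi ?_
            rcases huniq i hi' with rfl | rfl <;> simp
          · intro j _ hja
            split_ifs with hj
            · refine hv0 j fun hj' => ?_
              exact (huniq j hj').elim hj.1.ne' hja
            · rfl
          · simp
          · intro i _
            rw [if_neg]
            rintro ⟨hil, hi⟩
            rcases huniq i hi with rfl | rfl
            · exact lt_irrefl _ hil
            · exact lt_asymm hil hal'
      · have ha' : ∀ i, i ≠ l → v i s = 0 := fun i hi => hv0 i fun hi' => ha ⟨i, hi, hi'⟩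
        have : v l s = 0 := by
          rw [← hsum, Finset.sum_eq_single l (fun i _ hi => ha' i hi) (by simp)]
        rw [this, Finset.sum_eq_zero, Finset.sum_eq_zero, sub_zero]
        · intro j _
          split_ifs with hj
          · exact ha' j hj.1.ne'
          · rfl
        · intro i _
          simp
    · rw [hv0 l hl]
      simp [hl]

variable (hA' : ∀ i, IsOpen (A i))
include hA'

/-- Injectivity of the sum map on homology. Up to a boundary, `c` is small and splits as the sum of
chains w_i. Then x₁ - ∂w has sum zero, hence comes from edge chains g, and x₂ = ∂g because the edge
boundary is injective. -/
lemma mem_graphBoundaries_of_sum_eq_boundary {n : ℕ}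
    {x : GraphChains k ι X}
    (hx : x ∈ graphCycles k n (intersectionGraph A)) {c : SingularChains k X}
    (hc : c ∈ degree k (n + 2) (⋃ i, A i)) (h : ∑ i, x.1 i = boundary k c) :
    x ∈ graphBoundaries k n (intersectionGraph A) := by
  have hs : boundary k c ∈ small k (n + 1) A := by
    rw [← h]
    exact Submodule.sum_mem _ fun i _ => degree_le_small _ i (hx.1 i)
  obtain ⟨y, hy, hy'⟩ := exists_sub_boundary_mem_small hA' hc hs
  obtain ⟨w, hw, hw'⟩ := exists_sum_eq_of_mem_small hy'
  obtain ⟨g, hg, hg'⟩ := exists_edgeBoundary_eq hA (v := fun i => x.1 i - boundary k (w i))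
    (fun i => Submodule.sub_mem _ (hx.1 i) (boundary_mem_degree (hw i))) (by
      rw [Finset.sum_sub_distrib, ← map_sum, hw', map_sub, boundary_boundary, sub_zero, h, sub_self])
  refine ⟨w, g, hw, hg, fun i => by rw [hg', add_sub_cancel], fun i j => ?_⟩
  rw [← sub_eq_zero]
  refine eq_zero_of_edgeBoundary_eq_zero hA (m := n) (e := fun i j => x.2 i j - boundary k (g i j))
    (fun i j => Submodule.sub_mem _ (hx.2.1 i j) (boundary_mem_degree (hg i j))) ?_ i j
  have : (fun i j => x.2 i j - boundary k (g i j)) = x.2 - fun i j => boundary k (g i j) := rfl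
  rw [this, map_sub]
  ext1 l
  rw [Pi.sub_apply, ← boundary_edgeBoundary, hg', map_sub, boundary_boundary, sub_zero, hx.2.2.2,
    sub_self, Pi.zero_apply]

/-- Surjectivity of the sum map on homology. A small representative splits as the sum of chains v_i
whose boundaries have sum zero; so ∂v comes from edge chains, and these are cycles by injectivity of
the edge boundary. -/
lemma exists_sum_eq_sub_boundary {n : ℕ} {z : SingularChains k X}
    (hz : z ∈ degree k (n + 1) (⋃ i, A i)) (hz' : boundary k z = 0) :
    ∃ x ∈ graphCycles k n (intersectionGraph A), ∃ c ∈ degree k (n + 2) (⋃ i, A i),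
      ∑ i, x.1 i = z - boundary k c := by
  obtain ⟨c, hc, hc'⟩ := exists_sub_boundary_mem_small hA' hz
    (by rw [hz']; exact Submodule.zero_mem _)
  obtain ⟨v, hv, hv'⟩ := exists_sum_eq_of_mem_small hc'
  obtain ⟨e, he, he'⟩ := exists_edgeBoundary_eq hA (v := fun i => boundary k (v i))
    (fun i => boundary_mem_degree (hv i)) (by
      rw [← map_sum, hv', map_sub, boundary_boundary, sub_zero, hz'])
  refine ⟨(v, e), ⟨hv, he, fun i j => ?_, fun i => by rw [he']⟩, c, hc, hv'⟩
  cases n with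
  -- In total degree zero the edge chains have dimension -1 and vanish.
  | zero =>
    have := he i j
    rw [degree_zero, Submodule.mem_bot] at this
    simp [this]
  | succ n =>
    refine eq_zero_of_edgeBoundary_eq_zero hA (m := n) (e := fun i j => boundary k (e i j))
      (fun i j => boundary_mem_degree (he i j)) ?_ i j
    ext1 l
    rw [← boundary_edgeBoundary, he', boundary_boundary, Pi.zero_apply]

end

end CoverComplex

end LerayCosheaf

end

noncomputable section

namespace LerayCosheaf

/-! ### Homology classes of cycles in complexes of modules -/

section CycleClass

variable {k : Type u} [CommRing k] (K L : ChainComplex (ModuleCat.{u} k) ℕ) (n : ℕ)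

/-- The cycles of degree `n`. -/
abbrev complexCycles : Submodule k (K.X n) := LinearMap.ker (K.sc n).g.hom

/-- The homology class of a cycle. -/
def cycleClass : complexCycles K n →ₗ[k] K.homology n :=
  ((K.sc n).moduleCatCyclesIso.inv ≫ (K.sc n).homologyπ).hom

variable {K L n}

lemma mem_complexCycles_iff {x : K.X n} : x ∈ complexCycles K n ↔ ∀ j, K.d n j x = 0 := by
  change K.d n _ x = 0 ↔ _
  refine ⟨fun h j => ?_, fun h => h _⟩
  by_cases hj : (ComplexShape.down ℕ).Rel n j
  · rwa [(ComplexShape.down ℕ).next_eq' hj] at h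
  · rw [K.shape _ _ hj]
    rfl

lemma mem_complexCycles_succ_iff {x : K.X (n + 1)} :
    x ∈ complexCycles K (n + 1) ↔ K.d (n + 1) n x = 0 := by
  rw [mem_complexCycles_iff]
  refine ⟨fun h => h n, fun h j => ?_⟩
  by_cases hj : n = j
  · exact hj ▸ h
  · rw [K.shape _ _ (fun h' => hj (by simpa using h'.symm))]
    rfl

lemma mem_complexCycles_zero (x : K.X 0) : x ∈ complexCycles K 0 := by
  rw [mem_complexCycles_iff]
  intro j
  rw [K.shape _ _ (by simp)]
  rfl

lemma cycleClass_eq (x : complexCycles K n) :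
    cycleClass K n x = (K.sc n).moduleCatHomologyIso.inv ((K.sc n).moduleCatLeftHomologyData.π x) :=
  LinearMap.congr_fun (congrArg ModuleCat.Hom.hom (K.sc n).moduleCatCyclesIso_inv_π) x

variable (K n) in
lemma cycleClass_surjective : Function.Surjective (cycleClass K n) := by
  intro h
  obtain ⟨x, hx⟩ := Submodule.mkQ_surjective _ ((K.sc n).moduleCatHomologyIso.hom h)
  refine ⟨x, (cycleClass_eq x).trans ?_⟩
  refine (congrArg (K.sc n).moduleCatHomologyIso.inv hx).trans ?_
  exact LinearMap.congr_fun (congrArg ModuleCat.Hom.hom (K.sc n).moduleCatHomologyIso.hom_inv_id) h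

lemma cycleClass_eq_zero_iff (x : complexCycles K n) :
    cycleClass K n x = 0 ↔ ∃ y : K.X (n + 1), K.d (n + 1) n y = x := by
  have h1 : cycleClass K n x = 0 ↔ (K.sc n).moduleCatLeftHomologyData.π x = 0 := by
    rw [cycleClass_eq]
    exact map_eq_zero_iff (K.sc n).moduleCatHomologyIso.inv.hom
      ((ModuleCat.mono_iff_injective _).1 inferInstance)
  -- The complex shape provides the preceding degree only up to a propositional equality with `n +
  -- 1`; the free index `j` absorbs it.
  have h2 : ∀ j, j = n + 1 → ((∃ y, K.d j n y = x) ↔ ∃ y : K.X (n + 1), K.d (n + 1) n y = x) := by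
    rintro j rfl
    rfl
  rw [h1, ← h2 ((ComplexShape.down ℕ).prev n) (ChainComplex.prev ℕ n)]
  refine (Submodule.Quotient.mk_eq_zero (LinearMap.range (K.sc n).moduleCatToCycles)).trans ?_
  exact exists_congr fun y => Subtype.ext_iff

lemma map_mem_complexCycles (φ : K ⟶ L) {x : K.X n} (hx : x ∈ complexCycles K n) :
    φ.f n x ∈ complexCycles L n := by
  rw [mem_complexCycles_iff] at hx ⊢
  intro j
  have := LinearMap.congr_fun (congrArg ModuleCat.Hom.hom (φ.comm n j)) x
  refine this.trans ?_
  rw [ModuleCat.comp_apply, hx j, map_zero]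

lemma homologyMap_cycleClass (φ : K ⟶ L) (x : complexCycles K n) :
    HomologicalComplex.homologyMap φ n (cycleClass K n x) =
      cycleClass L n ⟨φ.f n x.1, map_mem_complexCycles φ x.2⟩ := by
  refine (LinearMap.congr_fun (congrArg ModuleCat.Hom.hom
    (HomologicalComplex.homologyπ_naturality φ n)) ((K.sc n).moduleCatCyclesIso.inv x)).trans ?_
  refine congrArg (L.homologyπ n) ?_
  apply (ModuleCat.mono_iff_injective (L.iCycles n)).1 inferInstance
  refine (LinearMap.congr_fun (congrArg ModuleCat.Hom.hom
    (HomologicalComplex.cyclesMap_i φ n)) ((K.sc n).moduleCatCyclesIso.inv x)).trans ?_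
  have h1 : K.iCycles n ((K.sc n).moduleCatCyclesIso.inv x) = x.1 :=
    LinearMap.congr_fun (congrArg ModuleCat.Hom.hom (K.sc n).moduleCatCyclesIso_inv_iCycles) x
  exact (congrArg (φ.f n) h1).trans (LinearMap.congr_fun
    (congrArg ModuleCat.Hom.hom (L.sc n).moduleCatCyclesIso_inv_iCycles) ⟨φ.f n x.1, _⟩).symm

end CycleClass

/-! ### The singular chain complex in terms of singular chains -/

section Realization

open SingularChains Opposite Simplicial

variable (k : Type u) [CommRing k] {X : Type u} [TopologicalSpace X] {Z W : TopCat.{u}}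

/-- The singular chain complex of a topological space. -/
abbrev singularComplex (Z : TopCat.{u}) : ChainComplex (ModuleCat.{u} k) ℕ :=
  (TopCat.toSSet.obj Z).chainComplex (ModuleCat.of k k)

/-- The continuous map underlying a simplex of the singular simplicial set. -/
def simplexMap {n : ℕ} (x : (TopCat.toSSet.obj Z) _⦋n⦌) : C(TopSimplex n, Z) :=
  TopCat.toSSetObjEquiv Z (op ⦋n⦌) x

lemma simplexMap_bijective (Z : TopCat.{u}) (n : ℕ) :
    Function.Bijective (simplexMap (Z := Z) (n := n)) :=
  (TopCat.toSSetObjEquiv Z (op ⦋n⦌)).bijective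

/-- A simplex of the singular simplicial set as a chain. -/
def singularGenerator {n : ℕ} (x : (TopCat.toSSet.obj Z) _⦋n⦌) : (singularComplex k Z).X n :=
  ((TopCat.toSSet.obj Z).ιChainComplex (R := ModuleCat.of k k) x).hom (1 : k)

variable {k}

lemma singularComplex_hom_ext {n : ℕ} {T : ModuleCat.{u} k} {f g : (singularComplex k Z).X n ⟶ T}
    (h : ∀ x, f (singularGenerator k x) = g (singularGenerator k x)) : f = g := by
  refine SSet.chainComplex_hom_ext fun x => ?_
  ext
  exact h x

lemma d_singularGenerator {n : ℕ} (x : (TopCat.toSSet.obj Z) _⦋n + 1⦌) :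
    (singularComplex k Z).d (n + 1) n (singularGenerator k x) =
      ∑ i : Fin (n + 2), (-1 : k) ^ (i : ℕ) •
        singularGenerator k ((TopCat.toSSet.obj Z).δ i x) := by
  have := LinearMap.congr_fun (congrArg ModuleCat.Hom.hom
    ((TopCat.toSSet.obj Z).ιChainComplex_d (ModuleCat.of k k) x)) (1 : k)
  refine this.trans ?_
  rw [ModuleCat.hom_sum, LinearMap.sum_apply]
  refine Finset.sum_congr rfl fun i _ => ?_
  rcases neg_one_pow_eq_or ℤ (i : ℕ) with h | h <;>
    rcases Nat.even_or_odd (i : ℕ) with h' | h' <;>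
    simp [h'.neg_one_pow, singularGenerator]

lemma map_singularGenerator {n : ℕ} (g : Z ⟶ W) (x : (TopCat.toSSet.obj Z) _⦋n⦌) :
    (SSet.chainComplexMap (TopCat.toSSet.map g) (ModuleCat.of k k)).f n (singularGenerator k x) =
      singularGenerator k ((TopCat.toSSet.map g).app _ x) :=
  LinearMap.congr_fun (congrArg ModuleCat.Hom.hom
    (SSet.ι_chainComplexMap_f _ _ (TopCat.toSSet.map g) (ModuleCat.of k k) x)) (1 : k)

variable (k Z) in
/-- The linear combinations of singular simplices. -/
def ofSimplices (n : ℕ) : ((TopCat.toSSet.obj Z) _⦋n⦌ →₀ k) →ₗ[k] (singularComplex k Z).X n :=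
  Finsupp.linearCombination k (singularGenerator k)

/-- The projection to the cokernel kills all generators, hence vanishes by the universal property of
the chain object. -/
lemma ofSimplices_surjective (n : ℕ) : Function.Surjective (ofSimplices k Z n) := by
  rw [← LinearMap.range_eq_top, ← Submodule.ker_mkQ (LinearMap.range (ofSimplices k Z n)),
    LinearMap.ker_eq_top]
  have : ModuleCat.ofHom (LinearMap.range (ofSimplices k Z n)).mkQ = 0 := by
    refine singularComplex_hom_ext fun x => ?_
    refine (Submodule.Quotient.mk_eq_zero _).2 ⟨Finsupp.single x 1, ?_⟩
    simp [ofSimplices]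
  exact congrArg ModuleCat.Hom.hom this

/-- The chains on `X` that are represented by elements of the singular chain complex of a space
over `X`. -/
def realize (i : C(Z, X)) (n : ℕ) : (singularComplex k Z).X n →ₗ[k] SingularChains k X :=
  (((TopCat.toSSet.obj Z).isColimitChainComplexXCofan (ModuleCat.of k k) n).desc
    (Cofan.mk (ModuleCat.of k (SingularChains k X)) fun x => ModuleCat.ofHom
      (LinearMap.toSpanSingleton k (SingularChains k X)
        (SingularChains.simplex k (i.comp (simplexMap x)))))).hom

lemma realize_singularGenerator (i : C(Z, X)) {n : ℕ} (x : (TopCat.toSSet.obj Z) _⦋n⦌) :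
    realize i n (singularGenerator k x) = SingularChains.simplex k (i.comp (simplexMap x)) := by
  have := ((TopCat.toSSet.obj Z).isColimitChainComplexXCofan (ModuleCat.of k k) n).fac
    (Cofan.mk (ModuleCat.of k (SingularChains k X)) fun x => ModuleCat.ofHom
      (LinearMap.toSpanSingleton k (SingularChains k X)
        (SingularChains.simplex k (i.comp (simplexMap x))))) ⟨x⟩
  refine (LinearMap.congr_fun (congrArg ModuleCat.Hom.hom this) (1 : k)).trans ?_
  exact one_smul k _

lemma boundary_realize (i : C(Z, X)) {n : ℕ} (x : (singularComplex k Z).X (n + 1)) :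
    boundary k (realize i (n + 1) x) = realize i n ((singularComplex k Z).d (n + 1) n x) := by
  suffices h : ModuleCat.ofHom (boundary k ∘ₗ realize i (n + 1)) =
      (singularComplex k Z).d (n + 1) n ≫ ModuleCat.ofHom (realize i n) from
    LinearMap.congr_fun (congrArg ModuleCat.Hom.hom h) x
  refine singularComplex_hom_ext fun x => ?_
  change boundary k (realize i (n + 1) (singularGenerator k x)) =
    realize i n ((singularComplex k Z).d (n + 1) n (singularGenerator k x))
  rw [d_singularGenerator, realize_singularGenerator, boundary_simplex]
  simp only [map_sum, map_smul, realize_singularGenerator, faces]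
  rfl

lemma boundary_realize_zero (i : C(Z, X)) (x : (singularComplex k Z).X 0) :
    boundary k (realize i 0 x) = 0 := by
  suffices h : ModuleCat.ofHom (boundary k ∘ₗ realize i 0) =
      (0 : (singularComplex k Z).X 0 ⟶ ModuleCat.of k (SingularChains k X)) from
    LinearMap.congr_fun (congrArg ModuleCat.Hom.hom h) x
  refine singularComplex_hom_ext fun x => ?_
  change boundary k (realize i 0 (singularGenerator k x)) = 0
  rw [realize_singularGenerator, boundary_simplex]
  rfl

lemma realize_map (i : C(W, X)) (g : Z ⟶ W) {n : ℕ} (x : (singularComplex k Z).X n) :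
    realize i n ((SSet.chainComplexMap (TopCat.toSSet.map g) (ModuleCat.of k k)).f n x) =
      realize (i.comp g.hom) n x := by
  suffices h : (SSet.chainComplexMap (TopCat.toSSet.map g) (ModuleCat.of k k)).f n ≫
      ModuleCat.ofHom (realize i n) = ModuleCat.ofHom (realize (i.comp g.hom) n) from
    LinearMap.congr_fun (congrArg ModuleCat.Hom.hom h) x
  refine singularComplex_hom_ext fun x => ?_
  change realize i n ((SSet.chainComplexMap (TopCat.toSSet.map g) (ModuleCat.of k k)).f n
    (singularGenerator k x)) = realize (i.comp g.hom) n (singularGenerator k x)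
  rw [map_singularGenerator, realize_singularGenerator, realize_singularGenerator]
  rfl

/-- On combinations of simplices this relabels basis vectors along an injection, and every chain is
such a combination. -/
lemma realize_injective {i : C(Z, X)} (hi : Function.Injective i) (n : ℕ) :
    Function.Injective (realize (k := k) i n) := by
  let e : (TopCat.toSSet.obj Z) _⦋n⦌ → Σ n, C(TopSimplex n, X) := fun x =>
    ⟨n, i.comp (simplexMap x)⟩
  have he : Function.Injective e := fun x y h => by
    apply (simplexMap_bijective Z n).1
    ext t
    exact hi (DFunLike.congr_fun (eq_of_heq (Sigma.mk.inj h).2) t)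
  have h : ∀ c, realize i n (ofSimplices k Z n c) = Finsupp.mapDomain e c := by
    intro c
    suffices h : realize i n ∘ₗ ofSimplices k Z n = Finsupp.lmapDomain k k e from
      LinearMap.congr_fun h c
    refine Finsupp.lhom_ext' fun x => LinearMap.ext_ring ?_
    simp [ofSimplices, realize_singularGenerator, e]
  intro a b hab
  obtain ⟨a, rfl⟩ := ofSimplices_surjective n a
  obtain ⟨b, rfl⟩ := ofSimplices_surjective n b
  rw [h, h] at hab
  rw [Finsupp.mapDomain_injective he hab]

lemma range_realize {i : C(Z, X)} (hi : IsInducing i) (n : ℕ) :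
    LinearMap.range (realize (k := k) i n) = degree k (n + 1) (Set.range i) := by
  apply le_antisymm
  · rintro _ ⟨x, rfl⟩
    obtain ⟨c, rfl⟩ := ofSimplices_surjective n x
    rw [← LinearMap.comp_apply]
    refine map_mem_of_supported _ ?_ (S := Set.univ) (by simp)
    rintro x -
    rw [LinearMap.comp_apply, ofSimplices, Finsupp.linearCombination_single, one_smul,
      realize_singularGenerator]
    exact simplex_mem_degree (Set.range_comp_subset_range (simplexMap x) i)
  · intro c hc
    rw [← LinearMap.id_apply (R := k) c]
    refine map_mem_of_supported _ ?_ hc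
    rintro ⟨m, s⟩ ⟨h, hs⟩
    obtain rfl : m = n := by simpa using h
    choose t ht using fun a => hs ⟨a, rfl⟩
    -- The pointwise lift of the simplex is continuous because `i` is inducing.
    have ht' : Continuous t := by
      rw [hi.continuous_iff]
      have : i ∘ t = s := funext ht
      rw [this]
      exact s.continuous
    obtain ⟨x, hx⟩ := (simplexMap_bijective Z m).2 ⟨t, ht'⟩
    refine ⟨singularGenerator k x, ?_⟩
    rw [realize_singularGenerator, hx]
    congr 2
    ext a
    exact ht a

end Realization

end LerayCosheaf

end

noncomputable section

namespace LerayCosheaf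

/-! ### The Leray cosheaf in terms of singular chains -/

section LerayClass

open SingularChains

variable (k : Type u) [Field k] {X : Type u} [TopologicalSpace X] {Y : Type v}
  [TopologicalSpace Y] (f : C(X, Y))

/-- The singular `n`-cycles in a subset. -/
def setCycles (n : ℕ) (A : Set X) : Submodule k (SingularChains k X) :=
  degree k (n + 1) A ⊓ LinearMap.ker (boundary k)

variable {k} in
lemma setCycles_mono {n : ℕ} {A B : Set X} (h : A ⊆ B) : setCycles k n A ≤ setCycles k n B :=
  inf_le_inf_right _ (degree_mono k _ h)

/-- The preimage of an open set as a topological space. -/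
abbrev preimageTop (V : Opens Y) : TopCat.{u} := TopCat.of (Opens.comap f V)

/-- The inclusion of the preimage of an open set. -/
def preimageInclusion (V : Opens Y) : C(preimageTop f V, X) := ⟨Subtype.val, continuous_subtype_val⟩

lemma range_preimageInclusion (V : Opens Y) : Set.range (preimageInclusion f V) = f ⁻¹' V :=
  Subtype.range_val

lemma map_realize_complexCycles (V : Opens Y) (n : ℕ) :
    (complexCycles (singularComplex k (preimageTop f V)) n).map
      (realize (preimageInclusion f V) n) = setCycles k n (f ⁻¹' V) := by
  have hr := range_realize (k := k) (i := preimageInclusion f V) IsInducing.subtypeVal n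
  rw [range_preimageInclusion] at hr
  rw [setCycles, ← hr]
  ext c
  refine ⟨?_, ?_⟩
  · rintro ⟨x, hx, rfl⟩
    refine ⟨⟨x, rfl⟩, ?_⟩
    change boundary k (realize (preimageInclusion f V) n x) = 0
    cases n with
    | zero => exact boundary_realize_zero _ x
    | succ n => rw [boundary_realize, mem_complexCycles_succ_iff.1 hx, map_zero]
  · rintro ⟨⟨x, rfl⟩, hx⟩
    refine ⟨x, ?_, rfl⟩
    cases n with
    | zero => exact mem_complexCycles_zero x
    | succ n =>
      refine mem_complexCycles_succ_iff.2 (realize_injective (k := k)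
        (i := preimageInclusion f V) Subtype.val_injective n ?_)
      rw [← boundary_realize, map_zero]
      exact hx

/-- The cycles of the singular chain complex of the preimage of `V` are the cycles in this
preimage. -/
def realizeCycles (V : Opens Y) (n : ℕ) :
    complexCycles (singularComplex k (preimageTop f V)) n ≃ₗ[k] setCycles k n (f ⁻¹' V) :=
  (Submodule.equivMapOfInjective _ (realize_injective
    (i := preimageInclusion f V) Subtype.val_injective n) _).trans
    (LinearEquiv.ofEq _ _ (map_realize_complexCycles k f V n))

lemma coe_realizeCycles (V : Opens Y) (n : ℕ)
    (x : complexCycles (singularComplex k (preimageTop f V)) n) :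
    (realizeCycles k f V n x : SingularChains k X) = realize (preimageInclusion f V) n x.1 := rfl

/-- The homology class of a cycle in the preimage of an open set. -/
def lerayClass (n : ℕ) (V : Opens Y) : setCycles k n (f ⁻¹' V) →ₗ[k] (leray k f n).obj V :=
  cycleClass (singularComplex k (preimageTop f V)) n ∘ₗ (realizeCycles k f V n).symm.toLinearMap

variable {k}

lemma lerayClass_realizeCycles {n : ℕ} {V : Opens Y}
    (x : complexCycles (singularComplex k (preimageTop f V)) n) :
    lerayClass k f n V (realizeCycles k f V n x) =
      cycleClass (singularComplex k (preimageTop f V)) n x := by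
  rw [lerayClass]
  exact congrArg (cycleClass (singularComplex k (preimageTop f V)) n)
    ((realizeCycles k f V n).symm_apply_apply x)

variable (k) in
lemma lerayClass_surjective (n : ℕ) (V : Opens Y) : Function.Surjective (lerayClass k f n V) :=
  (cycleClass_surjective (singularComplex k (preimageTop f V)) n).comp
    (realizeCycles k f V n).symm.surjective

lemma lerayClass_eq_zero_iff {n : ℕ} {V : Opens Y} (z : setCycles k n (f ⁻¹' V)) :
    lerayClass k f n V z = 0 ↔ ∃ c ∈ degree k (n + 2) (f ⁻¹' V), boundary k c = z := by
  obtain ⟨x, rfl⟩ := (realizeCycles k f V n).surjective z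
  have hr := range_realize (k := k) (i := preimageInclusion f V) IsInducing.subtypeVal (n + 1)
  rw [range_preimageInclusion] at hr
  rw [lerayClass_realizeCycles, ← hr]
  refine (cycleClass_eq_zero_iff x).trans ⟨?_, ?_⟩
  · rintro ⟨y, hy⟩
    refine ⟨_, ⟨y, rfl⟩, ?_⟩
    rw [boundary_realize, hy, coe_realizeCycles]
  · rintro ⟨_, ⟨y, rfl⟩, hy⟩
    refine ⟨y, realize_injective (k := k) (i := preimageInclusion f V) Subtype.val_injective n ?_⟩
    rw [← boundary_realize, hy, coe_realizeCycles]

lemma leray_map_lerayClass {n : ℕ} {V W : Opens Y} (h : V ⟶ W) (z : setCycles k n (f ⁻¹' V)) :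
    (leray k f n).map h (lerayClass k f n V z) =
      lerayClass k f n W (Submodule.inclusion
        (setCycles_mono (Set.preimage_mono (leOfHom h))) z) := by
  obtain ⟨x, rfl⟩ := (realizeCycles k f V n).surjective z
  let g : preimageTop f V ⟶ preimageTop f W := (Opens.toTopCat (TopCat.of X)).map
    ((OrderHomClass.mono (Opens.comap f)).functor.map h)
  let φ := SSet.chainComplexMap (TopCat.toSSet.map g) (ModuleCat.of k k)
  have e : Submodule.inclusion (setCycles_mono (Set.preimage_mono (leOfHom h)))
      (realizeCycles k f V n x) =
      realizeCycles k f W n ⟨φ.f n x.1, map_mem_complexCycles φ x.2⟩ :=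
    Subtype.ext (realize_map (preimageInclusion f W) g x.1).symm
  rw [e, lerayClass_realizeCycles, lerayClass_realizeCycles]
  exact homologyMap_cycleClass φ x

end LerayClass

end LerayCosheaf

end

noncomputable section

namespace LerayCosheaf

/-! ### Linear choices of fillings and of representing cycles -/

section Sections

open SingularChains

variable (k : Type u) [Field k] {X : Type u} [TopologicalSpace X]

/-- Over a field the surjection from D to d(D) has a linear section, and this extends to all of N.
The result is a total linear map whose use requires no proof that its argument is a boundary. -/
lemma exists_linear_section_of_submodule {M N : Type*} [AddCommGroup M] [Module k M]
    [AddCommGroup N] [Module k N] (D : Submodule k M) (d : M →ₗ[k] N) :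
    ∃ g : N →ₗ[k] M, ∀ c ∈ D, g (d c) ∈ D ∧ d (g (d c)) = d c := by
  obtain ⟨s, hs⟩ := LinearMap.exists_rightInverse_of_surjective (d.domRestrict D).rangeRestrict
    (d.domRestrict D).range_rangeRestrict
  obtain ⟨g, hg⟩ := LinearMap.exists_extend (D.subtype ∘ₗ s)
  refine ⟨g, fun c hc => ?_⟩
  have e : g (d c) = s ⟨d c, ⟨c, hc⟩, rfl⟩ := LinearMap.congr_fun hg ⟨d c, ⟨c, hc⟩, rfl⟩
  refine ⟨e ▸ (s _).2, ?_⟩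
  rw [e]
  exact congrArg Subtype.val (LinearMap.congr_fun hs ⟨d c, ⟨c, hc⟩, rfl⟩)

lemma exists_filling (m : ℕ) (A : Set X) : ∃ g : SingularChains k X →ₗ[k] SingularChains k X,
    ∀ c ∈ degree k (m + 1) A, g (boundary k c) ∈ degree k (m + 1) A ∧
      boundary k (g (boundary k c)) = boundary k c :=
  exists_linear_section_of_submodule k (degree k (m + 1) A) (boundary k)

/-- A linear choice of a chain in `A` with given boundary. -/
def filling (m : ℕ) (A : Set X) : SingularChains k X →ₗ[k] SingularChains k X :=
  (exists_filling k m A).choose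

variable {k}

lemma filling_mem_degree {m : ℕ} {A : Set X} {c : SingularChains k X}
    (hc : c ∈ degree k (m + 1) A) : filling k m A (boundary k c) ∈ degree k (m + 1) A :=
  ((exists_filling k m A).choose_spec c hc).1

lemma boundary_filling {m : ℕ} {A : Set X} {c : SingularChains k X}
    (hc : c ∈ degree k (m + 1) A) : boundary k (filling k m A (boundary k c)) = boundary k c :=
  ((exists_filling k m A).choose_spec c hc).2

variable (k) {Y : Type v} [TopologicalSpace Y] (f : C(X, Y)) (n : ℕ) (V : Opens Y)

/-- A linear choice of a cycle in every homology class. -/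
def lerayRep : (leray k f n).obj V →ₗ[k] SingularChains k X :=
  (setCycles k n (f ⁻¹' V)).subtype ∘ₗ (LinearMap.exists_rightInverse_of_surjective
    (lerayClass k f n V) (LinearMap.range_eq_top.2 (lerayClass_surjective k f n V))).choose

/-- A linear extension of the map taking a cycle to its homology class to all chains. -/
def lerayExt : SingularChains k X →ₗ[k] (leray k f n).obj V :=
  (LinearMap.exists_extend (lerayClass k f n V)).choose

variable {k f n V}

lemma lerayExt_eq {z : SingularChains k X} (hz : z ∈ setCycles k n (f ⁻¹' V)) :
    lerayExt k f n V z = lerayClass k f n V ⟨z, hz⟩ :=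
  LinearMap.congr_fun (LinearMap.exists_extend (lerayClass k f n V)).choose_spec ⟨z, hz⟩

lemma lerayRep_mem (x : (leray k f n).obj V) : lerayRep k f n V x ∈ setCycles k n (f ⁻¹' V) :=
  Subtype.prop _

lemma lerayExt_lerayRep (x : (leray k f n).obj V) :
    lerayExt k f n V (lerayRep k f n V x) = x :=
  (lerayExt_eq (lerayRep_mem x)).trans (LinearMap.congr_fun
    (LinearMap.exists_rightInverse_of_surjective (lerayClass k f n V)
      (LinearMap.range_eq_top.2 (lerayClass_surjective k f n V))).choose_spec x)

lemma lerayExt_eq_zero_iff {z : SingularChains k X} (hz : z ∈ setCycles k n (f ⁻¹' V)) :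
    lerayExt k f n V z = 0 ↔ ∃ c ∈ degree k (n + 2) (f ⁻¹' V), boundary k c = z := by
  rw [lerayExt_eq hz, lerayClass_eq_zero_iff]

lemma boundary_mem_setCycles {A : Set X} {c : SingularChains k X} (hc : c ∈ degree k (n + 2) A) :
    boundary k c ∈ setCycles k n A :=
  ⟨boundary_mem_degree hc, boundary_boundary c⟩

lemma lerayExt_boundary {c : SingularChains k X} (hc : c ∈ degree k (n + 2) (f ⁻¹' V)) :
    lerayExt k f n V (boundary k c) = 0 :=
  (lerayExt_eq_zero_iff (boundary_mem_setCycles hc)).2 ⟨c, hc, rfl⟩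

lemma leray_map_lerayExt {W : Opens Y} (h : V ⟶ W) {z : SingularChains k X}
    (hz : z ∈ setCycles k n (f ⁻¹' V)) :
    (leray k f n).map h (lerayExt k f n V z) = lerayExt k f n W z := by
  rw [lerayExt_eq hz, leray_map_lerayClass,
    lerayExt_eq (setCycles_mono (Set.preimage_mono (leOfHom h)) hz)]
  rfl

lemma exists_lerayRep_lerayExt_eq {z : SingularChains k X} (hz : z ∈ setCycles k n (f ⁻¹' V)) :
    ∃ c ∈ degree k (n + 2) (f ⁻¹' V), lerayRep k f n V (lerayExt k f n V z) = z + boundary k c := by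
  obtain ⟨c, hc, h⟩ := (lerayExt_eq_zero_iff (Submodule.sub_mem _
    (lerayRep_mem (lerayExt k f n V z)) hz)).1 (by rw [map_sub, lerayExt_lerayRep, sub_self])
  exact ⟨c, hc, by rw [h, add_sub_cancel]⟩

end Sections

end LerayCosheaf

end

noncomputable section

namespace LerayCosheaf

/-! ### Chains of the cellular Leray cosheaf -/

section CellChains

open SingularChains

set_option linter.unusedSectionVars false

variable (k : Type u) [Field k] {X : Type u} [TopologicalSpace X] {Y : Type v}
  [TopologicalSpace Y] (f : C(X, Y)) {ι : Type} [LinearOrder ι] {U : ι → Opens Y} (n : ℕ)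
  {L : PreAbstractSimplicialComplex ι} (hL : L ≤ nerve U)

/-- The chains of a subcomplex of the nerve with coefficients in the cellular Leray cosheaf. -/
abbrev CellChains (p : ℕ) : Type u := ((cellularLeray k U f n).restrict hL).Chains p

variable (L) in
/-- The vertex `i` is in `L`. -/
def HasVertex (i : ι) : Prop := ({i} : Finset ι) ∈ L

variable (L) in
/-- The edge from `i` to `j` is in `L`, and `i < j`. -/
def HasEdge (i j : ι) : Prop := i < j ∧ ({i, j} : Finset ι) ∈ L

lemma HasEdge.left {i j : ι} (h : HasEdge L i j) : HasVertex L i :=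
  (L.isRelLowerSet_faces h.2).2 (by simp) (by simp)

lemma HasEdge.right {i j : ι} (h : HasEdge L i j) : HasVertex L j :=
  (L.isRelLowerSet_faces h.2).2 (by simp) (by simp)

/-- A vertex as a simplex. -/
def vertexSimplex {i : ι} (h : HasVertex L i) : Simplex L 0 :=
  ⟨⟨{i}, h⟩, Finset.card_singleton i⟩

/-- An edge as a simplex. -/
def edgeSimplex {i j : ι} (h : HasEdge L i j) : Simplex L 1 :=
  ⟨⟨{i, j}, h.2⟩, Finset.card_pair h.1.ne⟩

lemma exists_eq_vertexSimplex (σ : Simplex L 0) :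
    ∃ (i : ι) (h : HasVertex L i), σ = vertexSimplex h := by
  obtain ⟨⟨s, hs⟩, h⟩ := σ
  obtain ⟨i, rfl⟩ := Finset.card_eq_one.1 h
  exact ⟨i, hs, rfl⟩

lemma exists_eq_edgeSimplex (σ : Simplex L 1) :
    ∃ (i j : ι) (h : HasEdge L i j), σ = edgeSimplex h := by
  obtain ⟨⟨s, hs⟩, h⟩ := σ
  obtain ⟨i, j, hij, rfl⟩ := Finset.card_eq_two.1 h
  rcases lt_or_gt_of_ne hij with hij | hij
  · exact ⟨i, j, ⟨hij, hs⟩, rfl⟩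
  · have e := Finset.pair_comm i j
    exact ⟨j, i, ⟨hij, e ▸ hs⟩, Subtype.ext (Subtype.ext e)⟩

lemma vertexSimplex_injective {i j : ι} {h : HasVertex L i} {h' : HasVertex L j}
    (e : vertexSimplex h = vertexSimplex h') : i = j :=
  Finset.singleton_inj.1 (congrArg (fun σ : Simplex L 0 => σ.1.1) e)

lemma edgeSimplex_injective {i j i' j' : ι} {h : HasEdge L i j} {h' : HasEdge L i' j'}
    (e : edgeSimplex h = edgeSimplex h') : i = i' ∧ j = j' := by
  have e : ({i, j} : Finset ι) = {i', j'} := congrArg (fun σ : Simplex L 1 => σ.1.1) e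
  have h1 : i ∈ ({i', j'} : Finset ι) := e ▸ (by simp)
  have h2 : j ∈ ({i', j'} : Finset ι) := e ▸ (by simp)
  have hij := h.1
  have hij' := h'.1
  simp only [Finset.mem_insert, Finset.mem_singleton] at h1 h2
  rcases h1 with rfl | rfl <;> rcases h2 with rfl | rfl <;> simp_all [lt_asymm]

lemma vertexSimplex_le_edgeSimplex_left {i j : ι} (h : HasEdge L i j) :
    (vertexSimplex h.left).1 ≤ (edgeSimplex h).1 := by
  change ({i} : Finset ι) ⊆ {i, j}
  simp

lemma vertexSimplex_le_edgeSimplex_right {i j : ι} (h : HasEdge L i j) :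
    (vertexSimplex h.right).1 ≤ (edgeSimplex h).1 := by
  change ({j} : Finset ι) ⊆ {i, j}
  simp

variable {k} in
lemma boundary_ofSimplex_edgeSimplex (F : CellularCosheaf k L) {i j : ι} (h : HasEdge L i j)
    (x : F.obj (Opposite.op (edgeSimplex h).1)) :
    F.boundary 0 (F.ofSimplex (edgeSimplex h) x) =
      F.ofSimplex (vertexSimplex h.right)
        (F.extension (vertexSimplex_le_edgeSimplex_right h) x) -
      F.ofSimplex (vertexSimplex h.left)
        (F.extension (vertexSimplex_le_edgeSimplex_left h) x) := by
  have hij := h.1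
  have mi : i ∈ (edgeSimplex h).1.1 := Finset.mem_insert_self i {j}
  have mj : j ∈ (edgeSimplex h).1.1 := Finset.mem_insert_of_mem (Finset.mem_singleton_self j)
  -- The face opposite to the smaller vertex i is {j}, so the larger end receives the sign +1, as in
  -- `edgeBoundary`.
  have si : (edgeSimplex h).sign ⟨i, mi⟩ = 1 := by
    have : ({i, j} : Finset ι).filter (· < i) = ∅ := by
      ext a; simp; rintro (rfl | rfl) <;> simp [hij.le]
    simp [Simplex.sign, edgeSimplex, this]
  have sj : (edgeSimplex h).sign ⟨j, mj⟩ = -1 := by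
    have : ({i, j} : Finset ι).filter (· < j) = {i} := by
      ext a; simp; constructor
      · rintro ⟨rfl | rfl, h⟩
        · rfl
        · exact absurd h (lt_irrefl _)
      · rintro rfl
        exact ⟨Or.inl rfl, hij⟩
    simp [Simplex.sign, edgeSimplex, this]
  have ei := F.ofSimplex_congr (σ := (edgeSimplex h).face ⟨i, mi⟩) (τ := vertexSimplex h.right)
    (by change ({i, j} : Finset ι).erase i = {j}; ext a; simp; grind)
    (Simplex.face_le _ _) (vertexSimplex_le_edgeSimplex_right h) x
  have ej := F.ofSimplex_congr (σ := (edgeSimplex h).face ⟨j, mj⟩) (τ := vertexSimplex h.left)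
    (by change ({i, j} : Finset ι).erase j = {i}; ext a; simp; grind)
    (Simplex.face_le _ _) (vertexSimplex_le_edgeSimplex_left h) x
  rw [F.boundary_ofSimplex, Finset.sum_eq_add (⟨i, mi⟩ : (edgeSimplex h).1.1) ⟨j, mj⟩, si, sj,
    ei, ej, one_smul, neg_smul, one_smul, sub_eq_add_neg]
  · exact fun e => hij.ne (congrArg Subtype.val e)
  · rintro ⟨a, ha⟩ - h'
    exfalso
    rcases Finset.mem_insert.1 ha with rfl | e
    · exact h'.1 rfl
    · exact h'.2 (Subtype.ext (Finset.mem_singleton.1 e))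
  · simp
  · simp

/-- The inclusion of the summand of a vertex of `L`. -/
def vertexIncl {i : ι} (h : HasVertex L i) :
    (leray k f n).obj (inter U {i}) →ₗ[k] CellChains k f n hL 0 :=
  ((cellularLeray k U f n).restrict hL).ofSimplex (vertexSimplex h)

/-- The projection to the summand of a vertex of `L`. -/
def vertexProj {i : ι} (h : HasVertex L i) :
    CellChains k f n hL 0 →ₗ[k] (leray k f n).obj (inter U {i}) :=
  DirectSum.component k (Simplex L 0)
    (fun σ => ((cellularLeray k U f n).restrict hL).obj (Opposite.op σ.1)) (vertexSimplex h)

/-- The inclusion of the summand of an edge of `L`. -/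
def edgeIncl {i j : ι} (h : HasEdge L i j) :
    (leray k f n).obj (inter U {i, j}) →ₗ[k] CellChains k f n hL 1 :=
  ((cellularLeray k U f n).restrict hL).ofSimplex (edgeSimplex h)

/-- The projection to the summand of an edge of `L`. -/
def edgeProj {i j : ι} (h : HasEdge L i j) :
    CellChains k f n hL 1 →ₗ[k] (leray k f n).obj (inter U {i, j}) :=
  DirectSum.component k (Simplex L 1)
    (fun σ => ((cellularLeray k U f n).restrict hL).obj (Opposite.op σ.1)) (edgeSimplex h)

open scoped Classical in
/-- The inclusion of the summand of a vertex. -/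
def ofVertex (i : ι) : (leray k f n).obj (inter U {i}) →ₗ[k] CellChains k f n hL 0 :=
  -- Extended by zero to indices outside `L`, so that sums can run over all of `ι`; likewise for the
  -- three maps below.
  if h : HasVertex L i then vertexIncl k f n hL h else 0

open scoped Classical in
/-- The component of a chain at a vertex. -/
def vertexComp (i : ι) : CellChains k f n hL 0 →ₗ[k] (leray k f n).obj (inter U {i}) :=
  if h : HasVertex L i then vertexProj k f n hL h else 0

open scoped Classical in
/-- The inclusion of the summand of an edge. -/
def ofEdge (i j : ι) : (leray k f n).obj (inter U {i, j}) →ₗ[k] CellChains k f n hL 1 :=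
  if h : HasEdge L i j then edgeIncl k f n hL h else 0

open scoped Classical in
/-- The component of a chain at an edge. -/
def edgeComp (i j : ι) : CellChains k f n hL 1 →ₗ[k] (leray k f n).obj (inter U {i, j}) :=
  if h : HasEdge L i j then edgeProj k f n hL h else 0

variable {k f n hL}

lemma ofVertex_of_hasVertex {i : ι} (h : HasVertex L i) :
    ofVertex k f n hL i = vertexIncl k f n hL h := dif_pos h

lemma ofEdge_of_hasEdge {i j : ι} (h : HasEdge L i j) :
    ofEdge k f n hL i j = edgeIncl k f n hL h := dif_pos h

lemma ofVertex_of_not {i : ι} (h : ¬ HasVertex L i) : ofVertex k f n hL i = 0 := dif_neg h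

lemma ofEdge_of_not {i j : ι} (h : ¬ HasEdge L i j) : ofEdge k f n hL i j = 0 := dif_neg h

lemma vertexComp_ofVertex_self {i : ι} (h : HasVertex L i)
    (x : (leray k f n).obj (inter U {i})) :
    vertexComp k f n hL i (ofVertex k f n hL i x) = x := by
  rw [ofVertex, vertexComp, dif_pos h, dif_pos h]
  exact DirectSum.component.lof_self k
    (M := fun σ : Simplex L 0 => ((cellularLeray k U f n).restrict hL).obj (Opposite.op σ.1))
    (vertexSimplex h) x

lemma vertexComp_ofVertex_of_ne {i j : ι} (hij : i ≠ j)
    (x : (leray k f n).obj (inter U {j})) :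
    vertexComp k f n hL i (ofVertex k f n hL j x) = 0 := by
  by_cases h : HasVertex L i
  · by_cases h' : HasVertex L j
    · rw [ofVertex, vertexComp, dif_pos h, dif_pos h']
      exact DirectSum.of_eq_of_ne
        (β := fun σ : Simplex L 0 =>
          ((cellularLeray k U f n).restrict hL).obj (Opposite.op σ.1))
        (vertexSimplex h') (vertexSimplex h) x fun e => hij (vertexSimplex_injective e)
    · rw [ofVertex_of_not h', LinearMap.zero_apply, map_zero]
  · rw [vertexComp, dif_neg h, LinearMap.zero_apply]

lemma edgeComp_ofEdge_self {i j : ι} (h : HasEdge L i j)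
    (x : (leray k f n).obj (inter U {i, j})) :
    edgeComp k f n hL i j (ofEdge k f n hL i j x) = x := by
  rw [ofEdge, edgeComp, dif_pos h, dif_pos h]
  exact DirectSum.component.lof_self k
    (M := fun σ : Simplex L 1 => ((cellularLeray k U f n).restrict hL).obj (Opposite.op σ.1))
    (edgeSimplex h) x

lemma edgeComp_ofEdge_of_ne {i j i' j' : ι} (hij : ¬ (i = i' ∧ j = j'))
    (x : (leray k f n).obj (inter U {i', j'})) :
    edgeComp k f n hL i j (ofEdge k f n hL i' j' x) = 0 := by
  by_cases h : HasEdge L i j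
  · by_cases h' : HasEdge L i' j'
    · rw [ofEdge, edgeComp, dif_pos h, dif_pos h']
      exact DirectSum.of_eq_of_ne
        (β := fun σ : Simplex L 1 =>
          ((cellularLeray k U f n).restrict hL).obj (Opposite.op σ.1))
        (edgeSimplex h') (edgeSimplex h) x fun e => hij (edgeSimplex_injective e)
    · rw [ofEdge_of_not h', LinearMap.zero_apply, map_zero]
  · rw [edgeComp, dif_neg h, LinearMap.zero_apply]

lemma vertexComp_of_not {i : ι} (h : ¬ HasVertex L i) (c : CellChains k f n hL 0) :
    vertexComp k f n hL i c = 0 := by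
  rw [vertexComp, dif_neg h]
  rfl

lemma edgeComp_of_not {i j : ι} (h : ¬ HasEdge L i j) (c : CellChains k f n hL 1) :
    edgeComp k f n hL i j c = 0 := by
  rw [edgeComp, dif_neg h]
  rfl

lemma cellChains_zero_hom_ext {T : Type*} [AddCommMonoid T] [Module k T]
    {g g' : CellChains k f n hL 0 →ₗ[k] T}
    (h : ∀ i, HasVertex L i → ∀ x, g (ofVertex k f n hL i x) = g' (ofVertex k f n hL i x)) :
    g = g' := by
  refine DirectSum.linearMap_ext k fun σ => LinearMap.ext fun x => ?_
  obtain ⟨i, hi, rfl⟩ := exists_eq_vertexSimplex σ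
  have := h i hi
  rw [ofVertex_of_hasVertex hi] at this
  exact this x

lemma cellChains_one_hom_ext {T : Type*} [AddCommMonoid T] [Module k T]
    {g g' : CellChains k f n hL 1 →ₗ[k] T}
    (h : ∀ i j, HasEdge L i j → ∀ x,
      g (ofEdge k f n hL i j x) = g' (ofEdge k f n hL i j x)) :
    g = g' := by
  refine DirectSum.linearMap_ext k fun σ => LinearMap.ext fun x => ?_
  obtain ⟨i, j, hi, rfl⟩ := exists_eq_edgeSimplex σ
  have := h i j hi
  rw [ofEdge_of_hasEdge hi] at this
  exact this x

/-- The boundary map of the cellular Leray cosheaf in degree one. -/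
abbrev cellBoundary : CellChains k f n hL 1 →ₗ[k] CellChains k f n hL 0 :=
  ((cellularLeray k U f n).restrict hL).boundary 0

lemma cellBoundary_ofEdge {i j : ι} (h : HasEdge L i j)
    (x : (leray k f n).obj (inter U {i, j})) :
    cellBoundary (ofEdge k f n hL i j x) =
      ofVertex k f n hL j ((leray k f n).map (homOfLE (inter_anti U (by simp))) x) -
        ofVertex k f n hL i ((leray k f n).map (homOfLE (inter_anti U (by simp))) x) := by
  rw [ofEdge_of_hasEdge h, ofVertex_of_hasVertex h.left, ofVertex_of_hasVertex h.right]
  exact boundary_ofSimplex_edgeSimplex ((cellularLeray k U f n).restrict hL) h x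

variable [Fintype ι]

lemma sum_ofVertex_vertexComp (c : CellChains k f n hL 0) :
    ∑ i, ofVertex k f n hL i (vertexComp k f n hL i c) = c := by
  suffices h : ∑ i, ofVertex k f n hL i ∘ₗ vertexComp k f n hL i = LinearMap.id by
    simpa using LinearMap.congr_fun h c
  refine cellChains_zero_hom_ext fun j hj x => ?_
  rw [LinearMap.sum_apply, Finset.sum_eq_single j]
  · rw [LinearMap.comp_apply, vertexComp_ofVertex_self hj]
    rfl
  · intro i _ hij
    rw [LinearMap.comp_apply, vertexComp_ofVertex_of_ne hij, map_zero]
  · simp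

lemma sum_ofEdge_edgeComp (c : CellChains k f n hL 1) :
    ∑ i, ∑ j, ofEdge k f n hL i j (edgeComp k f n hL i j c) = c := by
  suffices h : ∑ i, ∑ j, ofEdge k f n hL i j ∘ₗ edgeComp k f n hL i j = LinearMap.id by
    simpa using LinearMap.congr_fun h c
  refine cellChains_one_hom_ext fun i j hj x => ?_
  rw [LinearMap.sum_apply, Finset.sum_eq_single i, LinearMap.sum_apply, Finset.sum_eq_single j]
  · rw [LinearMap.comp_apply, edgeComp_ofEdge_self hj]
    rfl
  · intro j' _ hj'
    rw [LinearMap.comp_apply, edgeComp_ofEdge_of_ne (fun h => hj' h.2), map_zero]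
  · simp
  · intro i' _ hi'
    rw [LinearMap.sum_apply]
    refine Finset.sum_eq_zero fun j' _ => ?_
    rw [LinearMap.comp_apply, edgeComp_ofEdge_of_ne (fun h => hi' h.1), map_zero]
  · simp

lemma vertexComp_sum_ofVertex {i : ι} (h : HasVertex L i)
    (x : ∀ i, (leray k f n).obj (inter U {i})) :
    vertexComp k f n hL i (∑ j, ofVertex k f n hL j (x j)) = x i := by
  rw [map_sum, Finset.sum_eq_single i, vertexComp_ofVertex_self h]
  · intro j _ hj
    exact vertexComp_ofVertex_of_ne hj.symm _
  · simp

lemma edgeComp_sum_ofEdge {i j : ι} (h : HasEdge L i j)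
    (x : ∀ i j, (leray k f n).obj (inter U {i, j})) :
    edgeComp k f n hL i j (∑ i', ∑ j', ofEdge k f n hL i' j' (x i' j')) = x i j := by
  rw [map_sum, Finset.sum_eq_single i, map_sum, Finset.sum_eq_single j, edgeComp_ofEdge_self h]
  · intro j' _ hj
    exact edgeComp_ofEdge_of_ne (fun h => hj h.2.symm) _
  · simp
  · intro i' _ hi
    rw [map_sum]
    exact Finset.sum_eq_zero fun j' _ => edgeComp_ofEdge_of_ne (fun h => hi h.1.symm) _
  · simp

end CellChains

end LerayCosheaf

end

noncomputable section

namespace LerayCosheaf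

/-! ### Cellular chains and singular chains on graphs of sets -/

section Comparison

open SingularChains

set_option linter.unusedSectionVars false

variable (k : Type u) [Field k] {X : Type u} [TopologicalSpace X] {Y : Type v}
  [TopologicalSpace Y] (f : C(X, Y)) {ι : Type} [LinearOrder ι] (U : ι → Opens Y)
  (L : PreAbstractSimplicialComplex ι)

/-- The preimages of the cover elements and of their pairwise intersections, for the vertices and
edges of `L`. -/
def preimageGraph : GraphOfSets ι X :=
  -- Simplices outside `L` get the empty set and hence carry no chains; those in `L` get the full
  -- preimage, whatever `L` is.
  (fun i => {x | HasVertex L i ∧ f x ∈ inter U {i}},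
    fun i j => {x | HasEdge L i j ∧ f x ∈ inter U {i, j}})

variable {f U L}

lemma preimageGraph_edge_subset_left (i j : ι) :
    (preimageGraph f U L).2 i j ⊆ (preimageGraph f U L).1 i :=
  fun _ hx => ⟨hx.1.left, inter_anti U (by simp) hx.2⟩

lemma preimageGraph_edge_subset_right (i j : ι) :
    (preimageGraph f U L).2 i j ⊆ (preimageGraph f U L).1 j :=
  fun _ hx => ⟨hx.1.right, inter_anti U (by simp) hx.2⟩

lemma preimageGraph_vertex_subset (i : ι) : (preimageGraph f U L).1 i ⊆ f ⁻¹' (inter U {i}) :=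
  fun _ hx => hx.2

lemma preimageGraph_edge_subset (i j : ι) : (preimageGraph f U L).2 i j ⊆ f ⁻¹' (inter U {i, j}) :=
  fun _ hx => hx.2

lemma preimageGraph_vertex {i : ι} (h : HasVertex L i) :
    (preimageGraph f U L).1 i = f ⁻¹' (inter U {i}) :=
  Set.ext fun _ => and_iff_right h

lemma preimageGraph_edge {i j : ι} (h : HasEdge L i j) :
    (preimageGraph f U L).2 i j = f ⁻¹' (inter U {i, j}) :=
  Set.ext fun _ => and_iff_right h

variable {k}

lemma degree_empty (m : ℕ) : degree (X := X) k m ∅ = ⊥ := by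
  rw [eq_bot_iff]
  intro c hc
  ext s
  exact eq_zero_of_mem_degree hc (range_not_subset_empty s)

lemma eq_zero_of_mem_degree_vertex {m : ℕ} {i : ι} (h : ¬ HasVertex L i) {c : SingularChains k X}
    (hc : c ∈ degree k m ((preimageGraph f U L).1 i)) : c = 0 := by
  have : (preimageGraph f U L).1 i = ∅ := Set.eq_empty_of_forall_notMem fun x hx => h hx.1
  rwa [this, degree_empty, Submodule.mem_bot] at hc

lemma eq_zero_of_mem_degree_edge {m : ℕ} {i j : ι} (h : ¬ HasEdge L i j) {c : SingularChains k X}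
    (hc : c ∈ degree k m ((preimageGraph f U L).2 i j)) : c = 0 := by
  have : (preimageGraph f U L).2 i j = ∅ := Set.eq_empty_of_forall_notMem fun x hx => h hx.1
  rwa [this, degree_empty, Submodule.mem_bot] at hc

variable (k f) (n : ℕ) (hL : L ≤ nerve U)

/-- Representing cycles of the components of a chain at the vertices. -/
def vertexReps : CellChains k f n hL 0 →ₗ[k] (ι → SingularChains k X) :=
  LinearMap.pi fun i => lerayRep k f n (inter U {i}) ∘ₗ vertexComp k f n hL i

/-- Representing cycles of the components of a chain at the edges. -/
def edgeReps : CellChains k f n hL 1 →ₗ[k] (ι → ι → SingularChains k X) :=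
  LinearMap.pi fun i => LinearMap.pi fun j =>
    lerayRep k f n (inter U {i, j}) ∘ₗ edgeComp k f n hL i j

variable {k f n hL}

lemma vertexReps_apply (c : CellChains k f n hL 0) (i : ι) : vertexReps k f n hL c i =
    lerayRep k f n (inter U {i}) (vertexComp k f n hL i c) := rfl

lemma edgeReps_apply (c : CellChains k f n hL 1) (i j : ι) : edgeReps k f n hL c i j =
    lerayRep k f n (inter U {i, j}) (edgeComp k f n hL i j c) := rfl

lemma vertexReps_mem (c : CellChains k f n hL 0) (i : ι) :
    vertexReps k f n hL c i ∈ setCycles k n ((preimageGraph f U L).1 i) := by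
  by_cases h : HasVertex L i
  · rw [preimageGraph_vertex h]
    exact lerayRep_mem _
  · rw [vertexReps_apply, vertexComp_of_not h, map_zero]
    exact Submodule.zero_mem _

lemma edgeReps_mem (c : CellChains k f n hL 1) (i j : ι) :
    edgeReps k f n hL c i j ∈ setCycles k n ((preimageGraph f U L).2 i j) := by
  by_cases h : HasEdge L i j
  · rw [preimageGraph_edge h]
    exact lerayRep_mem _
  · rw [edgeReps_apply, edgeComp_of_not h, map_zero]
    exact Submodule.zero_mem _

variable [Fintype ι]

lemma edgeBoundary_mem {m : ℕ} {e : ι → ι → SingularChains k X}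
    (he : ∀ i j, e i j ∈ degree k m ((preimageGraph f U L).2 i j)) (l : ι) :
    edgeBoundary k e l ∈ degree k m ((preimageGraph f U L).1 l) :=
  Submodule.sub_mem _
    (Submodule.sum_mem _ fun i _ => degree_mono k _ (preimageGraph_edge_subset_right i l) (he i l))
    (Submodule.sum_mem _ fun j _ => degree_mono k _ (preimageGraph_edge_subset_left l j) (he l j))

lemma boundary_edgeBoundary_eq_zero {e : ι → ι → SingularChains k X}
    (he : ∀ i j, boundary k (e i j) = 0) (l : ι) : boundary k (edgeBoundary k e l) = 0 := by
  rw [boundary_edgeBoundary]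
  simp [edgeBoundary_apply, he]

lemma edgeBoundary_mem_setCycles {e : ι → ι → SingularChains k X}
    (he : ∀ i j, e i j ∈ setCycles k n ((preimageGraph f U L).2 i j)) (l : ι) :
    edgeBoundary k e l ∈ setCycles k n ((preimageGraph f U L).1 l) :=
  ⟨edgeBoundary_mem (fun i j => (he i j).1) l,
    boundary_edgeBoundary_eq_zero (fun i j => (he i j).2) l⟩

variable (k f n hL)

/-- The chain with components the homology classes of cycles at the vertices. -/
def vertexClasses : (ι → SingularChains k X) →ₗ[k] CellChains k f n hL 0 :=
  ∑ i, ofVertex k f n hL i ∘ₗ lerayExt k f n (inter U {i}) ∘ₗ LinearMap.proj i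

/-- The chain with components the homology classes of cycles at the edges. -/
def edgeClasses : (ι → ι → SingularChains k X) →ₗ[k] CellChains k f n hL 1 :=
  ∑ i, ∑ j, ofEdge k f n hL i j ∘ₗ lerayExt k f n (inter U {i, j}) ∘ₗ
    LinearMap.proj j ∘ₗ LinearMap.proj i

variable {k f n hL}

lemma vertexClasses_apply (v : ι → SingularChains k X) : vertexClasses k f n hL v =
    ∑ i, ofVertex k f n hL i (lerayExt k f n (inter U {i}) (v i)) := by
  simp [vertexClasses, LinearMap.sum_apply]

lemma edgeClasses_apply (e : ι → ι → SingularChains k X) : edgeClasses k f n hL e =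
    ∑ i, ∑ j, ofEdge k f n hL i j (lerayExt k f n (inter U {i, j}) (e i j)) := by
  simp [edgeClasses, LinearMap.sum_apply]

lemma vertexClasses_vertexReps (c : CellChains k f n hL 0) :
    vertexClasses k f n hL (vertexReps k f n hL c) = c := by
  simp only [vertexClasses_apply, vertexReps_apply, lerayExt_lerayRep]
  exact sum_ofVertex_vertexComp c

lemma edgeClasses_edgeReps (c : CellChains k f n hL 1) :
    edgeClasses k f n hL (edgeReps k f n hL c) = c := by
  simp only [edgeClasses_apply, edgeReps_apply, lerayExt_lerayRep]
  exact sum_ofEdge_edgeComp c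

/-- On homology classes the extension maps of the cosheaf only enlarge the set in which a cycle is
considered, so both sides are larger end minus smaller end. -/
lemma cellBoundary_edgeClasses {e : ι → ι → SingularChains k X}
    (he : ∀ i j, e i j ∈ setCycles k n ((preimageGraph f U L).2 i j)) :
    cellBoundary (edgeClasses k f n hL e) = vertexClasses k f n hL (edgeBoundary k e) := by
  have key : ∀ i j, cellBoundary (ofEdge k f n hL i j (lerayExt k f n (inter U {i, j}) (e i j))) =
      ofVertex k f n hL j (lerayExt k f n (inter U {j}) (e i j)) -
        ofVertex k f n hL i (lerayExt k f n (inter U {i}) (e i j)) := by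
    intro i j
    by_cases h : HasEdge L i j
    · have hij := setCycles_mono (preimageGraph_edge_subset i j) (he i j)
      rw [cellBoundary_ofEdge h, leray_map_lerayExt _ hij, leray_map_lerayExt _ hij]
    · rw [eq_zero_of_mem_degree_edge h (he i j).1]
      simp only [map_zero, sub_zero]
  simp only [edgeClasses_apply, vertexClasses_apply, edgeBoundary_apply, map_sum, map_sub, key,
    Finset.sum_sub_distrib]
  rw [Finset.sum_comm]

lemma exists_vertexReps_vertexClasses_eq {v : ι → SingularChains k X}
    (hv : ∀ i, v i ∈ setCycles k n ((preimageGraph f U L).1 i)) :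
    ∃ w : ι → SingularChains k X, (∀ i, w i ∈ degree k (n + 2) ((preimageGraph f U L).1 i)) ∧
      ∀ i, vertexReps k f n hL (vertexClasses k f n hL v) i = v i + boundary k (w i) := by
  have : ∀ i, ∃ w, w ∈ degree k (n + 2) ((preimageGraph f U L).1 i) ∧
      vertexReps k f n hL (vertexClasses k f n hL v) i = v i + boundary k w := by
    intro i
    rw [vertexReps_apply, vertexClasses_apply]
    by_cases h : HasVertex L i
    · rw [vertexComp_sum_ofVertex h (fun i => lerayExt k f n (inter U {i}) (v i)),
        preimageGraph_vertex h]
      exact exists_lerayRep_lerayExt_eq (setCycles_mono (preimageGraph_vertex_subset i) (hv i))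
    · rw [vertexComp_of_not h, eq_zero_of_mem_degree_vertex h (hv i).1]
      exact ⟨0, Submodule.zero_mem _, by simp⟩
  choose w hw using this
  exact ⟨w, fun i => (hw i).1, fun i => (hw i).2⟩

lemma exists_edgeReps_edgeClasses_eq {e : ι → ι → SingularChains k X}
    (he : ∀ i j, e i j ∈ setCycles k n ((preimageGraph f U L).2 i j)) :
    ∃ g : ι → ι → SingularChains k X,
      (∀ i j, g i j ∈ degree k (n + 2) ((preimageGraph f U L).2 i j)) ∧
      ∀ i j, edgeReps k f n hL (edgeClasses k f n hL e) i j = e i j + boundary k (g i j) := by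
  have : ∀ i j, ∃ g, g ∈ degree k (n + 2) ((preimageGraph f U L).2 i j) ∧
      edgeReps k f n hL (edgeClasses k f n hL e) i j = e i j + boundary k g := by
    intro i j
    rw [edgeReps_apply, edgeClasses_apply]
    by_cases h : HasEdge L i j
    · rw [edgeComp_sum_ofEdge h (fun i j => lerayExt k f n (inter U {i, j}) (e i j)),
        preimageGraph_edge h]
      exact exists_lerayRep_lerayExt_eq (setCycles_mono (preimageGraph_edge_subset i j) (he i j))
    · rw [edgeComp_of_not h, eq_zero_of_mem_degree_edge h (he i j).1]
      exact ⟨0, Submodule.zero_mem _, by simp⟩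
  choose g hg using this
  exact ⟨g, fun i j => (hg i j).1, fun i j => (hg i j).2⟩

lemma exists_boundary_eq_of_vertexClasses_eq_zero {v : ι → SingularChains k X}
    (hv : ∀ i, v i ∈ setCycles k n ((preimageGraph f U L).1 i))
    (h : vertexClasses k f n hL v = 0) (i : ι) :
    ∃ w ∈ degree k (n + 2) ((preimageGraph f U L).1 i), boundary k w = v i := by
  obtain ⟨w, hw, hw'⟩ := exists_vertexReps_vertexClasses_eq (hL := hL) hv
  refine ⟨-w i, Submodule.neg_mem _ (hw i), ?_⟩
  have := hw' i
  rw [h, map_zero, Pi.zero_apply] at this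
  rw [map_neg, neg_eq_iff_add_eq_zero, add_comm, ← this]

lemma vertexClasses_boundary {w : ι → SingularChains k X}
    (hw : ∀ i, w i ∈ degree k (n + 2) ((preimageGraph f U L).1 i)) :
    vertexClasses k f n hL (fun i => boundary k (w i)) = 0 := by
  rw [vertexClasses_apply]
  refine Finset.sum_eq_zero fun i _ => ?_
  rw [lerayExt_boundary (degree_mono k _ (preimageGraph_vertex_subset i) (hw i)), map_zero]

lemma edgeClasses_boundary {g : ι → ι → SingularChains k X}
    (hg : ∀ i j, g i j ∈ degree k (n + 2) ((preimageGraph f U L).2 i j)) :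
    edgeClasses k f n hL (fun i j => boundary k (g i j)) = 0 := by
  rw [edgeClasses_apply]
  refine Finset.sum_eq_zero fun i _ => Finset.sum_eq_zero fun j _ => ?_
  rw [lerayExt_boundary (degree_mono k _ (preimageGraph_edge_subset i j) (hg i j)), map_zero]

/-! #### The comparison maps on chains -/

variable (k f n hL)

/-- The cycle of the total complex given by a `0`-chain. -/
def vertexCycle : CellChains k f n hL 0 →ₗ[k] graphCycles k n (preimageGraph f U L) :=
  LinearMap.codRestrict _ (LinearMap.inl k _ _ ∘ₗ vertexReps k f n hL :
    CellChains k f n hL 0 →ₗ[k] GraphChains k ι X) fun c =>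
      ⟨fun i => (vertexReps_mem c i).1, fun _ _ => Submodule.zero_mem _, fun _ _ => map_zero _,
        fun i => ((vertexReps_mem c i).2 : _ = _).trans
          (congrFun (map_zero (edgeBoundary k)) i).symm⟩

lemma edgeBoundary_edgeReps_eq_boundary {c : CellChains k f n hL 1}
    (hc : cellBoundary c = 0) (l : ι) :
    ∃ w ∈ degree k (n + 2) ((preimageGraph f U L).1 l),
      boundary k w = edgeBoundary k (edgeReps k f n hL c) l := by
  refine exists_boundary_eq_of_vertexClasses_eq_zero (hL := hL)
    (fun l => edgeBoundary_mem_setCycles (edgeReps_mem c) l) ?_ l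
  rw [← cellBoundary_edgeClasses (edgeReps_mem c), edgeClasses_edgeReps, hc]

/-- The filling is chosen in the full preimage of U_l. For l in `L` this is the set at the vertex l,
and otherwise the chain to be filled is zero; so one choice serves all subcomplexes. -/
lemma filling_edgeBoundary_edgeReps {c : CellChains k f n hL 1}
    (hc : cellBoundary c = 0) (l : ι) :
    filling k (n + 1) (f ⁻¹' inter U {l}) (edgeBoundary k (edgeReps k f n hL c) l) ∈
        degree k (n + 2) ((preimageGraph f U L).1 l) ∧
      boundary k (filling k (n + 1) (f ⁻¹' inter U {l})
        (edgeBoundary k (edgeReps k f n hL c) l)) = edgeBoundary k (edgeReps k f n hL c) l := by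
  obtain ⟨w, hw, hw'⟩ := edgeBoundary_edgeReps_eq_boundary k f n hL hc l
  by_cases h : HasVertex L l
  · rw [preimageGraph_vertex h] at hw ⊢
    rw [← hw']
    exact ⟨filling_mem_degree hw, boundary_filling hw⟩
  · rw [← hw', eq_zero_of_mem_degree_vertex h hw, map_zero, map_zero, map_zero]
    exact ⟨Submodule.zero_mem _, rfl⟩

/-- The chain of the total complex given by a `1`-chain. -/
def edgeChain : CellChains k f n hL 1 →ₗ[k] GraphChains k ι X :=
  (LinearMap.prod (LinearMap.pi fun l => filling k (n + 1) (f ⁻¹' inter U {l}) ∘ₗ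
      LinearMap.proj l ∘ₗ edgeBoundary k ∘ₗ edgeReps k f n hL) (edgeReps k f n hL) :)

/-- The cycle of the total complex given by a `1`-cycle. -/
def edgeCycle : LinearMap.ker (cellBoundary (k := k) (f := f) (n := n) (hL := hL)) →ₗ[k]
    graphCycles k (n + 1) (preimageGraph f U L) :=
  LinearMap.codRestrict _ (edgeChain k f n hL ∘ₗ Submodule.subtype _) fun c =>
    ⟨fun i => (filling_edgeBoundary_edgeReps k f n hL c.2 i).1,
    fun i j => (edgeReps_mem c.1 i j).1, fun i j => (edgeReps_mem c.1 i j).2,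
    fun i => (filling_edgeBoundary_edgeReps k f n hL c.2 i).2⟩

variable {k f n hL}

lemma vertexCycle_fst (c : CellChains k f n hL 0) :
    (vertexCycle k f n hL c).1.1 = vertexReps k f n hL c := rfl

lemma vertexCycle_cellBoundary (d : CellChains k f n hL 1) :
    (vertexCycle k f n hL (cellBoundary d)).1 ∈ graphBoundaries k n (preimageGraph f U L) := by
  obtain ⟨w, hw, hw'⟩ := exists_vertexReps_vertexClasses_eq (hL := hL)
    (edgeBoundary_mem_setCycles (edgeReps_mem d))
  have hw'' := fun i => (hw' i).trans (add_comm _ _)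
  refine ⟨w, edgeReps k f n hL d, hw, fun i j => (edgeReps_mem d i j).1, fun i => ?_,
    fun i j => ((edgeReps_mem d i j).2 : _ = _).symm⟩
  rw [vertexCycle_fst, ← hw'', ← cellBoundary_edgeClasses (edgeReps_mem d),
    edgeClasses_edgeReps]

/-- The edge component of `vertexCycle` is zero, so the edge part g of a bounding chain consists of
cycles. Their classes form the required cellular 1-chain, since the terms ∂w have class zero. -/
lemma exists_cellBoundary_eq_of_vertexCycle_mem {c : CellChains k f n hL 0}
    (hc : (vertexCycle k f n hL c).1 ∈ graphBoundaries k n (preimageGraph f U L)) :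
    ∃ d, cellBoundary d = c := by
  obtain ⟨w, g, hw, hg, h1, h2⟩ := hc
  have hg' : ∀ i j, g i j ∈ setCycles k n ((preimageGraph f U L).2 i j) := fun i j =>
    ⟨hg i j, (h2 i j).symm⟩
  refine ⟨edgeClasses k f n hL g, ?_⟩
  rw [cellBoundary_edgeClasses hg', ← vertexClasses_vertexReps c]
  have : vertexReps k f n hL c = (fun i => boundary k (w i)) + edgeBoundary k g := funext h1
  rw [this, map_add, vertexClasses_boundary hw]
  exact (zero_add _).symm

/-- The edge component of the sum consists of the representatives of `b` alone; if these are
boundaries, their classes vanish. -/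
lemma eq_zero_of_vertexCycle_add_edgeCycle_mem {a : CellChains k f (n + 1) hL 0}
    {b : LinearMap.ker (cellBoundary (k := k) (f := f) (n := n) (hL := hL))}
    (h : (vertexCycle k f (n + 1) hL a + edgeCycle k f n hL b).1 ∈
      graphBoundaries k (n + 1) (preimageGraph f U L)) : b = 0 := by
  obtain ⟨w, g, hw, hg, h1, h2⟩ := h
  refine Subtype.ext ?_
  rw [← edgeClasses_edgeReps b.1]
  have : edgeReps k f n hL b.1 = fun i j => boundary k (g i j) := by
    ext1 i
    ext1 j
    refine Eq.trans ?_ (h2 i j)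
    exact (zero_add (edgeReps k f n hL b.1 i j)).symm
  rw [this, edgeClasses_boundary hg]
  rfl

lemma exists_eq_vertexCycle_add {n : ℕ} {x : GraphChains k ι X}
    (hx : x ∈ graphCycles k n (preimageGraph f U L)) (hx' : x.2 = 0) :
    ∃ a : CellChains k f n hL 0,
      x - (vertexCycle k f n hL a).1 ∈ graphBoundaries k n (preimageGraph f U L) := by
  obtain ⟨w, hw, hw'⟩ := exists_vertexReps_vertexClasses_eq (hL := hL) (v := x.1) fun i =>
    ⟨hx.1 i, by
      have := hx.2.2.2 i
      rwa [hx', map_zero] at this⟩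
  refine ⟨vertexClasses k f n hL x.1, -w, 0, fun i => Submodule.neg_mem _ (hw i),
    fun i j => Submodule.zero_mem _, fun i => ?_, fun i j => ?_⟩
  · change x.1 i - vertexReps k f n hL _ i = _
    rw [hw', map_zero, Pi.neg_apply, map_neg, Pi.zero_apply, add_zero, sub_add_cancel_left]
  · change x.2 i j - 0 = _
    rw [hx', sub_zero]
    exact (map_zero _).symm

/-- The classes of the edge component form a cellular 1-cycle `b`, because its edge boundary is ∂x₁.
Subtracting the cycle of `b` and adding a boundary `y` makes the edge component zero, and what
remains comes from vertices by `exists_eq_vertexCycle_add`. -/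
lemma exists_eq_vertexCycle_add_edgeCycle {x : GraphChains k ι X}
    (hx : x ∈ graphCycles k (n + 1) (preimageGraph f U L)) :
    ∃ (a : CellChains k f (n + 1) hL 0)
      (b : LinearMap.ker (cellBoundary (k := k) (f := f) (n := n) (hL := hL))),
      x - (vertexCycle k f (n + 1) hL a + edgeCycle k f n hL b).1 ∈
        graphBoundaries k (n + 1) (preimageGraph f U L) := by
  have he : ∀ i j, x.2 i j ∈ setCycles k n ((preimageGraph f U L).2 i j) := fun i j =>
    ⟨hx.2.1 i j, hx.2.2.1 i j⟩
  have hb : cellBoundary (edgeClasses k f n hL x.2) = 0 := by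
    rw [cellBoundary_edgeClasses he]
    have : edgeBoundary k x.2 = fun i => boundary k (x.1 i) := funext fun i => (hx.2.2.2 i).symm
    rw [this, vertexClasses_boundary hx.1]
  let b : LinearMap.ker (cellBoundary (k := k) (f := f) (n := n) (hL := hL)) :=
    ⟨edgeClasses k f n hL x.2, hb⟩
  obtain ⟨g, hg, hg'⟩ := exists_edgeReps_edgeClasses_eq (hL := hL) he
  let y : GraphChains k ι X := (edgeBoundary k g, fun i j => boundary k (g i j))
  have hy : y ∈ graphBoundaries k (n + 1) (preimageGraph f U L) :=
    ⟨0, g, fun i => Submodule.zero_mem _, hg, fun i => by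
      change edgeBoundary k g i = boundary k 0 + _
      rw [map_zero, zero_add], fun i j => rfl⟩
  have hy' : y ∈ graphCycles k (n + 1) (preimageGraph f U L) :=
    ⟨edgeBoundary_mem hg, fun i j => boundary_mem_degree (hg i j),
      fun i j => boundary_boundary _, fun i => boundary_edgeBoundary _ _⟩
  obtain ⟨a, ha⟩ := exists_eq_vertexCycle_add (hL := hL)
    (Submodule.add_mem _ (Submodule.sub_mem _ hx (edgeCycle k f n hL b).2) hy') (by
      ext1 i
      ext1 j
      change x.2 i j - edgeReps k f n hL (edgeClasses k f n hL x.2) i j + boundary k (g i j) = 0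
      rw [hg']
      abel)
  refine ⟨a, b, ?_⟩
  have := Submodule.sub_mem _ ha hy
  convert this using 1
  change x - ((vertexCycle k f (n + 1) hL a).1 + (edgeCycle k f n hL b).1) = _
  abel

end Comparison

end LerayCosheaf

end

noncomputable section

namespace LerayCosheaf

/-! ### The comparison maps on homology -/

section Lift

variable {R M N T : Type*} [Ring R] [AddCommGroup M] [Module R M] [AddCommGroup N]
  [Module R N] [AddCommGroup T] [Module R T]

lemma exists_lift_of_surjective {p : M →ₗ[R] N} (hp : Function.Surjective p) (g : M →ₗ[R] T)
    (h : ∀ x, p x = 0 → g x = 0) : ∃ l : N →ₗ[R] T, ∀ x, l (p x) = g x := by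
  refine ⟨(LinearMap.ker p).liftQ g (fun x hx => h x hx) ∘ₗ
    (p.quotKerEquivOfSurjective hp).symm.toLinearMap, fun x => ?_⟩
  have : (p.quotKerEquivOfSurjective hp).symm (p x) = Submodule.Quotient.mk x := by
    rw [LinearEquiv.symm_apply_eq]
    rfl
  rw [LinearMap.comp_apply, LinearEquiv.coe_coe, this]
  rfl

end Lift

section HomologyComparison

open SingularChains

set_option linter.unusedSectionVars false

variable (k : Type u) [Field k] {X : Type u} [TopologicalSpace X] {Y : Type v}
  [TopologicalSpace Y] (f : C(X, Y)) {ι : Type} [LinearOrder ι] {U : ι → Opens Y}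
  {L : PreAbstractSimplicialComplex ι} (n : ℕ) (hL : L ≤ nerve U)

/-- The chain complex of a subcomplex of the nerve. -/
abbrev cellComplex : ChainComplex (ModuleCat.{u} k) ℕ :=
  ((cellularLeray k U f n).restrict hL).chainComplex

variable {k f n hL}

lemma cellComplex_d (p : ℕ) (x : CellChains k f n hL (p + 1)) :
    (cellComplex k f n hL).d (p + 1) p x = ((cellularLeray k U f n).restrict hL).boundary p x :=
  LinearMap.congr_fun (congrArg ModuleCat.Hom.hom (ChainComplex.of_d
    (fun p => ModuleCat.of k (((cellularLeray k U f n).restrict hL).Chains p))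
    (fun p => ModuleCat.ofHom (((cellularLeray k U f n).restrict hL).boundary p)) p)) x

lemma cellBoundary_eq_zero {c : (cellComplex k f n hL).X 1}
    (hc : c ∈ complexCycles (cellComplex k f n hL) 1) :
    cellBoundary (c : CellChains k f n hL 1) = 0 :=
  (cellComplex_d 0 c).symm.trans (mem_complexCycles_succ_iff.1 hc)

variable (k f n hL)

/-- The `0`-cycles of the chain complex. -/
def toCellChains : complexCycles (cellComplex k f n hL) 0 →ₗ[k] CellChains k f n hL 0 :=
  Submodule.subtype (complexCycles (cellComplex k f n hL) 0)

/-- The `1`-cycles of the chain complex. -/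
def toKer : complexCycles (cellComplex k f n hL) 1 →ₗ[k]
    LinearMap.ker (cellBoundary (k := k) (f := f) (n := n) (hL := hL)) where
  toFun c := ⟨c.1, cellBoundary_eq_zero c.2⟩
  map_add' _ _ := rfl
  map_smul' _ _ := rfl

variable [Fintype ι]

lemma exists_vertexMap : ∃ l : (cellComplex k f n hL).homology 0 →ₗ[k]
    GraphHomology k n (preimageGraph f U L), ∀ c : complexCycles (cellComplex k f n hL) 0,
      l (cycleClass _ 0 c) = GraphHomology.mk (vertexCycle k f n hL c.1) := by
  refine exists_lift_of_surjective (cycleClass_surjective _ 0)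
    (GraphHomology.mk ∘ₗ vertexCycle k f n hL ∘ₗ toCellChains k f n hL) fun c hc => ?_
  obtain ⟨d, hd⟩ := (cycleClass_eq_zero_iff c).1 hc
  have hd' := (cellComplex_d 0 d).symm.trans hd
  refine GraphHomology.mk_eq_zero_iff.2 ?_
  have := vertexCycle_cellBoundary (k := k) (f := f) (n := n) (hL := hL) d
  rw [show cellBoundary d = _ from hd'] at this
  exact this

/-- The map from the cellular homology in degree zero to the homology of the total complex. -/
def vertexMap : (cellComplex k f n hL).homology 0 →ₗ[k] GraphHomology k n (preimageGraph f U L) :=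
  (exists_vertexMap k f n hL).choose

variable {k f n hL}

lemma vertexMap_cycleClass (c : complexCycles (cellComplex k f n hL) 0) :
    vertexMap k f n hL (cycleClass _ 0 c) = GraphHomology.mk (vertexCycle k f n hL c.1) :=
  (exists_vertexMap k f n hL).choose_spec c

variable (hU : ∀ σ ∈ nerve U, σ.card ≤ 2)

include hL hU in
lemma isEmpty_simplex_two : IsEmpty (Simplex L 2) :=
  ⟨fun σ => by
    have h1 := hU _ (hL σ.1.2)
    have h2 := σ.2
    omega⟩

-- Without 2-simplices there are no boundaries in degree one, so H_1 is the kernel of the cellular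
-- boundary. This makes `edgeMap` well defined.
include hU in
lemma cycleClass_one_eq_zero {c : complexCycles (cellComplex k f n hL) 1}
    (hc : cycleClass _ 1 c = 0) : c = 0 := by
  obtain ⟨d, hd⟩ := (cycleClass_eq_zero_iff c).1 hc
  have := isEmpty_simplex_two (hL := hL) hU
  have hd0 : ∀ d : CellChains k f n hL 2, d = 0 := fun d => DFinsupp.ext fun σ => this.elim σ
  refine Subtype.ext (hd.symm.trans ((cellComplex_d 1 d).trans ?_))
  exact (congrArg (((cellularLeray k U f n).restrict hL).boundary 1) (hd0 d)).trans (map_zero _)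

variable (k f n hL)

include hU in
lemma exists_edgeMap : ∃ l : (cellComplex k f n hL).homology 1 →ₗ[k]
    GraphHomology k (n + 1) (preimageGraph f U L), ∀ c : complexCycles (cellComplex k f n hL) 1,
      l (cycleClass _ 1 c) = GraphHomology.mk (edgeCycle k f n hL (toKer k f n hL c)) := by
  refine exists_lift_of_surjective (cycleClass_surjective _ 1)
    (GraphHomology.mk ∘ₗ edgeCycle k f n hL ∘ₗ toKer k f n hL) fun c hc => ?_
  rw [cycleClass_one_eq_zero hU hc, map_zero]

/-- The map from the cellular homology in degree one to the homology of the total complex. -/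
def edgeMap : (cellComplex k f n hL).homology 1 →ₗ[k]
    GraphHomology k (n + 1) (preimageGraph f U L) :=
  (exists_edgeMap k f n hL hU).choose

variable {k f n hL}

lemma edgeMap_cycleClass (c : complexCycles (cellComplex k f n hL) 1) :
    edgeMap k f n hL hU (cycleClass _ 1 c) =
      GraphHomology.mk (edgeCycle k f n hL (toKer k f n hL c)) :=
  (exists_edgeMap k f n hL hU).choose_spec c

lemma vertexMap_injective : Function.Injective (vertexMap k f n hL) := by
  rw [injective_iff_map_eq_zero]
  intro h hh
  obtain ⟨c, rfl⟩ := cycleClass_surjective _ 0 h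
  rw [vertexMap_cycleClass] at hh
  obtain ⟨d, hd⟩ := exists_cellBoundary_eq_of_vertexCycle_mem (GraphHomology.mk_eq_zero_iff.1 hh)
  exact (cycleClass_eq_zero_iff c).2 ⟨d, (cellComplex_d 0 d).trans hd⟩

lemma vertexMap_surjective : Function.Surjective (vertexMap k f 0 hL) := by
  intro h
  obtain ⟨x, rfl⟩ := Submodule.mkQ_surjective _ h
  -- Edge chains of a degree zero cycle have dimension -1.
  have hx : x.1.2 = 0 := by
    ext1 i
    ext1 j
    have := x.2.2.1 i j
    rwa [degree_zero, Submodule.mem_bot] at this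
  obtain ⟨a, ha⟩ := exists_eq_vertexCycle_add (hL := hL) x.2 hx
  refine ⟨cycleClass _ 0 ⟨a, mem_complexCycles_zero _⟩, ?_⟩
  rw [vertexMap_cycleClass]
  refine (sub_eq_zero.1 ?_).symm
  exact (map_sub GraphHomology.mk x _).symm.trans (GraphHomology.mk_eq_zero_iff.2 ha)

lemma vertexMap_coprod_edgeMap_bijective : Function.Bijective
    ((vertexMap k f (n + 1) hL).coprod (edgeMap k f n hL hU)) := by
  constructor
  · rw [injective_iff_map_eq_zero]
    rintro ⟨a, b⟩ h
    obtain ⟨a, rfl⟩ := cycleClass_surjective _ 0 a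
    obtain ⟨b, rfl⟩ := cycleClass_surjective _ 1 b
    rw [LinearMap.coprod_apply] at h
    have h' := h
    rw [vertexMap_cycleClass, edgeMap_cycleClass, ← map_add] at h'
    -- The edge component forces `b = 0` first; then `a` is handled by injectivity of `vertexMap`.
    have hb := eq_zero_of_vertexCycle_add_edgeCycle_mem (GraphHomology.mk_eq_zero_iff.1 h')
    have hb' : b = 0 := by
      have := congrArg Subtype.val hb
      exact Subtype.ext this
    have hb0 : cycleClass (cellComplex k f n hL) 1 b = 0 := by rw [hb', map_zero]
    dsimp only at h
    rw [hb0, map_zero, add_zero] at h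
    exact Prod.ext (vertexMap_injective (h.trans (map_zero _).symm)) hb0
  · intro h
    obtain ⟨x, rfl⟩ := Submodule.mkQ_surjective _ h
    obtain ⟨a, b, ha⟩ := exists_eq_vertexCycle_add_edgeCycle (hL := hL) x.2
    refine ⟨(cycleClass _ 0 ⟨a, mem_complexCycles_zero _⟩,
      cycleClass _ 1 ⟨b.1, mem_complexCycles_succ_iff.2 ((cellComplex_d 0 b.1).trans b.2)⟩), ?_⟩
    rw [LinearMap.coprod_apply, vertexMap_cycleClass, edgeMap_cycleClass, ← map_add]
    refine (sub_eq_zero.1 ?_).symm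
    exact (map_sub GraphHomology.mk x _).symm.trans (GraphHomology.mk_eq_zero_iff.2 ha)

end HomologyComparison

end LerayCosheaf

end

noncomputable section

namespace LerayCosheaf

/-! ### Naturality of the comparison maps in the subcomplex -/

section Naturality

open SingularChains

set_option linter.unusedSectionVars false

variable {k : Type u} [Field k] {X : Type u} [TopologicalSpace X] {Y : Type v}
  [TopologicalSpace Y] {f : C(X, Y)} {ι : Type} [LinearOrder ι] {U : ι → Opens Y}
  {L M : PreAbstractSimplicialComplex ι} {n : ℕ} (hM : M ≤ nerve U) (h : L ≤ M)

variable (k f n) in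
/-- The inclusion of chains. -/
abbrev cellIncl (p : ℕ) : CellChains k f n (h.trans hM) p →ₗ[k] CellChains k f n hM p :=
  (cellularLeray k U f n).chainsIncl hM h p

lemma HasVertex.mono {L M : PreAbstractSimplicialComplex ι} {i : ι} (hi : HasVertex L i) (h : L ≤ M) : HasVertex M i := h hi

lemma HasEdge.mono {L M : PreAbstractSimplicialComplex ι} {i j : ι} (hi : HasEdge L i j) (h : L ≤ M) : HasEdge M i j := ⟨hi.1, h hi.2⟩

lemma preimageGraph_mono {L M : PreAbstractSimplicialComplex ι} (h : L ≤ M) : preimageGraph f U L ≤ preimageGraph f U M :=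
  ⟨fun _ _ hx => ⟨hx.1.mono h, hx.2⟩, fun _ _ _ hx => ⟨hx.1.mono h, hx.2⟩⟩

lemma cellIncl_ofVertex {i : ι} (hi : HasVertex L i) (x : (leray k f n).obj (inter U {i})) :
    cellIncl k f n hM h 0 (ofVertex k f n (h.trans hM) i x) = ofVertex k f n hM i x := by
  rw [ofVertex_of_hasVertex hi, ofVertex_of_hasVertex (hi.mono h)]
  exact CellularCosheaf.chainsIncl_ofSimplex (cellularLeray k U f n) hM h (vertexSimplex hi) x

lemma cellIncl_ofEdge {i j : ι} (hi : HasEdge L i j) (x : (leray k f n).obj (inter U {i, j})) :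
    cellIncl k f n hM h 1 (ofEdge k f n (h.trans hM) i j x) = ofEdge k f n hM i j x := by
  rw [ofEdge_of_hasEdge hi, ofEdge_of_hasEdge (hi.mono h)]
  exact CellularCosheaf.chainsIncl_ofSimplex (cellularLeray k U f n) hM h (edgeSimplex hi) x

lemma vertexComp_cellIncl (i : ι) (c : CellChains k f n (h.trans hM) 0) :
    vertexComp k f n hM i (cellIncl k f n hM h 0 c) = vertexComp k f n (h.trans hM) i c := by
  suffices e : vertexComp k f n hM i ∘ₗ cellIncl k f n hM h 0 = vertexComp k f n (h.trans hM) i from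
    LinearMap.congr_fun e c
  refine cellChains_zero_hom_ext fun j hj x => ?_
  rw [LinearMap.comp_apply, cellIncl_ofVertex hM h hj]
  obtain rfl | hij := eq_or_ne i j
  · rw [vertexComp_ofVertex_self hj, vertexComp_ofVertex_self (hj.mono h)]
  · rw [vertexComp_ofVertex_of_ne hij, vertexComp_ofVertex_of_ne hij]

lemma edgeComp_cellIncl (i j : ι) (c : CellChains k f n (h.trans hM) 1) :
    edgeComp k f n hM i j (cellIncl k f n hM h 1 c) = edgeComp k f n (h.trans hM) i j c := by
  suffices e : edgeComp k f n hM i j ∘ₗ cellIncl k f n hM h 1 =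
    edgeComp k f n (h.trans hM) i j from LinearMap.congr_fun e c
  refine cellChains_one_hom_ext fun i' j' hj x => ?_
  rw [LinearMap.comp_apply, cellIncl_ofEdge hM h hj]
  by_cases hij : i = i' ∧ j = j'
  · obtain ⟨rfl, rfl⟩ := hij
    rw [edgeComp_ofEdge_self hj, edgeComp_ofEdge_self (hj.mono h)]
  · rw [edgeComp_ofEdge_of_ne hij, edgeComp_ofEdge_of_ne hij]

lemma vertexReps_cellIncl (c : CellChains k f n (h.trans hM) 0) :
    vertexReps k f n hM (cellIncl k f n hM h 0 c) = vertexReps k f n (h.trans hM) c := by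
  ext1 i
  rw [vertexReps_apply, vertexReps_apply, vertexComp_cellIncl]

lemma edgeReps_cellIncl (c : CellChains k f n (h.trans hM) 1) :
    edgeReps k f n hM (cellIncl k f n hM h 1 c) = edgeReps k f n (h.trans hM) c := by
  ext1 i
  ext1 j
  rw [edgeReps_apply, edgeReps_apply, edgeComp_cellIncl]

variable [Fintype ι]

lemma vertexCycle_cellIncl (c : CellChains k f n (h.trans hM) 0) :
    (vertexCycle k f n hM (cellIncl k f n hM h 0 c)).1 =
      (vertexCycle k f n (h.trans hM) c).1 :=
  Prod.ext (vertexReps_cellIncl hM h c) rfl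

/-- Representatives and fillings are chosen without reference to the subcomplex, so the
compatibility holds strictly on chains, not merely up to boundaries. -/
lemma edgeChain_cellIncl (c : CellChains k f n (h.trans hM) 1) :
    edgeChain k f n hM (cellIncl k f n hM h 1 c) = edgeChain k f n (h.trans hM) c := by
  refine Prod.ext (funext fun l => ?_) (edgeReps_cellIncl hM h c)
  exact congrArg (fun e => filling k (n + 1) (f ⁻¹' inter U {l}) (edgeBoundary k e l))
    (edgeReps_cellIncl hM h c)

variable (k f U)

/-- The graphs of preimages of the subcomplexes of the nerve. -/
def preimageGraphFunctor : Set.Iic (nerve U) ⥤ GraphOfSets ι X :=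
  Monotone.functor (f := fun L => preimageGraph f U L.1) fun _ _ h => preimageGraph_mono h

variable (n)

/-- The comparison map for homology in degree zero, as a natural transformation. -/
def vertexTransformation :
    (cellularLeray k U f n).homology 0 ⟶ preimageGraphFunctor f U ⋙ graphHomologyFunctor k n where
  app L := ModuleCat.ofHom (vertexMap k f n L.2)
  naturality L M h := by
    ext x
    obtain ⟨c, rfl⟩ := cycleClass_surjective _ 0 x
    have e : vertexMap k f n M.2 (HomologicalComplex.homologyMap
        ((cellularLeray k U f n).chainComplexFunctor.map h) 0 (cycleClass _ 0 c)) =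
        (graphHomologyFunctor k n).map ((preimageGraphFunctor f U).map h)
          (GraphHomology.mk (vertexCycle k f n _ c.1)) :=
      (congrArg (vertexMap k f n M.2) (homologyMap_cycleClass _ c)).trans
        ((vertexMap_cycleClass _).trans (congrArg GraphHomology.mk
          (Subtype.ext (vertexCycle_cellIncl M.2 (leOfHom h) c.1))))
    exact e.trans (congrArg ((graphHomologyFunctor k n).map ((preimageGraphFunctor f U).map h))
      (vertexMap_cycleClass c).symm)

variable {U} (hU : ∀ σ ∈ nerve U, σ.card ≤ 2)

/-- The comparison map for homology in degree one, as a natural transformation. -/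
def edgeTransformation : (cellularLeray k U f n).homology 1 ⟶
    preimageGraphFunctor f U ⋙ graphHomologyFunctor k (n + 1) where
  app L := ModuleCat.ofHom (edgeMap k f n L.2 hU)
  naturality L M h := by
    ext x
    obtain ⟨c, rfl⟩ := cycleClass_surjective _ 1 x
    have e : edgeMap k f n M.2 hU (HomologicalComplex.homologyMap
        ((cellularLeray k U f n).chainComplexFunctor.map h) 1 (cycleClass _ 1 c)) =
        (graphHomologyFunctor k (n + 1)).map ((preimageGraphFunctor f U).map h)
          (GraphHomology.mk (edgeCycle k f n _ (toKer k f n _ c))) :=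
      (congrArg (edgeMap k f n M.2 hU) (homologyMap_cycleClass _ c)).trans
        ((edgeMap_cycleClass hU _).trans (congrArg GraphHomology.mk
          (Subtype.ext (edgeChain_cellIncl M.2 (leOfHom h) c.1))))
    exact e.trans (congrArg ((graphHomologyFunctor k (n + 1)).map ((preimageGraphFunctor f U).map h))
      (edgeMap_cycleClass hU c).symm)

end Naturality

end LerayCosheaf

end

noncomputable section

namespace LerayCosheaf

/-! ### The continuous extension in terms of singular chains -/

section ContinuousExtension

set_option linter.unusedSectionVars false

variable (k : Type u) [Field k] {X : Type u} [TopologicalSpace X] {Y : Type v}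
  [TopologicalSpace Y] (f : C(X, Y)) {ι : Type} [LinearOrder ι] [Fintype ι] (U : ι → Opens Y)

/-- The graphs of preimages of the complexes `K_V`. -/
def meetingGraphFunctor : Opens Y ⥤ GraphOfSets ι X := meetingFunctor U ⋙ preimageGraphFunctor f U

/-- A transformation out of a biproduct of functors is an isomorphism if it is so on elements. -/
lemma isIso_biprod_desc {C : Type*} [Category C] {F G H : C ⥤ ModuleCat.{u} k}
    (a : F ⟶ H) (b : G ⟶ H)
    (h : ∀ V, Function.Bijective ((a.app V).hom.coprod (b.app V).hom)) :
    IsIso (biprod.desc a b) := by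
  rw [NatTrans.isIso_iff_isIso_app]
  intro V
  rw [ConcreteCategory.isIso_iff_bijective]
  have e : ∀ x, (biprod.desc a b).app V x = ((a.app V).hom.coprod (b.app V).hom)
      ((biprod.fst : F ⊞ G ⟶ F).app V x, (biprod.snd : F ⊞ G ⟶ G).app V x) := by
    intro x
    rw [biprod.desc_eq]
    rfl
  have h1 : ∀ x, (biprod.inl : F ⟶ F ⊞ G).app V ((biprod.fst : F ⊞ G ⟶ F).app V x) +
      (biprod.inr : G ⟶ F ⊞ G).app V ((biprod.snd : F ⊞ G ⟶ G).app V x) = x := fun x =>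
    LinearMap.congr_fun (congrArg (fun t : F ⊞ G ⟶ F ⊞ G => (t.app V).hom) biprod.total) x
  have h2 : ∀ x, (biprod.fst : F ⊞ G ⟶ F).app V ((biprod.inl : F ⟶ F ⊞ G).app V x) = x := fun x =>
    LinearMap.congr_fun (congrArg (fun t : F ⟶ F => (t.app V).hom) biprod.inl_fst) x
  have h3 : ∀ x, (biprod.snd : F ⊞ G ⟶ G).app V ((biprod.inl : F ⟶ F ⊞ G).app V x) = 0 := fun x =>
    LinearMap.congr_fun (congrArg (fun t : F ⟶ G => (t.app V).hom) biprod.inl_snd) x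
  have h4 : ∀ x, (biprod.fst : F ⊞ G ⟶ F).app V ((biprod.inr : G ⟶ F ⊞ G).app V x) = 0 := fun x =>
    LinearMap.congr_fun (congrArg (fun t : G ⟶ F => (t.app V).hom) biprod.inr_fst) x
  have h5 : ∀ x, (biprod.snd : F ⊞ G ⟶ G).app V ((biprod.inr : G ⟶ F ⊞ G).app V x) = x := fun x =>
    LinearMap.congr_fun (congrArg (fun t : G ⟶ G => (t.app V).hom) biprod.inr_snd) x
  constructor
  · intro x y hxy
    rw [e, e] at hxy
    obtain ⟨hx, hy⟩ := Prod.mk.inj ((h V).1 hxy)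
    rw [← h1 x, ← h1 y, hx, hy]
  · intro z
    obtain ⟨⟨p, q⟩, rfl⟩ := (h V).2 z
    refine ⟨(biprod.inl : F ⟶ F ⊞ G).app V p + (biprod.inr : G ⟶ F ⊞ G).app V q, ?_⟩
    rw [e]
    congr 1
    refine Prod.ext ?_ ?_
    · change (biprod.fst : F ⊞ G ⟶ F).app V _ = p
      rw [map_add, h2, h4, add_zero]
    · change (biprod.snd : F ⊞ G ⟶ G).app V _ = q
      rw [map_add, h3, h5, zero_add]

variable {U} (hU : ∀ σ ∈ nerve U, σ.card ≤ 2)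

/-- The continuous extension computes the homology of the total complexes of the graphs of
preimages of the complexes `K_V`. -/
def continuousExtensionIso : ∀ n, continuousExtension k U f n ≅
    meetingGraphFunctor f U ⋙ graphHomologyFunctor k n
  | 0 => by
    have : IsIso (Functor.whiskerLeft (meetingFunctor U) (vertexTransformation k f U 0)) := by
      rw [NatTrans.isIso_iff_isIso_app]
      intro V
      rw [ConcreteCategory.isIso_iff_bijective]
      exact ⟨vertexMap_injective (hL := ((meetingFunctor U).obj V).2),
        vertexMap_surjective (hL := ((meetingFunctor U).obj V).2)⟩
    let e := asIso (Functor.whiskerLeft (meetingFunctor U) (vertexTransformation k f U 0))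
    exact e
  | n + 1 => by
    have : IsIso (biprod.desc
        (Functor.whiskerLeft (meetingFunctor U) (vertexTransformation k f U (n + 1)))
        (Functor.whiskerLeft (meetingFunctor U) (edgeTransformation k f n hU))) :=
      isIso_biprod_desc k _ _ fun V =>
        vertexMap_coprod_edgeMap_bijective (hL := ((meetingFunctor U).obj V).2) hU
    let e := asIso (biprod.desc
        (Functor.whiskerLeft (meetingFunctor U) (vertexTransformation k f U (n + 1)))
        (Functor.whiskerLeft (meetingFunctor U) (edgeTransformation k f n hU)))
    exact e

end ContinuousExtension

/-! ### The Leray cosheaf in terms of the cover -/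

section Cover

open SingularChains

set_option linter.unusedSectionVars false

variable {k : Type u} [Field k] {X : Type u} [TopologicalSpace X] {Y : Type v}
  [TopologicalSpace Y] {f : C(X, Y)} {ι : Type} [LinearOrder ι] [Fintype ι] {U : ι → Opens Y}
  {n : ℕ}

variable (f U) in
/-- The preimages of the intersections of `V` with the cover elements and their pairwise
intersections. -/
def coverGraph (V : Opens Y) : GraphOfSets ι X :=
  intersectionGraph fun i => f ⁻¹' (U i ⊓ V : Opens Y)

lemma coverGraph_mono : Monotone (coverGraph (X := X) f U) := by
  intro V W h
  have h' : ∀ i, f ⁻¹' (U i ⊓ V : Opens Y) ⊆ f ⁻¹' (U i ⊓ W : Opens Y) := fun i =>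
    Set.preimage_mono (inf_le_inf_left (U i) h)
  refine ⟨h', fun i j => ?_⟩
  change (if i < j then _ else ∅ : Set X) ⊆ if i < j then _ else ∅
  split_ifs
  · exact Set.inter_subset_inter (h' i) (h' j)
  · exact le_rfl

variable (f U) in
/-- `coverGraph` as a functor. -/
def coverGraphFunctor : Opens Y ⥤ GraphOfSets ι X := (coverGraph_mono (f := f) (U := U)).functor

lemma sum_mem_degree {m : ℕ} {V : Opens Y} {v : ι → SingularChains k X}
    (hv : ∀ i, v i ∈ degree k m ((coverGraph f U V).1 i)) : ∑ i, v i ∈ degree k m (f ⁻¹' V) :=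
  Submodule.sum_mem _ fun i _ => degree_mono k _ (Set.preimage_mono inf_le_right) (hv i)

lemma sum_mem_setCycles {V : Opens Y} {x : GraphChains k ι X}
    (hx : x ∈ graphCycles k n (coverGraph f U V)) : ∑ i, x.1 i ∈ setCycles k n (f ⁻¹' V) := by
  refine ⟨sum_mem_degree hx.1, ?_⟩
  change boundary k _ = 0
  rw [map_sum, Finset.sum_congr rfl fun i _ => hx.2.2.2 i, sum_edgeBoundary]

variable (k f U n) in
/-- The class of the sum of the chains at the vertices. -/
def sumClass (V : Opens Y) : graphCycles k n (coverGraph f U V) →ₗ[k] (leray k f n).obj V where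
  toFun x := lerayExt k f n V (∑ i, x.1.1 i)
  map_add' x y := by
    rw [← map_add, ← Finset.sum_add_distrib]
    rfl
  map_smul' a x := by
    rw [RingHom.id_apply, ← map_smul, Finset.smul_sum]
    rfl

variable (k f U n) in
/-- The map from the homology of the total complex to the homology of the preimage. -/
def coverMap (V : Opens Y) : GraphHomology k n (coverGraph f U V) →ₗ[k] (leray k f n).obj V :=
  Submodule.liftQ _ (sumClass k f U n V) (by
    rintro x ⟨w, g, hw, hg, h1, h2⟩
    refine (lerayExt_eq_zero_iff (sum_mem_setCycles x.2)).2 ⟨∑ i, w i, sum_mem_degree hw, ?_⟩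
    rw [map_sum, ← add_zero (∑ i, boundary k (w i)), ← sum_edgeBoundary g,
      ← Finset.sum_add_distrib]
    exact Finset.sum_congr rfl fun i _ => (h1 i).symm)

lemma coverMap_mk {V : Opens Y} (x : graphCycles k n (coverGraph f U V)) :
    coverMap k f U n V (GraphHomology.mk x) = lerayExt k f n V (∑ i, x.1.1 i) := rfl

lemma iUnion_preimage_inf (hc : Set.range f ⊆ ⋃ i, (U i : Set Y)) (V : Opens Y) :
    ⋃ i, f ⁻¹' (U i ⊓ V : Opens Y) = f ⁻¹' V := by
  ext x
  obtain ⟨i, hi⟩ := Set.mem_iUnion.1 (hc ⟨x, rfl⟩)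
  simp only [Set.mem_iUnion]
  exact ⟨fun ⟨_, h⟩ => h.2, fun h => ⟨i, hi, h⟩⟩

lemma preimage_inf_inter_eq_empty (hU : ∀ σ ∈ nerve U, σ.card ≤ 2) (V : Opens Y) (i j l : ι)
    (hij : i ≠ j) (hjl : j ≠ l) (hil : i ≠ l) :
    f ⁻¹' (U i ⊓ V : Opens Y) ∩ f ⁻¹' (U j ⊓ V : Opens Y) ∩ f ⁻¹' (U l ⊓ V : Opens Y) = ∅ := by
  refine Set.eq_empty_of_forall_notMem fun x hx => ?_
  have h : ({i, j, l} : Finset ι) ∈ nerve U := by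
    refine ⟨by simp, f x, ?_⟩
    change f x ∈ inter U {i, j, l}
    simp only [inter, Finset.inf_insert, Finset.inf_singleton]
    exact ⟨hx.1.1.1, hx.1.2.1, hx.2.1⟩
  have := hU _ h
  rw [Finset.card_eq_three.2 ⟨i, j, l, hij, hil, hjl, rfl⟩] at this
  omega

lemma isOpen_preimage_inf (V : Opens Y) (i : ι) : IsOpen (f ⁻¹' (U i ⊓ V : Opens Y)) :=
  (U i ⊓ V).isOpen.preimage f.continuous

variable (hc : Set.range f ⊆ ⋃ i, (U i : Set Y)) (hU : ∀ σ ∈ nerve U, σ.card ≤ 2)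

include hc hU

lemma coverMap_injective (V : Opens Y) : Function.Injective (coverMap k f U n V) := by
  rw [injective_iff_map_eq_zero]
  intro h hh
  obtain ⟨x, rfl⟩ := Submodule.mkQ_surjective _ h
  have hx := sum_mem_setCycles x.2
  obtain ⟨c, hc', hc''⟩ := (lerayExt_eq_zero_iff hx).1 hh
  refine GraphHomology.mk_eq_zero_iff.2 ?_
  rw [← iUnion_preimage_inf hc V] at hc'
  exact mem_graphBoundaries_of_sum_eq_boundary (preimage_inf_inter_eq_empty hU V)
    (isOpen_preimage_inf V) x.2 hc' hc''.symm

lemma coverMap_surjective (V : Opens Y) : Function.Surjective (coverMap k f U n V) := by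
  intro h
  have hz := lerayRep_mem h
  obtain ⟨x, hx, c, hc', h'⟩ := exists_sum_eq_sub_boundary
    (A := fun i => f ⁻¹' (U i ⊓ V : Opens Y)) (preimage_inf_inter_eq_empty hU V)
    (isOpen_preimage_inf V) ((iUnion_preimage_inf hc V).symm ▸ hz.1) hz.2
  rw [iUnion_preimage_inf hc V] at hc'
  refine ⟨GraphHomology.mk ⟨x, hx⟩, ?_⟩
  rw [coverMap_mk]
  change lerayExt k f n V (∑ i, x.1 i) = h
  rw [h', map_sub, lerayExt_boundary hc', sub_zero, lerayExt_lerayRep]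

variable (k n)

/-- The Leray cosheaf computes the homology of the total complexes of a cover. -/
def lerayIso : coverGraphFunctor f U ⋙ graphHomologyFunctor k n ≅ leray k f n :=
  NatIso.ofComponents
    (fun V => (LinearEquiv.ofBijective (coverMap k f U n V)
      ⟨coverMap_injective hc hU V, coverMap_surjective hc hU V⟩).toModuleIso) fun {V W} h => by
    ext x
    obtain ⟨x, rfl⟩ := Submodule.mkQ_surjective _ x
    exact (leray_map_lerayExt h (sum_mem_setCycles x.2)).symm

end Cover

end LerayCosheaf

end

noncomputable section

namespace LerayCosheaf

/-! ### Interleavings -/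

section Interleavings

variable {B : Type*} [Category B]

lemma conj_comp_eq {M M' N N' L L' : B} {a : M ⟶ M'} {a' : L' ⟶ L} {b : N ⟶ N'} {b' : N' ⟶ N}
    {φ : M' ⟶ N'} {ψ : N' ⟶ L'} {s : M ⟶ L} {t : M' ⟶ L'} (hb : b' ≫ b = 𝟙 N') (h : φ ≫ ψ = t)
    (hs : a ≫ t ≫ a' = s) : (a ≫ φ ≫ b') ≫ b ≫ ψ ≫ a' = s := by
  rw [← hs, ← h]
  simp only [Category.assoc]
  rw [reassoc_of% hb]

lemma IsInterleaved.of_iso {δ : ℝ≥0} {M M' N N' : ℝ≥0 ⥤ B} (h : IsInterleaved δ M' N')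
    (a : M ≅ M') (b : N ≅ N') : IsInterleaved δ M N := by
  obtain ⟨φ, ψ, h1, h2⟩ := h
  have key : ∀ {M M' : ℝ≥0 ⥤ B} (a : M ≅ M') {ε ε' : ℝ≥0} (g : ε ⟶ ε'),
      a.hom.app ε ≫ M'.map g ≫ a.inv.app ε' = M.map g := fun a _ _ g => by
    rw [a.inv.naturality, Iso.hom_inv_id_app_assoc]
  exact ⟨a.hom ≫ φ ≫ Functor.whiskerLeft (shift δ) b.inv,
    b.hom ≫ ψ ≫ Functor.whiskerLeft (shift δ) a.inv,
    fun ε => conj_comp_eq (b.inv_hom_id_app (ε + δ)) (h1 ε) (key a _),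
    fun ε => conj_comp_eq (a.inv_hom_id_app (ε + δ)) (h2 ε) (key b _)⟩

variable {Y : Type v} [MetricSpace Y]

lemma thicken_thicken_le (δ ε : ℝ≥0) (V : Opens Y) :
    thicken δ (thicken ε V) ≤ thicken (ε + δ) V := by
  refine sup_le (thicken_mono le_self_add le_rfl) ?_
  change Metric.thickening δ ((V : Set Y) ∪ Metric.thickening ε V) ⊆
    (V : Set Y) ∪ Metric.thickening (ε + δ : ℝ≥0) V
  rw [Metric.thickening_union]
  refine Set.subset_union_of_subset_right (Set.union_subset ?_ ?_) _
  · exact Metric.thickening_mono (by exact_mod_cast le_add_self) _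
  · refine (Metric.thickening_thickening_subset _ _ _).trans ?_
    rw [NNReal.coe_add, add_comm]

/-- Two functors to a preorder whose values are interleaved give interleaved cosheaves. -/
lemma isInterleaved_of_le {C : Type*} [Preorder C] (P Q : Opens Y ⥤ C) (T : C ⥤ B) {δ : ℝ≥0}
    (hPQ : ∀ V W, thicken δ V ≤ W → P.obj V ≤ Q.obj W)
    (hQP : ∀ V W, thicken δ V ≤ W → Q.obj V ≤ P.obj W) :
    IsInterleaved δ (parameterized (P ⋙ T)) (parameterized (Q ⋙ T)) := by
  -- The hypothesis is applied to V^ε and V^(ε+δ), using (V^ε)^δ ⊆ V^(ε+δ). Every square and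
  -- composite below is the image under `T` of a diagram in a preorder, hence commutes.
  let trans : ∀ (P Q : Opens Y ⥤ C), (∀ V W, thicken δ V ≤ W → P.obj V ≤ Q.obj W) →
      (parameterized (P ⋙ T) ⟶ shift δ ⋙ parameterized (Q ⋙ T)) := fun P Q h =>
    { app := fun ε =>
        { app := fun V => T.map (homOfLE (h _ _ (thicken_thicken_le δ ε V)))
          naturality := fun V W _ => by
            change T.map _ ≫ T.map _ = T.map _ ≫ T.map _
            rw [← T.map_comp, ← T.map_comp]
            rfl }
      naturality := fun ε ε' _ => by
        ext V
        change T.map _ ≫ T.map _ = T.map _ ≫ T.map _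
        rw [← T.map_comp, ← T.map_comp]
        rfl }
  refine ⟨trans P Q hPQ, trans Q P hQP, fun ε => ?_, fun ε => ?_⟩
  · ext V
    exact (T.map_comp _ _).symm
  · ext V
    exact (T.map_comp _ _).symm

/-- `parameterized` on isomorphisms. -/
def parameterizedIso {F G : Opens Y ⥤ B} (e : F ≅ G) : parameterized F ≅ parameterized G :=
  Functor.isoWhiskerLeft thickenFunctor ((Functor.whiskeringRight _ _ _).mapIso e)

set_option linter.unusedSectionVars false

variable {X : Type u} [TopologicalSpace X] {f : C(X, Y)} {ι : Type} [LinearOrder ι]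
  {U : ι → Opens Y}

/-- Two points of one cover element are at distance at most `res U`. The inequality with δ must be
strict because the thickening is open. -/
lemma mem_of_edist_le {δ : ℝ≥0} (hδ : res U < δ) {V W : Opens Y} (hVW : thicken δ V ≤ W) {i : ι}
    {x y : Y} (hx : x ∈ U i) (hy : y ∈ U i) (hyV : y ∈ V) : x ∈ W := by
  refine hVW (Or.inr ?_)
  change x ∈ Metric.thickening (δ : ℝ) (V : Set Y)
  have h : edist x y ≤ res U := le_iSup₂_of_le i x (le_iSup₂_of_le hx y (le_iSup_of_le hy le_rfl))
  rw [Metric.mem_thickening_iff]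
  refine ⟨y, hyV, ?_⟩
  have := h.trans_lt hδ
  rw [edist_dist, ENNReal.ofReal_lt_coe_iff dist_nonneg] at this
  exact this

lemma mem_of_mem_inter {s : Finset ι} {i : ι} (hi : i ∈ s) {y : Y} (hy : y ∈ inter U s) : y ∈ U i :=
  Finset.inf_le (f := U) hi hy

lemma mem_inter_pair {i j : ι} {y : Y} (hi : y ∈ U i) (hj : y ∈ U j) : y ∈ inter U {i, j} := by
  simp only [inter, Finset.inf_insert, Finset.inf_singleton]
  exact ⟨hi, hj⟩

lemma mem_inter_singleton {i : ι} {y : Y} (hi : y ∈ U i) : y ∈ inter U {i} := by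
  simp only [inter, Finset.inf_singleton]
  exact hi

/-- The image of a point over U_σ ∩ V itself witnesses that U_σ meets V; no thickening is needed in
this direction. -/
lemma coverGraph_le_preimageGraph (V : Opens Y) :
    coverGraph f U V ≤ preimageGraph f U (meeting U V) := by
  refine ⟨fun i x hx => ?_, fun i j x hx => ?_⟩
  · have h := mem_inter_singleton hx.1
    exact ⟨⟨by simp, f x, h, hx.2⟩, h⟩
  · change x ∈ (if i < j then f ⁻¹' (U i ⊓ V : Opens Y) ∩ f ⁻¹' (U j ⊓ V : Opens Y) else ∅) at hx
    split_ifs at hx with hij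
    · have h := mem_inter_pair hx.1.1 hx.2.1
      exact ⟨⟨hij, by simp, f x, h, hx.1.2⟩, h⟩
    · exact hx.elim

/-- If U_σ meets V in y, every point of U_σ shares a cover element with y and so lies in the
thickening of V. This is where the resolution enters. -/
lemma preimageGraph_le_coverGraph {δ : ℝ≥0} (hδ : res U < δ) {V W : Opens Y}
    (hVW : thicken δ V ≤ W) : preimageGraph f U (meeting U V) ≤ coverGraph f U W := by
  refine ⟨fun i x hx => ?_, fun i j x hx => ?_⟩
  · obtain ⟨⟨-, y, hy, hyV⟩, hxU⟩ := hx
    have hi : i ∈ ({i} : Finset ι) := by simp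
    exact ⟨mem_of_mem_inter hi hxU,
      mem_of_edist_le hδ hVW (mem_of_mem_inter hi hxU) (mem_of_mem_inter hi hy) hyV⟩
  · obtain ⟨⟨hij, -, y, hy, hyV⟩, hxU⟩ := hx
    have hi : i ∈ ({i, j} : Finset ι) := by simp
    have hj : j ∈ ({i, j} : Finset ι) := by simp
    have hW := mem_of_edist_le hδ hVW (mem_of_mem_inter hi hxU) (mem_of_mem_inter hi hy) hyV
    change x ∈ (if i < j then f ⁻¹' (U i ⊓ W : Opens Y) ∩ f ⁻¹' (U j ⊓ W : Opens Y) else ∅)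
    rw [if_pos hij]
    exact ⟨⟨mem_of_mem_inter hi hxU, hW⟩, ⟨mem_of_mem_inter hj hxU, hW⟩⟩

variable (k : Type u) [Field k]

lemma isInterleaved_of_res_lt (hU : IsFinite1DCover U f) {δ : ℝ≥0} (hδ : res U < δ) :
    IsInterleaved δ (parameterized (gradedContinuousExtension k U f))
      (parameterized (gradedLeray k f)) := by
  have := hU.finite
  have := Fintype.ofFinite ι
  let T : GraphOfSets ι X ⥤ GradedObject ℕ (ModuleCat.{u} k) :=
    Functor.pi' (graphHomologyFunctor k)
  have h : IsInterleaved δ (parameterized (meetingGraphFunctor f U ⋙ T))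
      (parameterized (coverGraphFunctor f U ⋙ T)) :=
    isInterleaved_of_le _ _ T (fun V W hVW => preimageGraph_le_coverGraph hδ hVW)
      fun V W hVW => (coverGraph_mono (le_sup_left.trans hVW)).trans (coverGraph_le_preimageGraph W)
  have a : gradedContinuousExtension k U f ≅ meetingGraphFunctor f U ⋙ T :=
    NatIso.pi' fun n => continuousExtensionIso k f hU.dim_le_one n
  have b : gradedLeray k f ≅ coverGraphFunctor f U ⋙ T :=
    NatIso.pi' fun n => (lerayIso k n hU.covers hU.dim_le_one).symm
  exact h.of_iso (parameterizedIso a) (parameterizedIso b)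

lemma precosheafDist_le_res (hU : IsFinite1DCover U f) :
    precosheafDist (gradedContinuousExtension k U f) (gradedLeray k f) ≤ res U := by
  -- Interleavings exist only for δ strictly above `res U`, which suffices for an infimum. For
  -- infinite resolution there is no such r and nothing to prove.
  refine le_of_forall_gt_imp_ge_of_dense fun r hr => ?_
  obtain ⟨δ, hδ, hδr⟩ := ENNReal.lt_iff_exists_nnreal_btwn.1 hr
  exact (iInf₂_le δ (isInterleaved_of_res_lt k hU hδ)).trans hδr.le

end Interleavings

end LerayCosheaf

end

theorem theorem1 {k : Type u} [Field k] {X : Type u} [TopologicalSpace X]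
    {Y : Type v} [MetricSpace Y] (f : C(X, Y)) :
    (∀ {ι : Type} [LinearOrder ι] (U : ι → Opens Y), LerayCosheaf.IsFinite1DCover U f →
      LerayCosheaf.precosheafDist (LerayCosheaf.gradedContinuousExtension k U f)
        (LerayCosheaf.gradedLeray k f) ≤ LerayCosheaf.res U) ∧
    (∀ {J : Type w} (l : Filter J) (ι : J → Type) [∀ j, LinearOrder (ι j)]
      (U : ∀ j, ι j → Opens Y), (∀ j, LerayCosheaf.IsFinite1DCover (U j) f) →
      Tendsto (fun j => LerayCosheaf.res (U j)) l (𝓝 0) →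
      Tendsto (fun j => LerayCosheaf.precosheafDist
        (LerayCosheaf.gradedContinuousExtension k (U j) f)
        (LerayCosheaf.gradedLeray k f)) l (𝓝 0)) := by
  have h : ∀ {ι : Type} [LinearOrder ι] (U : ι → Opens Y), LerayCosheaf.IsFinite1DCover U f →
      LerayCosheaf.precosheafDist (LerayCosheaf.gradedContinuousExtension k U f)
        (LerayCosheaf.gradedLeray k f) ≤ LerayCosheaf.res U := fun U hU =>
    LerayCosheaf.precosheafDist_le_res k hU
  exact ⟨h, fun l ι _ U hU hr => tendsto_of_tendsto_of_tendsto_of_le_of_le tendsto_const_nhds hr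
    (fun _ => zero_le) fun j => h (U j) (hU j)⟩
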